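/- Let $\Gamma\subset T^*\mathbb R^d=\mathbb R^{2d}$ be a nonempty compact set, with Minkowski dimension $$2\mu_0 = 2d-\sup\Big\{\gamma:\ \limsup_{\epsilon\to0^+}\epsilon^{-\gamma}\,\mathrm{vol}\{\rho\in\mathbb R^{2d}: d(\rho,\Gamma)<\epsilon\}<\infty\Big\},$$ where $d(\cdot,\Gamma)$ is the Euclidean distance; $\Gamma$ is said to be of pure dimension if $\limsup_{\epsilon\to0^+}\epsilon^{-2d+2\mu_0}\,\mathrm{vol}\{d(\cdot,\Gamma)<\epsilon\}<\infty$. For parameters $0<h\le\tilde h\le1$ put $m(\rho)=h/\tilde h+d(\rho,\Gamma)^2$, and let $q=q_{h,\tilde h}\in C^\infty(T^*\mathbb R^d;\mathbb R)$ be a family of symbols such that, with constants independent of $h,\tilde h$ and $\rho$, $$|\partial^\alpha q|\le C_\alpha(\tilde h/h)^{|\alpha|/2}\,m,\qquad m/C\le q\le C\,m,\qquad |\partial^\alpha q|\le C_\alpha\, q^{1-|\alpha|/2}\quad\text{for all }\alpha .$$ Let $Q=q^w(x,hD)$ be its semiclassical Weyl quantization, closed from $\mathcal S(\mathbb R^d)$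 in $L^2(\mathbb R^d)$, and let $K>0$. Then there is $\tilde h_0\in(0,1]$ such that for $0<h\le\tilde h\le\tilde h_0$ the operator $Q$ is self-adjoint, the spectral subspace $V=\mathbf 1_{Q\le Kh/\tilde h}L^2(\mathbb R^d)$ is finite dimensional, and for every $\mu>\mu_0$ there is a constant $C=C_\mu$, independent of $h$ and $\tilde h$, with $$\dim V\le C\,\tilde h^{-d}\Big(\frac{\tilde h}{h}\Big)^{\mu}\qquad\text{for all } 0<h\le\tilde h\le\tilde h_0 .$$ If $\Gamma$ is of pure dimension, the same holds with $\mu=\mu_0$. -/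

import Mathlib

open MeasureTheory Filter Topology
open scoped ENNReal SchwartzMap ContDiff

noncomputable section

/-- The base space `ℝ^d` with its Euclidean structure. -/
abbrev BaseSpace (d : ℕ) : Type := EuclideanSpace ℝ (Fin d)

/-- Phase space `T^*ℝ^d = ℝ^d × ℝ^d`, with the Euclidean norm and Lebesgue measure of `ℝ^{2d}`. -/
abbrev PhaseSpace (d : ℕ) : Type := WithLp 2 (BaseSpace d × BaseSpace d)

/-- The Hilbert space `L²(ℝ^d)`. -/
abbrev L2Space (d : ℕ) : Type := Lp ℂ 2 (volume : Measure (BaseSpace d))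

/-! ### Minkowski dimension -/

section Minkowski

variable {X : Type*} [NormedAddCommGroup X] [InnerProductSpace ℝ X] [MeasureSpace X]

/-- `limsup_{ε → 0+} ε^{-γ} vol {ρ : d(ρ, Γ) < ε}`, with values in `[0, ∞]`. -/
def tubeLimsup (Γ : Set X) (γ : ℝ) : ℝ≥0∞ :=
  limsup (fun ε : ℝ => ENNReal.ofReal (ε ^ (-γ)) * volume (Metric.thickening ε Γ)) (𝓝[>] 0)

/-- The (box, or Minkowski) dimension of a nonempty compact set: the dimension of the space minus
the supremum of all `γ` with `limsup_{ε → 0+} ε^{-γ} vol {ρ : d(ρ, Γ) < ε} < ∞`. -/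
def minkowskiDim (Γ : Set X) : ℝ :=
  (Module.finrank ℝ X : ℝ) - sSup {γ : ℝ | tubeLimsup Γ γ < ⊤}

/-- `Γ` is of pure dimension: the supremum in the Minkowski dimension is attained. -/
def IsPureDimensional (Γ : Set X) : Prop :=
  tubeLimsup Γ ((Module.finrank ℝ X : ℝ) - minkowskiDim Γ) < ⊤

end Minkowski

/-! ### Symbols depending on the two parameters `h` and `ht` (for `h̃`) -/

section Symbols

variable {d : ℕ}

/-- The weight `m(ρ) = h/h̃ + d(ρ, Γ)²`. -/
def distWeight (Γ : Set (PhaseSpace d)) (h ht : ℝ) (ρ : PhaseSpace d) : ℝ :=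
  h / ht + Metric.infDist ρ Γ ^ 2

/-- The symbol class `S̃_{1/2}(m)`: smooth, with
`|∂^α a| ≤ C_α (h̃/h)^{|α|/2} m` uniformly for `0 < h ≤ h̃ ≤ 1`. -/
def IsHalfSymbol (m a : ℝ → ℝ → PhaseSpace d → ℝ) : Prop :=
  (∀ h ht : ℝ, 0 < h → h ≤ ht → ht ≤ 1 → ContDiff ℝ ∞ (a h ht)) ∧
  ∀ n : ℕ, ∃ C : ℝ, ∀ h ht : ℝ, 0 < h → h ≤ ht → ht ≤ 1 → ∀ ρ : PhaseSpace d,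
    ‖iteratedFDeriv ℝ n (a h ht) ρ‖ ≤ C * (ht / h) ^ ((n : ℝ) / 2) * m h ht ρ

/-- Real symbols `q` in `S̃_{1/2}(m)`, for `m = h/h̃ + d(·, Γ)²`, with `q ∼ m` and
`∂^α q = O(q^{1 - |α|/2})`, uniformly for `0 < h ≤ h̃ ≤ 1`. -/
structure IsDistSymbol (Γ : Set (PhaseSpace d)) (q : ℝ → ℝ → PhaseSpace d → ℝ) : Prop where
  isHalfSymbol : IsHalfSymbol (distWeight Γ) q
  comparable : ∃ C : ℝ, 1 ≤ C ∧ ∀ h ht : ℝ, 0 < h → h ≤ ht → ht ≤ 1 → ∀ ρ : PhaseSpace d,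
    distWeight Γ h ht ρ / C ≤ q h ht ρ ∧ q h ht ρ ≤ C * distWeight Γ h ht ρ
  deriv_bound : ∀ n : ℕ, ∃ C : ℝ, ∀ h ht : ℝ, 0 < h → h ≤ ht → ht ≤ 1 → ∀ ρ : PhaseSpace d,
    ‖iteratedFDeriv ℝ n (q h ht) ρ‖ ≤ C * (q h ht ρ) ^ (1 - (n : ℝ) / 2)

end Symbols

/-! ### Weyl quantization -/

section Weyl

variable {d : ℕ}

/-- The semiclassical Weyl quantization
`(2πh)^{-d} ∫ (∫ a((x + y)/2, ξ) e^{i⟨x - y, ξ⟩/h} u(y) dy) dξ`.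
For a Schwartz function `u` and a symbol all of whose derivatives are `O(⟨ρ⟩^N)`, both successive
integrals converge absolutely. -/
def weylQuantization (h : ℝ) (a : PhaseSpace d → ℂ) (u : BaseSpace d → ℂ) (x : BaseSpace d) : ℂ :=
  (((2 * Real.pi * h) ^ d : ℝ) : ℂ)⁻¹ *
    ∫ ξ : BaseSpace d, ∫ y : BaseSpace d,
      a (WithLp.toLp 2 ((1 / 2 : ℝ) • (x + y), ξ)) *
        Complex.exp (Complex.I * ((inner ℝ (x - y) ξ / h : ℝ) : ℂ)) * u y

/-- `a^w(x, hD)` as an unbounded operator on `L²(ℝ^d)` with domain the Schwartz functions. -/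
def weylOnSchwartz (h : ℝ) (a : PhaseSpace d → ℂ) : L2Space d →ₗ.[ℂ] L2Space d :=
  (Submodule.span ℂ {p : L2Space d × L2Space d | ∃ φ : 𝓢(BaseSpace d, ℂ),
    p.1 = φ.toLp 2 volume ∧ ⇑p.2 =ᵐ[volume] weylQuantization h a φ}).toLinearPMap

/-- The operator `a^w(x, hD)` on `L²(ℝ^d)`: the closure from Schwartz functions. -/
def weylOperator (h : ℝ) (a : PhaseSpace d → ℂ) : L2Space d →ₗ.[ℂ] L2Space d :=
  (weylOnSchwartz h a).closure

end Weyl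

/-! ### Spectral projections -/

/-- A projection-valued measure on the Borel sets of `ℝ`, with values in the orthogonal projections
of a Hilbert space. (The values on non-measurable sets carry no meaning.) -/
structure ProjectionValuedMeasure (H : Type*) [NormedAddCommGroup H] [InnerProductSpace ℂ H]
    [CompleteSpace H] where
  proj : Set ℝ → H →L[ℂ] H
  isStarProjection : ∀ S : Set ℝ, MeasurableSet S → IsStarProjection (proj S)
  proj_univ : proj Set.univ = 1
  hasSum_iUnion : ∀ S : ℕ → Set ℝ, (∀ i, MeasurableSet (S i)) →
    Pairwise (Function.onFun Disjoint S) → ∀ u : H, HasSum (fun i => proj (S i) u) (proj (⋃ i, S i) u)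

namespace ProjectionValuedMeasure

variable {H : Type*} [NormedAddCommGroup H] [InnerProductSpace ℂ H] [CompleteSpace H]

theorem re_inner_nonneg (P : ProjectionValuedMeasure H) (u : H) {S : Set ℝ}
    (hS : MeasurableSet S) : 0 ≤ (inner ℂ u (P.proj S u)).re := by
  have h := P.isStarProjection S hS
  have h1 : P.proj S u = P.proj S (P.proj S u) := by
    have := congrArg (fun T : H →L[ℂ] H => T u) h.isIdempotentElem.eq
    simpa using this.symm
  have h2 : ContinuousLinearMap.adjoint (P.proj S) = P.proj S := h.isSelfAdjoint
  rw [h1, ← ContinuousLinearMap.adjoint_inner_left, h2]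
  exact inner_self_nonneg (𝕜 := ℂ)

theorem proj_empty (P : ProjectionValuedMeasure H) (u : H) : P.proj ∅ u = 0 := by
  have h := P.hasSum_iUnion (fun _ => ∅) (fun _ => MeasurableSet.empty)
    (fun _ _ _ => by simp [Function.onFun]) u
  have h2 := h.summable.tendsto_atTop_zero
  exact (tendsto_const_nhds_iff.mp h2)

/-- The scalar spectral measure `S ↦ ⟨u, P(S) u⟩ = ‖P(S) u‖²`. -/
def scalarMeasure (P : ProjectionValuedMeasure H) (u : H) : Measure ℝ :=
  Measure.ofMeasurable (fun S _ => ENNReal.ofReal (inner ℂ u (P.proj S u)).re)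
    (by simp [P.proj_empty])
    (by
      intro S hS hd
      have h := P.hasSum_iUnion S hS hd u
      have h2 : HasSum (fun i => (inner ℂ u (P.proj (S i) u)).re)
          (inner ℂ u (P.proj (⋃ i, S i) u)).re :=
        Complex.reCLM.hasSum ((innerSL ℂ u).hasSum h)
      rw [← h2.tsum_eq]
      exact ENNReal.ofReal_tsum_of_nonneg (fun i => P.re_inner_nonneg u (hS i)) h2.summable)

/-- `P` is the spectral measure of the unbounded operator `Q`, that is `Q = ∫ t dP(t)`:
the domain of `Q` is `{u : ∫ t² d⟨u, P u⟩ < ∞}`, and `⟨u, Q u⟩ = ∫ t d⟨u, P u⟩` there (by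
polarization, this determines `Q u`). -/
def IsSpectralMeasureOf (P : ProjectionValuedMeasure H) (Q : H →ₗ.[ℂ] H) : Prop :=
  (∀ u : H, u ∈ Q.domain ↔ ∫⁻ t : ℝ, ENNReal.ofReal (t ^ 2) ∂(P.scalarMeasure u) < ⊤) ∧
  ∀ u : Q.domain, inner ℂ (u : H) (Q u) = ((∫ t : ℝ, t ∂(P.scalarMeasure (u : H)) : ℝ) : ℂ)

/-- The spectral subspace `1_{Q ≤ c} H` of the operator with spectral measure `P`. -/
def lowSubspace (P : ProjectionValuedMeasure H) (c : ℝ) : Submodule ℂ H :=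
  (P.proj (Set.Iic c)).range

end ProjectionValuedMeasure

end

open scoped FourierTransform

noncomputable section

/-! ### Polynomial weights -/

section Weights

variable {V : Type*} [NormedAddCommGroup V]

/-! The mechanism is a phase space localisation by coherent states. Put `s = √(2πh)`. The Gaussian
coherent states `ψ_z`, dilated by `s`, form a continuous Parseval frame of `L²(ℝ^d)`: `∫ |⟨ψ_z, u⟩|²
dz = ‖u‖²` (`isParsevalFrame_stateVec`). In this representation the Weyl operator is almost
multiplication by the rescaled symbol `q_s(z) = q(s z)`. More precisely `Q = T + R` on Schwartz
functions, where `T = ∫ q_s(z) |ψ_z⟩⟨ψ_z| dz` is the Toeplitz operator and `R` is bounded.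

The matrix elements of `Q` and `T` between `ψ_z` and `ψ_w` both test `q_s` against a Gaussian
centred at `(z + w)/2`, and they coincide when the symbol is affine. Only the second order Taylor
remainder at the midpoint survives (`remainderKernel_eq`), so the kernel of `R` is bounded by
derivatives of `q_s` of orders `2, …, 2d + 2` times an integrable function of `z - w`
(`exists_norm_remainderKernel_le`), and the Schur test applies. As `∂^k q = O(q^{1 - k/2})` and `q ≥
h/C`, each derivative of `q_s` of order at least two is `O(h)`
(`IsDistSymbol.exists_norm_iteratedFDeriv_le`). Hence `‖R‖ = O(h)`, which is at most a constant
times `h/h̃`.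

Counting: on the spectral subspace the form of `Q` is at most `K h/h̃`, so a unit vector `u` there
satisfies `∫ q_s |⟨ψ_z, u⟩|² dz ≤ k` with `k = O(h/h̃)`. By Chebyshev at least half of the mass of
`⟨ψ_z, u⟩` lies in `{q_s ≤ 2k}`. Summing over an orthonormal family and using Bessel's inequality
for each `ψ_z`, its cardinality is at most `2 vol {q_s ≤ 2k}` (`IsParsevalFrame.card_le_volume`).
This set is a rescaled subset of a tube of radius `O(√(h/h̃))` around `Γ`, of volume `O(h^{-d}
(h/h̃)^{γ/2})` for every admissible exponent `γ`. Taking `γ ≥ 2d - 2μ` gives the bound.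

Self-adjointness and discreteness use the same frame. If `v` is orthogonal to the range of `Q + σ²`
on Schwartz functions, testing on `ψ_z` gives an integral equation for `⟨ψ_z, v⟩` whose kernel
`(q_s(w) - q_s(z)) ⟨ψ_z, ψ_w⟩ / (q_s(z) + σ²)` is small in the Schur norm for large `σ`, since `q_s`
varies slowly: `|∇q_s| = O(√q_s)` for fixed parameters. So `v = 0`, and
`LinearPMap.exists_resolvent` yields self-adjointness and a bounded resolvent. As `q_s → ∞` at
infinity, the resolvent is a norm limit of compact operators, and an eigenbasis provides the
spectral measure. -/

theorem one_add_norm_add_le (x y : V) : 1 + ‖x + y‖ ≤ (1 + ‖x‖) * (1 + ‖y‖) := by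
  nlinarith [norm_add_le x y, norm_nonneg x, norm_nonneg y]

theorem one_add_norm_le_sub_mul (x y : V) : 1 + ‖x‖ ≤ (1 + ‖x - y‖) * (1 + ‖y‖) := by
  simpa using one_add_norm_add_le (x - y) y

/-- The weight `(1 + ‖x‖)^{-N}`. -/
def polyDecay (N : ℕ) (x : V) : ℝ := ((1 + ‖x‖) ^ N)⁻¹

theorem polyDecay_pos (N : ℕ) (x : V) : 0 < polyDecay N x := by
  unfold polyDecay; positivity

theorem polyDecay_nonneg (N : ℕ) (x : V) : 0 ≤ polyDecay N x := (polyDecay_pos N x).le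

theorem polyDecay_le_one (N : ℕ) (x : V) : polyDecay N x ≤ 1 := by
  unfold polyDecay
  exact inv_le_one_of_one_le₀ (one_le_pow₀ (by linarith [norm_nonneg x]))

theorem polyDecay_add (N M : ℕ) (x : V) :
    polyDecay (N + M) x = polyDecay N x * polyDecay M x := by
  simp [polyDecay, pow_add, mul_comm]

theorem pow_mul_polyDecay (N : ℕ) (x : V) : (1 + ‖x‖) ^ N * polyDecay N x = 1 := by
  unfold polyDecay
  exact mul_inv_cancel₀ (by positivity)

theorem pow_mul_polyDecay_add (M N : ℕ) (x : V) :
    (1 + ‖x‖) ^ M * polyDecay (M + N) x = polyDecay N x := by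
  rw [polyDecay_add, ← mul_assoc, pow_mul_polyDecay, one_mul]

/-- Peetre's inequality: the weight can be recentred at the price of a power of the shift. -/
theorem polyDecay_sub_le (N : ℕ) (x y : V) :
    polyDecay N (x - y) ≤ polyDecay N x * (1 + ‖y‖) ^ N := by
  unfold polyDecay
  rw [inv_le_iff_one_le_mul₀ (by positivity), mul_assoc, ← mul_pow, ← div_eq_inv_mul,
    one_le_div (by positivity)]
  · gcongr
    rw [mul_comm]
    exact one_add_norm_le_sub_mul x y

theorem polyDecay_neg (N : ℕ) (x : V) : polyDecay N (-x) = polyDecay N x := by simp [polyDecay]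

variable [NormedSpace ℝ V] [FiniteDimensional ℝ V] [MeasurableSpace V] [BorelSpace V]

theorem integrable_polyDecay {N : ℕ} (hN : Module.finrank ℝ V < N) (μ : Measure V)
    [μ.IsAddHaarMeasure] : Integrable (polyDecay N : V → ℝ) μ := by
  have h := integrable_one_add_norm (E := V) (μ := μ) (r := N) (by exact_mod_cast hN)
  refine h.congr (Eventually.of_forall fun x => ?_)
  simp only [polyDecay]
  rw [Real.rpow_neg (by positivity), Real.rpow_natCast]

end Weights

/-! ### Schwartz functions: decay, Gaussians, Fourier transforms of products -/

section SchwartzFacts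

theorem SchwartzMap.exists_le_polyDecay {V F : Type*} [NormedAddCommGroup V] [NormedSpace ℝ V]
    [NormedAddCommGroup F] [NormedSpace ℝ F] (u : 𝓢(V, F)) (N n : ℕ) :
    ∃ C, 0 ≤ C ∧ ∀ k ≤ n, ∀ x, ‖iteratedFDeriv ℝ k u x‖ ≤ C * polyDecay N x := by
  refine ⟨2 ^ N * (Finset.Iic (N, n)).sup (fun m => SchwartzMap.seminorm ℝ m.1 m.2) u,
    by positivity, fun k hk x => ?_⟩
  have h := SchwartzMap.one_add_le_sup_seminorm_apply (𝕜 := ℝ) (m := (N, n)) (k := N) (n := k)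
    le_rfl hk u x
  unfold polyDecay
  rwa [← div_eq_mul_inv, le_div_iff₀ (by positivity), mul_comm]

theorem SchwartzMap.exists_norm_le_polyDecay {V F : Type*} [NormedAddCommGroup V] [NormedSpace ℝ V]
    [NormedAddCommGroup F] [NormedSpace ℝ F] (u : 𝓢(V, F)) (N : ℕ) :
    ∃ C, 0 ≤ C ∧ ∀ x, ‖u x‖ ≤ C * polyDecay N x := by
  obtain ⟨C, hC, h⟩ := u.exists_le_polyDecay N 0
  exact ⟨C, hC, fun x => by simpa using h 0 le_rfl x⟩

variable {V : Type*} [NormedAddCommGroup V] [InnerProductSpace ℝ V]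

/-- The Gaussian `e^{-b|x|²}` as a Schwartz function. -/
def gaussianSchwartzReal (b : ℝ) (hb : 0 < b) : 𝓢(V, ℝ) where
  toFun x := Real.exp (-b * ‖x‖ ^ 2)
  smooth' := by
    have : ContDiff ℝ ∞ (fun x : V => ‖x‖ ^ 2) := contDiff_norm_sq ℝ
    exact Real.contDiff_exp.comp (contDiff_const.mul this)
  decay' := by
    intro k n
    have hf : Function.HasTemperateGrowth (fun x : V => -b * ‖x‖ ^ 2) :=
      (Function.HasTemperateGrowth.const (-b)).mul (Function.hasTemperateGrowth_norm_sq V)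
    obtain ⟨l, C, hC, hb'⟩ := hf.norm_iteratedFDeriv_le_uniform n
    have hkey : ∀ x : V, ‖iteratedFDeriv ℝ n (fun x : V => Real.exp (-b * ‖x‖ ^ 2)) x‖ ≤
        n.factorial * Real.exp (-b * ‖x‖ ^ 2) * ((1 + C) * (1 + ‖x‖) ^ l) ^ n := by
      intro x
      -- The composition estimate wants the `i`-th derivative of the inner function bounded by the
      -- `i`-th power of one number. Since this number is at least one, a bound by the number itself
      -- suffices.
      have h1 : (1 : ℝ) ≤ (1 + C) * (1 + ‖x‖) ^ l :=
        one_le_mul_of_one_le_of_one_le (by linarith)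
          (one_le_pow₀ (by linarith [norm_nonneg x]))
      refine norm_iteratedFDeriv_comp_le (g := Real.exp) (N := ∞) Real.contDiff_exp hf.1
        (by exact_mod_cast le_top) x (fun i _ => ?_) (fun i hi1 hi => ?_)
      · rw [norm_iteratedFDeriv_eq_norm_iteratedDeriv, iteratedDeriv_eq_iterate,
          Real.iter_deriv_exp]
        simp
      · refine (hb' i hi x).trans (le_trans ?_ (le_self_pow₀ h1 (by omega)))
        gcongr
        linarith
    have htend : Tendsto (fun t : ℝ => (1 + t) ^ (k + l * n) * Real.exp (-b * t ^ 2)) atTop (𝓝 0) := by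
      have h0 := (Real.tendsto_pow_mul_exp_neg_atTop_nhds_zero (k + l * n)).const_mul
        ((2 / b + 2) ^ (k + l * n) * Real.exp b)
      rw [mul_zero] at h0
      refine squeeze_zero' ?_ ?_ h0
      · filter_upwards [eventually_ge_atTop 0] with t ht using by positivity
      · filter_upwards [eventually_ge_atTop (1 + 2 / b)] with t ht
        have hbp : 0 < 2 / b := by positivity
        have ht0 : 1 ≤ t := by linarith
        have h2 : Real.exp (-b * t ^ 2) ≤ Real.exp b * Real.exp (-t) := by
          rw [← Real.exp_add]
          gcongr
          have : 1 ≤ b * t := by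
            have : b * (2 / b) ≤ b * t := by gcongr; linarith
            rw [mul_div_cancel₀ _ hb.ne'] at this
            linarith
          nlinarith
        calc (1 + t) ^ (k + l * n) * Real.exp (-b * t ^ 2)
            ≤ ((2 / b + 2) * t) ^ (k + l * n) * (Real.exp b * Real.exp (-t)) := by
              gcongr
              nlinarith
          _ = _ := by rw [mul_pow]; ring
    obtain ⟨T, hT⟩ := (htend.eventually (gt_mem_nhds one_pos)).exists_forall_of_atTop
    have hbd : ∃ B, 0 ≤ B ∧ ∀ t : ℝ, 0 ≤ t → (1 + t) ^ (k + l * n) * Real.exp (-b * t ^ 2) ≤ B := by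
      refine ⟨max 1 ((1 + |T|) ^ (k + l * n)), by positivity, fun t ht => ?_⟩
      rcases le_total T t with h | h
      · exact (hT t h).le.trans (le_max_left _ _)
      · refine le_trans ?_ (le_max_right _ _)
        have h1 : Real.exp (-b * t ^ 2) ≤ 1 := Real.exp_le_one_iff.2 (by nlinarith [sq_nonneg t])
        calc _ ≤ (1 + t) ^ (k + l * n) * 1 := by gcongr
          _ ≤ _ := by
            rw [mul_one]
            gcongr
            exact h.trans (le_abs_self T)
    obtain ⟨B, hB0, hB⟩ := hbd
    refine ⟨n.factorial * (1 + C) ^ n * B, fun x => ?_⟩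
    calc ‖x‖ ^ k * ‖iteratedFDeriv ℝ n (fun x : V => Real.exp (-b * ‖x‖ ^ 2)) x‖
        ≤ (1 + ‖x‖) ^ k * (n.factorial * Real.exp (-b * ‖x‖ ^ 2) * ((1 + C) * (1 + ‖x‖) ^ l) ^ n) := by
          gcongr
          · linarith
          · exact hkey x
      _ = n.factorial * (1 + C) ^ n * ((1 + ‖x‖) ^ (k + l * n) * Real.exp (-b * ‖x‖ ^ 2)) := by
          rw [mul_pow, ← pow_mul, pow_add]; ring
      _ ≤ _ := by
          gcongr
          exact hB _ (norm_nonneg x)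

/-- The Gaussian `e^{-b|x|²}` as a complex valued Schwartz function. -/
def gaussianSchwartz (b : ℝ) (hb : 0 < b) : 𝓢(V, ℂ) :=
  (gaussianSchwartzReal b hb).postcompCLM Complex.ofRealCLM

@[simp]
theorem gaussianSchwartz_apply (b : ℝ) (hb : 0 < b) (x : V) :
    gaussianSchwartz b hb x = (Real.exp (-b * ‖x‖ ^ 2) : ℂ) := by
  change ((Real.exp (-b * ‖x‖ ^ 2) : ℝ) : ℂ) = _
  simp

theorem exists_exp_le_polyDecay (b : ℝ) (hb : 0 < b) (N : ℕ) :
    ∃ C, 0 ≤ C ∧ ∀ x : V, Real.exp (-b * ‖x‖ ^ 2) ≤ C * polyDecay N x := by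
  obtain ⟨C, hC, h⟩ := (gaussianSchwartzReal (V := V) b hb).exists_norm_le_polyDecay N
  refine ⟨C, hC, fun x => ?_⟩
  have := h x
  change ‖Real.exp (-b * ‖x‖ ^ 2)‖ ≤ _ at this
  rwa [Real.norm_of_nonneg (by positivity)] at this

/-- The `n`-th derivative of `t ↦ e^{it}` is `i^n e^{it}`, of modulus one, and temperate growth is
stable under composition with the linear phase. -/
theorem hasTemperateGrowth_cexp_inner (ξ : V) :
    Function.HasTemperateGrowth
      (fun y : V => Complex.exp (((2 * Real.pi * inner ℝ ξ y : ℝ) : ℂ) * Complex.I)) := by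
  have h1 : Function.HasTemperateGrowth (fun t : ℝ => Complex.exp ((t : ℂ) * Complex.I)) := by
    refine ⟨?_, fun n => ⟨0, 1, fun t => ?_⟩⟩
    · exact (Complex.contDiff_exp (𝕜 := ℝ)).comp (Complex.ofRealCLM.contDiff.mul contDiff_const)
    · have h : iteratedDeriv n (fun t : ℝ => Complex.exp ((t : ℂ) * Complex.I)) =
          fun t : ℝ => Complex.I ^ n * Complex.exp ((t : ℂ) * Complex.I) := by
        induction n with
        | zero => simp
        | succ n ih =>
          rw [iteratedDeriv_succ, ih]
          funext t
          have : HasDerivAt (fun t : ℝ => Complex.exp ((t : ℂ) * Complex.I))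
              (Complex.exp ((t : ℂ) * Complex.I) * (1 * Complex.I)) t :=
            ((Complex.ofRealCLM.hasDerivAt (x := t)).mul_const Complex.I).cexp
          rw [(this.const_mul (Complex.I ^ n)).deriv]
          ring
      rw [norm_iteratedFDeriv_eq_norm_iteratedDeriv, h]
      simp [Complex.norm_exp_ofReal_mul_I]
  have h2 : Function.HasTemperateGrowth (fun y : V => 2 * Real.pi * inner ℝ ξ y) :=
    (Function.HasTemperateGrowth.const (2 * Real.pi)).mul (Function.hasTemperateGrowth_inner_right ξ)
  exact h1.comp h2

variable [FiniteDimensional ℝ V] [MeasurableSpace V] [BorelSpace V]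

/-- The Fourier transform of `f u`, with `u` Schwartz and the derivatives of `f` polynomially
bounded, is rapidly decreasing, with constants depending on the bounds for `f` only. -/
theorem exists_fourier_mul_schwartz_le (u : 𝓢(V, ℂ)) (N M : ℕ) :
    ∃ C, 0 ≤ C ∧ ∀ (f : V → ℂ) (A : ℝ), 0 ≤ A → ContDiff ℝ ∞ f →
      (∀ k ≤ N, ∀ y, ‖iteratedFDeriv ℝ k f y‖ ≤ A * (1 + ‖y‖) ^ M) →
      ∀ ξ, ‖𝓕 (fun y => f y * u y) ξ‖ ≤ C * A * polyDecay N ξ := by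
  -- Of the decay of `u`, the power `M` pays for the growth of `f`, and one more than the dimension
  -- is left for integrability.
  obtain ⟨C₀, hC₀, hu⟩ := u.exists_le_polyDecay (M + (Module.finrank ℝ V + 1)) N
  set I₀ := ∫ y : V, polyDecay (Module.finrank ℝ V + 1) y with hI₀
  have hI₀' : 0 ≤ I₀ := integral_nonneg fun y => polyDecay_nonneg _ y
  have hint : Integrable (polyDecay (Module.finrank ℝ V + 1) : V → ℝ) :=
    integrable_polyDecay (by omega) _
  refine ⟨2 ^ N * (1 + 2 ^ N * (N + 1)) * (2 ^ N * C₀ * I₀), by positivity,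
    fun f A hA hf hfb ξ => ?_⟩
  have hprod : ContDiff ℝ ∞ (fun y => f y * u y) := hf.mul u.smooth'
  have hD : ∀ n ≤ N, ∀ y, ‖iteratedFDeriv ℝ n (fun y => f y * u y) y‖ ≤
      2 ^ N * A * C₀ * polyDecay (Module.finrank ℝ V + 1) y := by
    intro n hn y
    refine (norm_iteratedFDeriv_mul_le hf u.smooth' y (by exact_mod_cast le_top)).trans ?_
    calc _ ≤ ∑ i ∈ Finset.range (n + 1), (n.choose i : ℝ) *
          (A * C₀ * polyDecay (Module.finrank ℝ V + 1) y) := by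
          refine Finset.sum_le_sum fun i hi => ?_
          have hi' : i ≤ n := by simpa [Nat.lt_succ_iff] using hi
          rw [mul_assoc]
          refine mul_le_mul_of_nonneg_left ?_ (by positivity)
          calc _ ≤ (A * (1 + ‖y‖) ^ M) * (C₀ * polyDecay (M + (Module.finrank ℝ V + 1)) y) := by
                gcongr
                · exact hfb i (hi'.trans hn) y
                · exact hu (n - i) (by omega) y
            _ = A * C₀ * ((1 + ‖y‖) ^ M * polyDecay (M + (Module.finrank ℝ V + 1)) y) := by ring
            _ = _ := by rw [pow_mul_polyDecay_add]
      _ = 2 ^ n * (A * C₀ * polyDecay (Module.finrank ℝ V + 1) y) := by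
          rw [← Finset.sum_mul]
          norm_cast
          rw [Nat.sum_range_choose]
      _ ≤ 2 ^ N * (A * C₀ * polyDecay (Module.finrank ℝ V + 1) y) := by
          have := polyDecay_nonneg (Module.finrank ℝ V + 1) y
          gcongr
          norm_num
      _ = _ := by ring
  have hInt : ∀ n ≤ N, Integrable (fun y => ‖iteratedFDeriv ℝ n (fun y => f y * u y) y‖) := by
    intro n hn
    refine (hint.const_mul (2 ^ N * A * C₀)).mono'
      (hprod.continuous_iteratedFDeriv (by exact_mod_cast le_top)).norm.aestronglyMeasurable
      (Eventually.of_forall fun y => ?_)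
    simpa using hD n hn y
  have hIle : ∀ n ≤ N, ∫ y, ‖iteratedFDeriv ℝ n (fun y => f y * u y) y‖ ≤ 2 ^ N * A * C₀ * I₀ := by
    intro n hn
    rw [hI₀, ← integral_const_mul]
    exact integral_mono (hInt n hn) (hint.const_mul _) (hD n hn)
  -- Integration by parts `n` times; only `n = 0` and `n = N` are used, as `(1 + ‖ξ‖)^N ≤ 2^N (1 +
  -- ‖ξ‖^N)`.
  have key : ∀ n ≤ N, ‖ξ‖ ^ n * ‖𝓕 (fun y => f y * u y) ξ‖ ≤
      2 ^ N * (N + 1) * (2 ^ N * A * C₀ * I₀) := by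
    intro n hn
    have h := Real.pow_mul_norm_iteratedFDeriv_fourier_le (f := fun y => f y * u y)
      (K := 0) (N := N) (hprod.of_le (by exact_mod_cast le_top))
      (fun k m hk hm => by
        have hk0 : k = 0 := by simpa using hk
        subst hk0
        simpa using hInt m (by exact_mod_cast hm)) (k := 0) (n := n) le_rfl
      (by exact_mod_cast hn) ξ
    simp only [norm_iteratedFDeriv_zero, pow_zero, one_mul, CharP.cast_eq_zero, mul_zero,
      zero_add, Finset.range_one, Finset.sum_product, Finset.sum_singleton] at h
    refine h.trans ?_
    calc _ ≤ (2 : ℝ) ^ n * ∑ m ∈ Finset.range (n + 1), 2 ^ N * A * C₀ * I₀ := by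
          gcongr with m hm
          exact hIle m (by have := Finset.mem_range.1 hm; omega)
      _ = 2 ^ n * (n + 1) * (2 ^ N * A * C₀ * I₀) := by simp; ring
      _ ≤ _ := by
          gcongr
          norm_num
  have h0 := key 0 (Nat.zero_le _)
  have hN := key N le_rfl
  rw [pow_zero, one_mul] at h0
  have hpow : (1 + ‖ξ‖) ^ N ≤ 2 ^ N * (1 + ‖ξ‖ ^ N) := by
    rcases le_total ‖ξ‖ 1 with h | h
    · calc (1 + ‖ξ‖) ^ N ≤ 2 ^ N := by gcongr; linarith
        _ ≤ _ := le_mul_of_one_le_right (by positivity) (by linarith [pow_nonneg (norm_nonneg ξ) N])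
    · calc (1 + ‖ξ‖) ^ N ≤ (2 * ‖ξ‖) ^ N := by gcongr; linarith
        _ ≤ _ := by rw [mul_pow]; gcongr; linarith
  have h0' : ‖𝓕 (fun y => f y * u y) ξ‖ ≤ 2 ^ N * A * C₀ * I₀ := by
    refine (VectorFourier.norm_fourierIntegral_le_integral_norm _ _ _ _ _).trans ?_
    simpa using hIle 0 (Nat.zero_le _)
  unfold polyDecay
  rw [← div_eq_mul_inv, le_div_iff₀ (by positivity), mul_comm]
  calc (1 + ‖ξ‖) ^ N * ‖𝓕 (fun y => f y * u y) ξ‖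
      ≤ 2 ^ N * (1 + ‖ξ‖ ^ N) * ‖𝓕 (fun y => f y * u y) ξ‖ := by gcongr
    _ = 2 ^ N * (‖𝓕 (fun y => f y * u y) ξ‖ + ‖ξ‖ ^ N * ‖𝓕 (fun y => f y * u y) ξ‖) := by ring
    _ ≤ 2 ^ N * (2 ^ N * A * C₀ * I₀ + 2 ^ N * (N + 1) * (2 ^ N * A * C₀ * I₀)) := by gcongr
    _ = _ := by ring

end SchwartzFacts

end

noncomputable section

/-! ### Phase space -/

section PhaseSpaceFacts

variable {d : ℕ}

theorem finrank_phaseSpace : Module.finrank ℝ (PhaseSpace d) = 2 * d := by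
  simp [(WithLp.linearEquiv 2 ℝ (BaseSpace d × BaseSpace d)).finrank_eq, two_mul]

theorem integrable_polyDecay_phase : Integrable (polyDecay (2 * d + 1) : PhaseSpace d → ℝ) :=
  integrable_polyDecay (by rw [finrank_phaseSpace]; omega) _

theorem integrable_polyDecay_base : Integrable (polyDecay (d + 1) : BaseSpace d → ℝ) :=
  integrable_polyDecay (by simp) _

theorem phase_norm_fst_le (w : PhaseSpace d) : ‖w.fst‖ ≤ ‖w‖ := by
  have := WithLp.prod_norm_sq_eq_of_L2 w
  exact abs_le_of_sq_le_sq' (by nlinarith [sq_nonneg ‖w.snd‖]) (norm_nonneg _) |>.2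

theorem phase_norm_snd_le (w : PhaseSpace d) : ‖w.snd‖ ≤ ‖w‖ := by
  have := WithLp.prod_norm_sq_eq_of_L2 w
  exact abs_le_of_sq_le_sq' (by nlinarith [sq_nonneg ‖w.fst‖]) (norm_nonneg _) |>.2

theorem norm_le_fst_add_snd (w : PhaseSpace d) : ‖w‖ ≤ ‖w.fst‖ + ‖w.snd‖ := by
  have := WithLp.prod_norm_sq_eq_of_L2 w
  exact abs_le_of_sq_le_sq' (by nlinarith [norm_nonneg w.fst, norm_nonneg w.snd])
    (by positivity) |>.2

theorem polyDecay_fst_mul_snd_le (N : ℕ) (w : PhaseSpace d) :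
    polyDecay N w.fst * polyDecay N w.snd ≤ polyDecay N w := by
  unfold polyDecay
  rw [← mul_inv, ← mul_pow]
  gcongr
  nlinarith [norm_le_fst_add_snd w, norm_nonneg w.fst, norm_nonneg w.snd]

@[fun_prop]
theorem continuous_phase_fst : Continuous (fun w : PhaseSpace d => w.fst) :=
  continuous_fst.comp (WithLp.prod_continuous_ofLp 2 _ _)

@[fun_prop]
theorem continuous_phase_snd : Continuous (fun w : PhaseSpace d => w.snd) :=
  continuous_snd.comp (WithLp.prod_continuous_ofLp 2 _ _)

@[fun_prop]
theorem continuous_phase_mk :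
    Continuous (fun p : BaseSpace d × BaseSpace d => (WithLp.toLp 2 p : PhaseSpace d)) :=
  WithLp.prod_continuous_toLp 2 _ _

theorem integrable_phase_iff {F : Type*} [NormedAddCommGroup F] {f : PhaseSpace d → F} :
    Integrable (fun p : BaseSpace d × BaseSpace d => f (WithLp.toLp 2 p))
      (volume.prod volume) ↔ Integrable f :=
  (WithLp.volume_preserving_toLp (BaseSpace d) (BaseSpace d)).integrable_comp_emb
    (MeasurableEquiv.toLp 2 _).measurableEmbedding

theorem integral_phase_eq {F : Type*} [NormedAddCommGroup F] [NormedSpace ℝ F]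
    (f : PhaseSpace d → F) :
    ∫ w, f w = ∫ p : BaseSpace d × BaseSpace d, f (WithLp.toLp 2 p) ∂(volume.prod volume) :=
  ((WithLp.volume_preserving_toLp (BaseSpace d) (BaseSpace d)).integral_comp
    (MeasurableEquiv.toLp 2 _).measurableEmbedding f).symm

theorem integral_phase {F : Type*} [NormedAddCommGroup F] [NormedSpace ℝ F]
    {f : PhaseSpace d → F} (hf : Integrable f) :
    ∫ w, f w = ∫ x : BaseSpace d, ∫ ξ : BaseSpace d, f (WithLp.toLp 2 (x, ξ)) := by
  rw [integral_phase_eq, integral_prod _ (integrable_phase_iff.2 hf)]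

theorem integral_phase_symm {F : Type*} [NormedAddCommGroup F] [NormedSpace ℝ F]
    {f : PhaseSpace d → F} (hf : Integrable f) :
    ∫ w, f w = ∫ ξ : BaseSpace d, ∫ x : BaseSpace d, f (WithLp.toLp 2 (x, ξ)) := by
  rw [integral_phase_eq, integral_prod_symm _ (integrable_phase_iff.2 hf)]

end PhaseSpaceFacts

/-! ### Coherent states, normalized for the frequency variable of `e^{2πi⟨x, ξ⟩}` -/

section CoherentStates

variable {d : ℕ}

/-- The normalized Gaussian window `2^{d/4} e^{-π|y|²}`. -/
def gaussWindow (y : BaseSpace d) : ℝ := (2 : ℝ) ^ ((d : ℝ) / 4) * Real.exp (-Real.pi * ‖y‖ ^ 2)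

/-- The plane wave `y ↦ e^{2πi⟨ξ, y⟩}`. -/
def planeWave (ξ y : BaseSpace d) : ℂ :=
  Complex.exp (((2 * Real.pi * inner ℝ ξ y : ℝ) : ℂ) * Complex.I)

/-- The coherent state at the point `w` of phase space. -/
def coherentState (w : PhaseSpace d) : 𝓢(BaseSpace d, ℂ) :=
  SchwartzMap.smulLeftCLM ℂ (planeWave w.snd)
    (SchwartzMap.compSubConstCLM ℂ w.fst
      ((((2 : ℝ) ^ ((d : ℝ) / 4) : ℝ) : ℂ) • gaussianSchwartz Real.pi Real.pi_pos))

theorem coherentState_apply (w : PhaseSpace d) (y : BaseSpace d) :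
    coherentState w y = gaussWindow (y - w.fst) * planeWave w.snd y := by
  have h : Function.HasTemperateGrowth (planeWave w.snd) := hasTemperateGrowth_cexp_inner w.snd
  rw [coherentState, SchwartzMap.smulLeftCLM_apply_apply h]
  simp [gaussWindow]
  ring

theorem norm_planeWave (ξ y : BaseSpace d) : ‖planeWave ξ y‖ = 1 :=
  Complex.norm_exp_ofReal_mul_I _

theorem conj_planeWave (ξ y : BaseSpace d) :
    starRingEnd ℂ (planeWave ξ y) = planeWave (-ξ) y := by
  rw [planeWave, planeWave, ← Complex.exp_conj, map_mul, Complex.conj_ofReal, Complex.conj_I]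
  simp

theorem Continuous.planeWave' {X : Type*} [TopologicalSpace X] {f g : X → BaseSpace d}
    (hf : Continuous f) (hg : Continuous g) : Continuous (fun x => planeWave (f x) (g x)) := by
  unfold planeWave
  fun_prop

theorem gaussWindow_pos (y : BaseSpace d) : 0 < gaussWindow y := by
  unfold gaussWindow; positivity

@[fun_prop]
theorem continuous_gaussWindow : Continuous (gaussWindow : BaseSpace d → ℝ) := by
  unfold gaussWindow; fun_prop

theorem gaussWindow_eq_schwartz (y : BaseSpace d) : (gaussWindow y : ℂ) =
    ((((2 : ℝ) ^ ((d : ℝ) / 4) : ℝ) : ℂ) •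
      (gaussianSchwartz Real.pi Real.pi_pos : 𝓢(BaseSpace d, ℂ))) y := by
  simp [gaussWindow]

/-- This normalisation is the purpose of the factor `2^{d/4}`; it makes the coherent state transform
an isometry, with an inversion formula free of constants. -/
theorem integral_gaussWindow_sq (a : BaseSpace d) : ∫ x, gaussWindow (a - x) ^ 2 = 1 := by
  rw [integral_sub_left_eq_self (fun x => gaussWindow x ^ 2) volume a]
  have h : ∀ x : BaseSpace d, gaussWindow x ^ 2 =
      (2 : ℝ) ^ ((d : ℝ) / 2) * Real.exp (-(2 * Real.pi) * ‖x‖ ^ 2) := by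
    intro x
    rw [gaussWindow, mul_pow, ← Real.exp_nat_mul, ← Real.rpow_natCast, ← Real.rpow_mul (by norm_num)]
    congr 2 <;> push_cast <;> ring
  simp_rw [h]
  rw [integral_const_mul, GaussianFourier.integral_rexp_neg_mul_sq_norm (by positivity)]
  have : Real.pi / (2 * Real.pi) = 2⁻¹ := by
    field_simp
  rw [this, finrank_euclideanSpace_fin, Real.inv_rpow (by norm_num), mul_inv_cancel₀ (by positivity)]

theorem exists_gaussWindow_le (N : ℕ) : ∃ C, 0 ≤ C ∧
    ∀ y : BaseSpace d, gaussWindow y ≤ C * polyDecay N y := by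
  obtain ⟨C, hC, h⟩ := exists_exp_le_polyDecay (V := BaseSpace d) Real.pi Real.pi_pos N
  refine ⟨(2 : ℝ) ^ ((d : ℝ) / 4) * C, by positivity, fun y => ?_⟩
  rw [gaussWindow, mul_assoc]
  gcongr
  exact h y

theorem norm_coherentState (w : PhaseSpace d) (y : BaseSpace d) :
    ‖coherentState w y‖ = gaussWindow (y - w.fst) := by
  rw [coherentState_apply, norm_mul, norm_planeWave, mul_one, Complex.norm_real,
    Real.norm_of_nonneg (gaussWindow_pos _).le]

theorem exists_norm_coherentState_le (N : ℕ) : ∃ C, 0 ≤ C ∧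
    ∀ (w : PhaseSpace d) (y : BaseSpace d),
      ‖coherentState w y‖ ≤ C * polyDecay N y * (1 + ‖w‖) ^ N := by
  obtain ⟨C, hC, h⟩ := exists_gaussWindow_le (d := d) N
  refine ⟨C, hC, fun w y => ?_⟩
  rw [norm_coherentState, mul_assoc]
  refine (h _).trans (mul_le_mul_of_nonneg_left ((polyDecay_sub_le N y w.fst).trans ?_) hC)
  have := phase_norm_fst_le w
  have := polyDecay_nonneg N y
  gcongr

theorem Continuous.coherentState' {X : Type*} [TopologicalSpace X] {f : X → PhaseSpace d}
    {g : X → BaseSpace d} (hf : Continuous f) (hg : Continuous g) :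
    Continuous (fun x => coherentState (f x) (g x)) := by
  simp_rw [coherentState_apply]
  exact (Complex.continuous_ofReal.comp (by fun_prop)).mul (Continuous.planeWave' (by fun_prop) hg)

/-- The coherent state transform `w ↦ ⟨φ_w, u⟩`. -/
def coherentTransform (u : BaseSpace d → ℂ) (w : PhaseSpace d) : ℂ :=
  ∫ y, starRingEnd ℂ (coherentState w y) * u y

/-- The transform is a short-time Fourier transform with Gaussian window. Decay in frequency and
inversion thereby reduce to facts about the Fourier transform. -/
theorem coherentTransform_eq_fourier (u : BaseSpace d → ℂ) (w : PhaseSpace d) :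
    coherentTransform u w = 𝓕 (fun y => (gaussWindow (y - w.fst) : ℂ) * u y) w.snd := by
  rw [coherentTransform, Real.fourier_eq']
  congr 1
  funext y
  rw [coherentState_apply, map_mul, Complex.conj_ofReal, conj_planeWave, planeWave, smul_eq_mul]
  simp only [inner_neg_left, real_inner_comm w.snd y]
  ring_nf

/-- Decay in the frequency comes from the smoothness of the windowed function. Decay in the position
comes from the window: its derivatives are small away from `w.fst`, and Peetre's inequality moves
this smallness into a factor depending on `w.fst` alone, at the price of growth in `y` that `u`
absorbs. -/
theorem coherentTransform_schwartz_decay (u : 𝓢(BaseSpace d, ℂ)) (N : ℕ) :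
    ∃ C, 0 ≤ C ∧ ∀ w, ‖coherentTransform u w‖ ≤ C * polyDecay N w := by
  obtain ⟨C₁, hC₁, h₁⟩ := ((((2 : ℝ) ^ ((d : ℝ) / 4) : ℝ) : ℂ) •
      (gaussianSchwartz Real.pi Real.pi_pos : 𝓢(BaseSpace d, ℂ))).exists_le_polyDecay N N
  obtain ⟨C₂, hC₂, h₂⟩ := exists_fourier_mul_schwartz_le u N N
  refine ⟨C₂ * C₁, by positivity, fun w => ?_⟩
  rw [coherentTransform_eq_fourier]
  simp_rw [gaussWindow_eq_schwartz]
  set G : 𝓢(BaseSpace d, ℂ) := ((((2 : ℝ) ^ ((d : ℝ) / 4) : ℝ) : ℂ) •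
      (gaussianSchwartz Real.pi Real.pi_pos : 𝓢(BaseSpace d, ℂ)))
  refine (h₂ (fun y => G (y - w.fst)) (C₁ * polyDecay N w.fst)
    (mul_nonneg hC₁ (polyDecay_nonneg _ _)) (G.smooth'.comp (contDiff_id.sub contDiff_const))
    (fun k hk y => ?_) w.snd).trans ?_
  · rw [iteratedFDeriv_comp_sub]
    refine (h₁ k hk _).trans ?_
    rw [mul_assoc, ← neg_sub, polyDecay_neg]
    gcongr
    exact polyDecay_sub_le N w.fst y
  · have := polyDecay_fst_mul_snd_le N w
    calc _ = C₂ * C₁ * (polyDecay N w.fst * polyDecay N w.snd) := by ring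
      _ ≤ _ := by gcongr

theorem continuous_coherentTransform (u : 𝓢(BaseSpace d, ℂ)) :
    Continuous (coherentTransform (u : BaseSpace d → ℂ)) := by
  unfold coherentTransform
  refine continuous_of_dominated (bound := fun y => (2 : ℝ) ^ ((d : ℝ) / 4) * ‖u y‖)
    (fun w => ?_) (fun w => Eventually.of_forall fun y => ?_)
    (u.integrable.norm.const_mul _) (Eventually.of_forall fun y => ?_)
  · exact ((Complex.continuous_conj.comp (coherentState w).continuous).mul
      u.continuous).aestronglyMeasurable
  · rw [norm_mul, RCLike.norm_conj, norm_coherentState, gaussWindow]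
    gcongr
    refine mul_le_of_le_one_right (by positivity) (Real.exp_le_one_iff.2 ?_)
    nlinarith [Real.pi_pos, sq_nonneg ‖y - w.fst‖]
  · exact (Complex.continuous_conj.comp (Continuous.coherentState' continuous_id
      continuous_const)).mul continuous_const

theorem integrable_coherentTransform_mul {u : 𝓢(BaseSpace d, ℂ)} {f : PhaseSpace d → ℂ}
    (hf : AEStronglyMeasurable f) {C : ℝ} {N : ℕ} (hfb : ∀ w, ‖f w‖ ≤ C * (1 + ‖w‖) ^ N) :
    Integrable (fun w => coherentTransform u w * f w) := by
  obtain ⟨C₁, hC₁, h₁⟩ := coherentTransform_schwartz_decay u (N + (2 * d + 1))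
  refine (integrable_polyDecay_phase.const_mul (C₁ * C)).mono'
    ((continuous_coherentTransform u).aestronglyMeasurable.mul hf) (Eventually.of_forall fun w => ?_)
  rw [norm_mul]
  calc _ ≤ (C₁ * polyDecay (N + (2 * d + 1)) w) * (C * (1 + ‖w‖) ^ N) := by
        gcongr
        · exact mul_nonneg hC₁ (polyDecay_nonneg _ _)
        · exact h₁ w
        · exact hfb w
    _ = C₁ * C * ((1 + ‖w‖) ^ N * polyDecay (N + (2 * d + 1)) w) := by ring
    _ = _ := by rw [pow_mul_polyDecay_add]

theorem integrable_weight_mul_coherentTransform (u : 𝓢(BaseSpace d, ℂ)) (N : ℕ) :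
    Integrable (fun w => (1 + ‖w‖) ^ N * ‖coherentTransform u w‖) := by
  have h := (integrable_coherentTransform_mul (u := u) (f := fun w => ((1 + ‖w‖) ^ N : ℝ))
    (C := 1) (N := N) (Complex.continuous_ofReal.comp (by fun_prop)).aestronglyMeasurable
    (fun w => by rw [Complex.norm_real, Real.norm_of_nonneg (by positivity), one_mul])).norm
  refine h.congr (Eventually.of_forall fun w => ?_)
  simp only [norm_mul, Complex.norm_real]
  rw [Real.norm_of_nonneg (by positivity), mul_comm]

/-- For a fixed position `x`, Fourier inversion in the frequency gives `gaussWindow (y - x) ^ 2 * u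
y`; integrating in `x` uses the normalisation of the window. -/
theorem coherentTransform_inversion (u : 𝓢(BaseSpace d, ℂ)) (y : BaseSpace d) :
    ∫ w, coherentTransform u w * coherentState w y = u y := by
  have hint : Integrable (fun w => coherentTransform u w * coherentState w y) := by
    obtain ⟨C, hC, h⟩ := exists_norm_coherentState_le (d := d) 0
    exact integrable_coherentTransform_mul (C := C) (N := 0)
      (Continuous.coherentState' continuous_id continuous_const).aestronglyMeasurable
      (fun w => by simpa [polyDecay] using h w y)
  rw [integral_phase hint]
  have hx : ∀ x : BaseSpace d, (∫ ξ : BaseSpace d, coherentTransform u (WithLp.toLp 2 (x, ξ)) *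
      coherentState (WithLp.toLp 2 (x, ξ)) y) = ((gaussWindow (y - x) ^ 2 : ℝ) : ℂ) * u y := by
    intro x
    let v : BaseSpace d → ℂ := fun y => (gaussWindow (y - x) : ℂ) * u y
    have hv : Continuous v := (Complex.continuous_ofReal.comp (by fun_prop)).mul u.continuous
    have hvi : Integrable v := by
      refine (u.integrable.norm.const_mul ((2 : ℝ) ^ ((d : ℝ) / 4))).mono' hv.aestronglyMeasurable
        (Eventually.of_forall fun y => ?_)
      rw [norm_mul, Complex.norm_real, Real.norm_of_nonneg (gaussWindow_pos _).le]
      gcongr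
      refine mul_le_of_le_one_right (by positivity) (Real.exp_le_one_iff.2 ?_)
      nlinarith [Real.pi_pos, sq_nonneg ‖y - x‖]
    have hFv : ∀ ξ, coherentTransform u (WithLp.toLp 2 (x, ξ)) = 𝓕 v ξ := fun ξ =>
      coherentTransform_eq_fourier u _
    have hFi : Integrable (𝓕 v) := by
      obtain ⟨C, hC, h⟩ := coherentTransform_schwartz_decay u (d + 1)
      refine (integrable_polyDecay_base.const_mul C).mono' ?_ (Eventually.of_forall fun ξ => ?_)
      · have : 𝓕 v = fun ξ => coherentTransform u (WithLp.toLp 2 (x, ξ)) := by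
          funext ξ; exact (hFv ξ).symm
        rw [this]
        exact ((continuous_coherentTransform u).comp (by fun_prop)).aestronglyMeasurable
      · rw [← hFv]
        refine (h _).trans (mul_le_mul_of_nonneg_left ?_ hC)
        unfold polyDecay
        gcongr
        exact phase_norm_snd_le (WithLp.toLp 2 (x, ξ))
    have hinv := congrFun (hv.fourierInv_fourier_eq hvi hFi) y
    rw [Real.fourierInv_eq'] at hinv
    calc _ = (gaussWindow (y - x) : ℂ) * ∫ ξ, Complex.exp (↑(2 * Real.pi * inner ℝ ξ y) * Complex.I)
            • 𝓕 v ξ := by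
          rw [← integral_const_mul]
          congr 1
          funext ξ
          rw [hFv, coherentState_apply]
          simp only [planeWave, smul_eq_mul, WithLp.toLp_fst, WithLp.toLp_snd, real_inner_comm]
          ring
      _ = _ := by
          rw [hinv]
          simp only [v]
          push_cast
          ring
  simp_rw [hx]
  rw [integral_mul_const, integral_complex_ofReal, integral_gaussWindow_sq]
  simp

/-- Superposition of coherent states: a polynomially bounded functional of a Schwartz function. -/
theorem integral_mul_schwartz_eq (u : 𝓢(BaseSpace d, ℂ)) {b : BaseSpace d → ℂ}
    (hb : AEStronglyMeasurable b) {C : ℝ} {M : ℕ} (hbb : ∀ y, ‖b y‖ ≤ C * (1 + ‖y‖) ^ M) :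
    ∫ y, b y * u y = ∫ w, coherentTransform u w * ∫ y, b y * coherentState w y := by
  have hC : 0 ≤ C := by
    have := (norm_nonneg _).trans (hbb 0)
    simpa using this
  obtain ⟨C₁, hC₁, h₁⟩ := exists_norm_coherentState_le (d := d) (M + (d + 1))
  -- The uniform bound on the coherent state costs a power of `1 + ‖w‖`, which the rapid decay of
  -- the transform of `u` absorbs.
  have hI : Integrable (Function.uncurry fun (y : BaseSpace d) (w : PhaseSpace d) =>
      b y * (coherentTransform u w * coherentState w y)) (volume.prod volume) := by
    refine (Integrable.mul_prod (integrable_polyDecay_base.const_mul (C * C₁))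
      (integrable_weight_mul_coherentTransform u (M + (d + 1)))).mono' ?_
      (Eventually.of_forall fun p => ?_)
    · exact hb.comp_fst.mul (((continuous_coherentTransform u).comp continuous_snd).mul
        (Continuous.coherentState' continuous_snd continuous_fst)).aestronglyMeasurable
    · simp only [Function.uncurry, norm_mul]
      calc _ ≤ (C * (1 + ‖p.1‖) ^ M) * (‖coherentTransform u p.2‖ *
            (C₁ * polyDecay (M + (d + 1)) p.1 * (1 + ‖p.2‖) ^ (M + (d + 1)))) := by
            gcongr
            · exact hbb _
            · exact h₁ _ _
        _ = C * C₁ * ((1 + ‖p.1‖) ^ M * polyDecay (M + (d + 1)) p.1) *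
            ((1 + ‖p.2‖) ^ (M + (d + 1)) * ‖coherentTransform u p.2‖) := by ring
        _ = _ := by rw [pow_mul_polyDecay_add]
  calc ∫ y, b y * u y = ∫ y, ∫ w, b y * (coherentTransform u w * coherentState w y) := by
        congr 1; funext y
        rw [integral_const_mul, coherentTransform_inversion]
    _ = ∫ w, ∫ y, b y * (coherentTransform u w * coherentState w y) := integral_integral_swap hI
    _ = _ := by
        congr 1; funext w
        rw [← integral_const_mul]
        congr 1; funext y
        ring

end CoherentStates

end

noncomputable section

/-! ### Symbols with derivatives of at most quadratic growth -/

section QuadraticGrowth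

/-- All derivatives of `q` have at most quadratic growth. -/
structure HasQuadraticGrowth {V : Type*} [NormedAddCommGroup V] [NormedSpace ℝ V] (q : V → ℝ) :
    Prop where
  contDiff : ContDiff ℝ ∞ q
  bound : ∀ N : ℕ, ∃ A, 0 ≤ A ∧ ∀ k ≤ N, ∀ x, ‖iteratedFDeriv ℝ k q x‖ ≤ A * (1 + ‖x‖) ^ 2

theorem HasQuadraticGrowth.norm_le {V : Type*} [NormedAddCommGroup V] [NormedSpace ℝ V] {q : V → ℝ}
    (hq : HasQuadraticGrowth q) : ∃ A, 0 ≤ A ∧ ∀ x, |q x| ≤ A * (1 + ‖x‖) ^ 2 := by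
  obtain ⟨A, hA, h⟩ := hq.bound 0
  exact ⟨A, hA, fun x => by simpa using h 0 le_rfl x⟩

theorem norm_iteratedFDeriv_comp_add_clm_le {V W F : Type*} [NormedAddCommGroup V]
    [NormedSpace ℝ V] [NormedAddCommGroup W] [NormedSpace ℝ W] [NormedAddCommGroup F]
    [NormedSpace ℝ F] {f : W → F} (hf : ContDiff ℝ ∞ f) (c : W) (L : V →L[ℝ] W) (hL : ‖L‖ ≤ 1)
    (k : ℕ) (y : V) :
    ‖iteratedFDeriv ℝ k (fun y => f (c + L y)) y‖ ≤ ‖iteratedFDeriv ℝ k f (c + L y)‖ := by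
  have hg : ContDiff ℝ ∞ (fun x => f (c + x)) := hf.comp (contDiff_const.add contDiff_id)
  have h := L.iteratedFDeriv_comp_right (f := fun x => f (c + x)) hg y (i := k)
    (by exact_mod_cast le_top)
  change ‖iteratedFDeriv ℝ k ((fun x => f (c + x)) ∘ L) y‖ ≤ _
  rw [h, iteratedFDeriv_comp_add_left]
  refine (ContinuousMultilinearMap.norm_compContinuousLinearMap_le _ _).trans ?_
  refine mul_le_of_le_one_right (norm_nonneg _) ?_
  simpa using pow_le_one₀ (norm_nonneg _) hL

theorem norm_iteratedFDeriv_ofReal {V : Type*} [NormedAddCommGroup V] [NormedSpace ℝ V]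
    {q : V → ℝ} (hq : ContDiff ℝ ∞ q) (k : ℕ) (x : V) :
    ‖iteratedFDeriv ℝ k (fun x => (q x : ℂ)) x‖ = ‖iteratedFDeriv ℝ k q x‖ :=
  Complex.ofRealLI.norm_iteratedFDeriv_comp_left hq.contDiffAt (by exact_mod_cast le_top)

end QuadraticGrowth

/-! ### The Weyl quantization at the fixed parameter `h = 1/(2π)`. -/

section WeylUnit

variable {d : ℕ}

theorem phase_ext {a b : PhaseSpace d} (h₁ : a.fst = b.fst) (h₂ : a.snd = b.snd) : a = b := by
  apply WithLp.ofLp_injective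
  exact Prod.ext h₁ h₂

/-- The point `((x + y)/2, ξ)` of phase space. -/
def midPoint (x y ξ : BaseSpace d) : PhaseSpace d := WithLp.toLp 2 ((1 / 2 : ℝ) • (x + y), ξ)

theorem one_add_norm_midPoint_le (x y ξ : BaseSpace d) :
    1 + ‖midPoint x y ξ‖ ≤ (1 + ‖x‖) * (1 + ‖y‖) * (1 + ‖ξ‖) := by
  have h1 := norm_le_fst_add_snd (midPoint x y ξ)
  have h2 : ‖(midPoint x y ξ).fst‖ ≤ ‖x‖ + ‖y‖ := by
    change ‖(1 / 2 : ℝ) • (x + y)‖ ≤ _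
    rw [norm_smul]
    norm_num
    linarith [norm_add_le x y, norm_nonneg x, norm_nonneg y]
  have h3 : (midPoint x y ξ).snd = ξ := rfl
  rw [h3] at h1
  have := norm_nonneg x
  have := norm_nonneg y
  have := norm_nonneg ξ
  have h4 : 1 + ‖x‖ + ‖y‖ ≤ (1 + ‖x‖) * (1 + ‖y‖) := by nlinarith
  have : 0 ≤ ‖x‖ * ‖y‖ := by positivity
  nlinarith

@[fun_prop]
theorem Continuous.midPoint' {X : Type*} [TopologicalSpace X] {f g k : X → BaseSpace d}
    (hf : Continuous f) (hg : Continuous g) (hk : Continuous k) :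
    Continuous (fun x => midPoint (f x) (g x) (k x)) := by
  unfold midPoint
  have h : Continuous (fun x => (1 / 2 : ℝ) • (f x + g x)) := by fun_prop
  exact continuous_phase_mk.comp (h.prodMk hk)

/-- The integrand of the Weyl quantization at `h = 1/(2π)`. -/
def weylIntegrand (q : PhaseSpace d → ℝ) (x y ξ : BaseSpace d) : ℂ :=
  (q (midPoint x y ξ) : ℂ) * planeWave ξ (x - y)

/-- The Weyl quantization at `h = 1/(2π)`. -/
def weylUnit (q : PhaseSpace d → ℝ) (u : BaseSpace d → ℂ) (x : BaseSpace d) : ℂ :=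
  ∫ ξ, ∫ y, weylIntegrand q x y ξ * u y

theorem continuous_weylIntegrand {q : PhaseSpace d → ℝ} (hq : Continuous q)
    {X : Type*} [TopologicalSpace X] {f g k : X → BaseSpace d}
    (hf : Continuous f) (hg : Continuous g) (hk : Continuous k) :
    Continuous (fun x => weylIntegrand q (f x) (g x) (k x)) := by
  unfold weylIntegrand
  exact (Complex.continuous_ofReal.comp (hq.comp (by fun_prop))).mul
    (Continuous.planeWave' hk (hf.sub hg))

theorem norm_weylIntegrand_le {q : PhaseSpace d → ℝ} {A : ℝ} (hA : 0 ≤ A)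
    (hq : ∀ x, |q x| ≤ A * (1 + ‖x‖) ^ 2) (x y ξ : BaseSpace d) :
    ‖weylIntegrand q x y ξ‖ ≤ A * (1 + ‖x‖) ^ 2 * (1 + ‖y‖) ^ 2 * (1 + ‖ξ‖) ^ 2 := by
  rw [weylIntegrand, norm_mul, norm_planeWave, mul_one, Complex.norm_real]
  refine (hq _).trans ?_
  rw [mul_assoc, mul_assoc, ← mul_pow, ← mul_pow, ← mul_assoc]
  have := one_add_norm_midPoint_le x y ξ
  gcongr

theorem planeWave_sub_right (ξ x y : BaseSpace d) :
    planeWave ξ (x - y) = planeWave ξ x * planeWave (-ξ) y := by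
  simp only [planeWave, ← Complex.exp_add, inner_sub_right, inner_neg_left]
  congr 1
  push_cast
  ring

/-- The inner integral of the Weyl quantization is rapidly decreasing in the frequency. -/
theorem exists_inner_integral_le {q : PhaseSpace d → ℝ} (hq : HasQuadraticGrowth q)
    (u : 𝓢(BaseSpace d, ℂ)) : ∃ C, 0 ≤ C ∧ ∀ x ξ,
      ‖∫ y, weylIntegrand q x y ξ * u y‖ ≤ C * (1 + ‖x‖) ^ 2 * polyDecay (d + 1) ξ := by
  -- Two orders compensate the factor `(1 + ‖ξ‖)²` from the growth of the symbol; the other `d + 1`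
  -- make the result integrable in `ξ`.
  obtain ⟨A, hA, hAq⟩ := hq.bound (2 + (d + 1))
  obtain ⟨C, hC, h⟩ := exists_fourier_mul_schwartz_le u (2 + (d + 1)) 2
  refine ⟨C * A, by positivity, fun x ξ => ?_⟩
  let L : BaseSpace d →L[ℝ] PhaseSpace d :=
    LinearMap.mkContinuous
      { toFun := fun y => WithLp.toLp 2 ((1 / 2 : ℝ) • y, 0)
        map_add' := fun a b => phase_ext (smul_add _ a b) (add_zero _).symm
        map_smul' := fun c a => phase_ext (smul_comm _ c a) (smul_zero c).symm } 1
      (fun y => by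
        refine (norm_le_fst_add_snd _).trans ?_
        change ‖(1 / 2 : ℝ) • y‖ + ‖(0 : BaseSpace d)‖ ≤ _
        rw [norm_smul]
        norm_num
        linarith [norm_nonneg y])
  have hL : ‖L‖ ≤ 1 := LinearMap.mkContinuous_norm_le _ zero_le_one _
  have hLy : ∀ y, midPoint x y ξ = midPoint x 0 ξ + L y := by
    intro y
    refine phase_ext ?_ (add_zero ξ).symm
    change (1 / 2 : ℝ) • (x + y) = (1 / 2 : ℝ) • (x + 0) + (1 / 2 : ℝ) • y
    rw [← smul_add, add_zero]
  have hqc : ContDiff ℝ ∞ (fun ρ => (q ρ : ℂ)) := Complex.ofRealCLM.contDiff.comp hq.contDiff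
  have hfun : (fun y => (q (midPoint x y ξ) : ℂ)) =
      fun y => (fun ρ => (q ρ : ℂ)) (midPoint x 0 ξ + L y) := by
    funext y
    rw [hLy y]
  have hfb := h (fun y => (q (midPoint x y ξ) : ℂ)) (A * (1 + ‖x‖) ^ 2 * (1 + ‖ξ‖) ^ 2)
    (by positivity)
    (by rw [hfun]; exact hqc.comp (contDiff_const.add L.contDiff))
    (fun k hk y => by
      rw [hfun]
      refine (norm_iteratedFDeriv_comp_add_clm_le hqc _ L hL k y).trans ?_
      rw [norm_iteratedFDeriv_ofReal hq.contDiff, ← hLy]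
      refine (hAq k hk _).trans ?_
      have := one_add_norm_midPoint_le x y ξ
      calc A * (1 + ‖midPoint x y ξ‖) ^ 2 ≤ A * ((1 + ‖x‖) * (1 + ‖y‖) * (1 + ‖ξ‖)) ^ 2 := by gcongr
        _ = _ := by ring) ξ
  have heq : ∫ y, weylIntegrand q x y ξ * u y =
      planeWave ξ x * 𝓕 (fun y => (q (midPoint x y ξ) : ℂ) * u y) ξ := by
    rw [Real.fourier_eq', ← integral_const_mul]
    congr 1
    funext y
    rw [weylIntegrand, planeWave_sub_right, planeWave, planeWave]
    simp only [smul_eq_mul, inner_neg_left, real_inner_comm ξ y]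
    ring_nf
  rw [heq, norm_mul, norm_planeWave, one_mul]
  refine hfb.trans (le_of_eq ?_)
  calc _ = C * A * (1 + ‖x‖) ^ 2 * ((1 + ‖ξ‖) ^ 2 * polyDecay (2 + (d + 1)) ξ) := by ring
    _ = _ := by rw [pow_mul_polyDecay_add]

theorem stronglyMeasurable_inner_integral {q : PhaseSpace d → ℝ} (hq : Continuous q)
    {u : BaseSpace d → ℂ} (hu : Continuous u) :
    StronglyMeasurable (fun p : BaseSpace d × BaseSpace d =>
      ∫ y, weylIntegrand q p.1 y p.2 * u y) := by
  refine StronglyMeasurable.integral_prod_right (f := fun (p : BaseSpace d × BaseSpace d) y =>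
      weylIntegrand q p.1 y p.2 * u y) ?_
  exact ((continuous_weylIntegrand hq (by fun_prop) continuous_snd (by fun_prop)).mul
    (hu.comp continuous_snd)).stronglyMeasurable

theorem stronglyMeasurable_weylUnit {q : PhaseSpace d → ℝ} (hq : Continuous q)
    {u : BaseSpace d → ℂ} (hu : Continuous u) : StronglyMeasurable (weylUnit q u) :=
  StronglyMeasurable.integral_prod_right (f := fun x ξ => ∫ y, weylIntegrand q x y ξ * u y)
    (stronglyMeasurable_inner_integral hq hu)

theorem exists_norm_weylUnit_le {q : PhaseSpace d → ℝ} (hq : HasQuadraticGrowth q)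
    (u : 𝓢(BaseSpace d, ℂ)) : ∃ C, 0 ≤ C ∧ ∀ x, ‖weylUnit q u x‖ ≤ C * (1 + ‖x‖) ^ 2 := by
  obtain ⟨C, hC, h⟩ := exists_inner_integral_le hq u
  refine ⟨C * ∫ ξ : BaseSpace d, polyDecay (d + 1) ξ,
    mul_nonneg hC (integral_nonneg fun ξ => polyDecay_nonneg _ ξ), fun x => ?_⟩
  refine (norm_integral_le_of_norm_le (integrable_polyDecay_base.const_mul (C * (1 + ‖x‖) ^ 2))
    (Eventually.of_forall fun ξ => h x ξ)).trans (le_of_eq ?_)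
  rw [integral_const_mul]
  ring

/-! ### Cross-Wigner functions of coherent states -/

/-- The cross-Wigner function of the coherent states at `z` and `w`. -/
def wignerKernel (z w ρ : PhaseSpace d) : ℂ :=
  ((2 ^ d * Real.exp (-(2 * Real.pi) * ‖ρ - (1 / 2 : ℝ) • (z + w)‖ ^ 2) : ℝ) : ℂ) *
    Complex.exp (((2 * Real.pi * (inner ℝ (z.fst - w.fst) (ρ.snd - (1 / 2 : ℝ) • (z.snd + w.snd)) -
      inner ℝ (z.snd - w.snd) ρ.fst) : ℝ) : ℂ) * Complex.I)

theorem norm_wignerKernel (z w ρ : PhaseSpace d) : ‖wignerKernel z w ρ‖ =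
    2 ^ d * Real.exp (-(2 * Real.pi) * ‖ρ - (1 / 2 : ℝ) • (z + w)‖ ^ 2) := by
  rw [wignerKernel, norm_mul, Complex.norm_exp_ofReal_mul_I, mul_one, Complex.norm_real,
    Real.norm_of_nonneg (by positivity)]

theorem continuous_wignerKernel :
    Continuous (fun p : PhaseSpace d × PhaseSpace d × PhaseSpace d =>
      wignerKernel p.1 p.2.1 p.2.2) := by
  unfold wignerKernel
  have h1 := continuous_phase_fst (d := d)
  have h2 := continuous_phase_snd (d := d)
  fun_prop

/-- By the parallelogram law the product of the two windows is a Gaussian in the distance of `X` to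
the midpoint times a Gaussian in `p`, recentred at `z.fst - w.fst`. The integral in `p` is then a
Gaussian Fourier transform, which produces the missing Gaussian in the frequency. -/
theorem integral_coherentState_mul (z w : PhaseSpace d) (X ξ : BaseSpace d) :
    ∫ p : BaseSpace d, starRingEnd ℂ (coherentState z (X + (1 / 2 : ℝ) • p)) *
      coherentState w (X - (1 / 2 : ℝ) • p) * planeWave ξ p =
      wignerKernel z w (WithLp.toLp 2 (X, ξ)) := by
  set Δ := z.fst - w.fst with hΔ
  set η := ξ - (1 / 2 : ℝ) • (z.snd + w.snd) with hη
  set D := (2 : ℝ) ^ ((d : ℝ) / 2) * Real.exp (-(2 * Real.pi) *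
    ‖X - (1 / 2 : ℝ) • (z.fst + w.fst)‖ ^ 2) with hD
  set Ph : ℂ := Complex.exp (((2 * Real.pi * (inner ℝ Δ η -
      inner ℝ (z.snd - w.snd) X) : ℝ) : ℂ) * Complex.I) with hPh
  -- Shifting by `Δ` removes the cross term between `X` and the integration variable in the
  -- exponent.
  rw [← integral_add_left_eq_self _ Δ]
  have hpt : ∀ t : BaseSpace d, starRingEnd ℂ (coherentState z (X + (1 / 2 : ℝ) • (Δ + t))) *
      coherentState w (X - (1 / 2 : ℝ) • (Δ + t)) * planeWave ξ (Δ + t) =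
      (D : ℂ) * Ph * Complex.exp (-((Real.pi / 2 : ℝ) : ℂ) * (‖t‖ : ℂ) ^ 2 +
        (2 * Real.pi * Complex.I) * ((inner ℝ η t : ℝ) : ℂ)) := by
    intro t
    simp only [coherentState_apply, map_mul, Complex.conj_ofReal, conj_planeWave]
    have hg : gaussWindow (X + (1 / 2 : ℝ) • (Δ + t) - z.fst) *
        gaussWindow (X - (1 / 2 : ℝ) • (Δ + t) - w.fst) = D * Real.exp (-(Real.pi / 2) * ‖t‖ ^ 2) := by
      have hn : ‖X + (1 / 2 : ℝ) • (Δ + t) - z.fst‖ ^ 2 + ‖X - (1 / 2 : ℝ) • (Δ + t) - w.fst‖ ^ 2 =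
          2 * ‖X - (1 / 2 : ℝ) • (z.fst + w.fst)‖ ^ 2 + 1 / 2 * ‖t‖ ^ 2 := by
        have e1 : X + (1 / 2 : ℝ) • (Δ + t) - z.fst =
            (X - (1 / 2 : ℝ) • (z.fst + w.fst)) + (1 / 2 : ℝ) • t := by
          rw [hΔ]; module
        have e2 : X - (1 / 2 : ℝ) • (Δ + t) - w.fst =
            (X - (1 / 2 : ℝ) • (z.fst + w.fst)) - (1 / 2 : ℝ) • t := by
          rw [hΔ]; module
        rw [e1, e2]
        generalize X - (1 / 2 : ℝ) • (z.fst + w.fst) = c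
        rw [norm_add_sq_real, norm_sub_sq_real, norm_smul]
        norm_num
        ring
      have h2 : (2 : ℝ) ^ ((d : ℝ) / 4) * (2 : ℝ) ^ ((d : ℝ) / 4) = (2 : ℝ) ^ ((d : ℝ) / 2) := by
        rw [← Real.rpow_add (by norm_num)]
        ring_nf
      unfold gaussWindow
      calc _ = ((2 : ℝ) ^ ((d : ℝ) / 4) * (2 : ℝ) ^ ((d : ℝ) / 4)) *
            Real.exp (-Real.pi * (‖X + (1 / 2 : ℝ) • (Δ + t) - z.fst‖ ^ 2 +
              ‖X - (1 / 2 : ℝ) • (Δ + t) - w.fst‖ ^ 2)) := by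
            rw [mul_add, Real.exp_add]; ring
        _ = _ := by
            rw [hn, h2, hD, mul_assoc, ← Real.exp_add]
            ring_nf
    have hp : planeWave (-z.snd) (X + (1 / 2 : ℝ) • (Δ + t)) *
        planeWave w.snd (X - (1 / 2 : ℝ) • (Δ + t)) * planeWave ξ (Δ + t) =
        Ph * Complex.exp ((2 * Real.pi * Complex.I) * ((inner ℝ η t : ℝ) : ℂ)) := by
      have hin : inner ℝ (-z.snd) (X + (1 / 2 : ℝ) • (Δ + t)) +
          inner ℝ w.snd (X - (1 / 2 : ℝ) • (Δ + t)) + inner ℝ ξ (Δ + t) =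
          inner ℝ Δ η - inner ℝ (z.snd - w.snd) X + inner ℝ η t := by
        rw [real_inner_comm η Δ, hη]
        simp only [inner_add_left, inner_add_right, inner_sub_left, inner_sub_right, inner_neg_left,
          inner_smul_left, inner_smul_right, conj_trivial]
        ring
      simp only [planeWave, hPh, ← Complex.exp_add]
      congr 1
      rw [← add_mul, ← add_mul]
      have : ((2 * Real.pi * inner ℝ (-z.snd) (X + (1 / 2 : ℝ) • (Δ + t)) : ℝ) : ℂ) +
          ((2 * Real.pi * inner ℝ w.snd (X - (1 / 2 : ℝ) • (Δ + t)) : ℝ) : ℂ) +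
          ((2 * Real.pi * inner ℝ ξ (Δ + t) : ℝ) : ℂ) =
          ((2 * Real.pi * (inner ℝ Δ η - inner ℝ (z.snd - w.snd) X + inner ℝ η t) : ℝ) : ℂ) := by
        rw [← hin]; push_cast; ring
      rw [this]
      push_cast
      ring
    calc _ = ((gaussWindow (X + (1 / 2 : ℝ) • (Δ + t) - z.fst) *
          gaussWindow (X - (1 / 2 : ℝ) • (Δ + t) - w.fst) : ℝ) : ℂ) *
          (planeWave (-z.snd) (X + (1 / 2 : ℝ) • (Δ + t)) *
            planeWave w.snd (X - (1 / 2 : ℝ) • (Δ + t)) * planeWave ξ (Δ + t)) := by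
          push_cast; ring
      _ = _ := by
          rw [hg, hp, Complex.exp_add]
          push_cast
          ring
  simp_rw [hpt]
  rw [integral_const_mul, GaussianFourier.integral_cexp_neg_mul_sq_norm_add
    (by simp [Real.pi_pos])]
  have hpi : (Real.pi : ℂ) ≠ 0 := by exact_mod_cast Real.pi_ne_zero
  have hb : (Real.pi : ℂ) / ((Real.pi / 2 : ℝ) : ℂ) = 2 := by
    push_cast
    field_simp
  have he : (2 * (Real.pi : ℂ) * Complex.I) ^ 2 * (‖η‖ : ℂ) ^ 2 / (4 * ((Real.pi / 2 : ℝ) : ℂ)) =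
      ((-(2 * Real.pi) * ‖η‖ ^ 2 : ℝ) : ℂ) := by
    rw [mul_pow, Complex.I_sq]
    push_cast
    field_simp
    ring
  rw [hb, he, finrank_euclideanSpace_fin, wignerKernel]
  have h2 : ((2 : ℂ) ^ ((d : ℂ) / 2)) = (((2 : ℝ) ^ ((d : ℝ) / 2) : ℝ) : ℂ) := by
    rw [Complex.ofReal_cpow (by norm_num)]
    push_cast
    rfl
  have hnorm : ‖(WithLp.toLp 2 (X, ξ) : PhaseSpace d) - (1 / 2 : ℝ) • (z + w)‖ ^ 2 =
      ‖X - (1 / 2 : ℝ) • (z.fst + w.fst)‖ ^ 2 + ‖η‖ ^ 2 := by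
    rw [WithLp.prod_norm_sq_eq_of_L2]
    rfl
  have h22 : (2 : ℝ) ^ ((d : ℝ) / 2) * (2 : ℝ) ^ ((d : ℝ) / 2) = 2 ^ d := by
    rw [← Real.rpow_add (by norm_num), add_halves, Real.rpow_natCast]
  rw [hnorm, mul_add, Real.exp_add, h2, ← h22]
  simp only [WithLp.toLp_fst, WithLp.toLp_snd, hPh, hD, ← hη, ← hΔ]
  push_cast
  ring

end WeylUnit

end

noncomputable section

/-! ### Matrix elements of the Weyl quantization between coherent states. -/

section WeylKernel

variable {d : ℕ}

/-- The matrix element of the Weyl quantization (at `h = 1/(2π)`) between the coherent states at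
`z` and `w`. -/
def weylKernel (q : PhaseSpace d → ℝ) (z w : PhaseSpace d) : ℂ :=
  ∫ ρ, (q ρ : ℂ) * wignerKernel z w ρ

theorem one_add_norm_half_add_le {V : Type*} [NormedAddCommGroup V] [NormedSpace ℝ V] (z w : V) :
    1 + ‖(1 / 2 : ℝ) • (z + w)‖ ≤ (1 + ‖z‖) * (1 + ‖w‖) := by
  rw [norm_smul]
  norm_num
  nlinarith [norm_add_le z w, norm_nonneg z, norm_nonneg w, norm_nonneg (z + w)]

/-- The Gaussian is centred at the midpoint of `z` and `w`; Peetre's inequality recentres it at the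
origin, with polynomial losses in `z` and `w` that are harmless against transforms of Schwartz
functions. -/
theorem exists_norm_symbol_mul_wignerKernel_le {q : PhaseSpace d → ℝ} (hq : HasQuadraticGrowth q)
    (L : ℕ) : ∃ C, 0 ≤ C ∧ ∀ z w ρ, ‖(q ρ : ℂ) * wignerKernel z w ρ‖ ≤
      C * (1 + ‖z‖) ^ (2 + L) * (1 + ‖w‖) ^ (2 + L) * polyDecay L ρ := by
  obtain ⟨A, hA, hAq⟩ := hq.norm_le
  obtain ⟨C, hC, h⟩ := exists_exp_le_polyDecay (V := PhaseSpace d) (2 * Real.pi) (by positivity)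
    (2 + L)
  refine ⟨A * (2 ^ d * C), by positivity, fun z w ρ => ?_⟩
  rw [norm_mul, norm_wignerKernel, Complex.norm_real]
  have h1 := polyDecay_sub_le (2 + L) ρ ((1 / 2 : ℝ) • (z + w))
  have h2 := one_add_norm_half_add_le z w
  have h3 := polyDecay_nonneg (2 + L) ρ
  calc _ ≤ (A * (1 + ‖ρ‖) ^ 2) * (2 ^ d * (C * (polyDecay (2 + L) ρ *
        ((1 + ‖z‖) * (1 + ‖w‖)) ^ (2 + L)))) := by
        gcongr
        · exact hAq ρ
        · refine (h _).trans (mul_le_mul_of_nonneg_left (h1.trans ?_) hC)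
          gcongr
    _ = A * (2 ^ d * C) * (1 + ‖z‖) ^ (2 + L) * (1 + ‖w‖) ^ (2 + L) *
        ((1 + ‖ρ‖) ^ 2 * polyDecay (2 + L) ρ) := by rw [mul_pow]; ring
    _ = _ := by rw [pow_mul_polyDecay_add]

theorem polyDecay_phase_le (L : ℕ) (ρ : PhaseSpace d) :
    polyDecay (L + L) ρ ≤ polyDecay L ρ.fst * polyDecay L ρ.snd := by
  rw [polyDecay_add]
  have h1 : polyDecay L ρ ≤ polyDecay L ρ.fst := by
    unfold polyDecay; gcongr; exact phase_norm_fst_le ρ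
  have h2 : polyDecay L ρ ≤ polyDecay L ρ.snd := by
    unfold polyDecay; gcongr; exact phase_norm_snd_le ρ
  exact mul_le_mul h1 h2 (polyDecay_nonneg _ _) (polyDecay_nonneg _ _)

theorem integrable_symbol_mul_wignerKernel {q : PhaseSpace d → ℝ} (hq : HasQuadraticGrowth q)
    (z w : PhaseSpace d) : Integrable (fun ρ => (q ρ : ℂ) * wignerKernel z w ρ) := by
  obtain ⟨C, hC, h⟩ := exists_norm_symbol_mul_wignerKernel_le hq (2 * d + 1)
  refine (integrable_polyDecay_phase.const_mul _).mono' ?_ (Eventually.of_forall fun ρ => h z w ρ)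
  exact ((Complex.continuous_ofReal.comp hq.contDiff.continuous).mul
    (continuous_wignerKernel.comp (by fun_prop : Continuous fun ρ : PhaseSpace d =>
      (z, w, ρ)))).aestronglyMeasurable

/-- Products of decaying functions remain integrable after a linear change of variables which
controls both variables. -/
theorem integrable_of_le_polyDecay_mul {G : BaseSpace d × BaseSpace d → ℂ} (hG : Continuous G)
    {C : ℝ} (hC : 0 ≤ C) {f g : BaseSpace d × BaseSpace d → BaseSpace d}
    (hfg₁ : ∀ p, 1 + ‖p.1‖ ≤ (1 + ‖f p‖) * (1 + ‖g p‖))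
    (hfg₂ : ∀ p, 1 + ‖p.2‖ ≤ (1 + ‖f p‖) * (1 + ‖g p‖))
    (h : ∀ p, ‖G p‖ ≤ C * (polyDecay ((d + 1) + (d + 1)) (f p) *
      polyDecay ((d + 1) + (d + 1)) (g p))) :
    Integrable G (volume.prod volume) := by
  refine ((Integrable.mul_prod integrable_polyDecay_base integrable_polyDecay_base).const_mul
    C).mono' hG.aestronglyMeasurable (Eventually.of_forall fun p => (h p).trans ?_)
  refine mul_le_mul_of_nonneg_left ?_ hC
  have key : ∀ x : BaseSpace d, 1 + ‖x‖ ≤ (1 + ‖f p‖) * (1 + ‖g p‖) →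
      polyDecay (d + 1) (f p) * polyDecay (d + 1) (g p) ≤ polyDecay (d + 1) x := by
    intro x hx
    unfold polyDecay
    rw [← mul_inv, ← mul_pow]
    gcongr
  calc _ = (polyDecay (d + 1) (f p) * polyDecay (d + 1) (g p)) *
        (polyDecay (d + 1) (f p) * polyDecay (d + 1) (g p)) := by simp only [polyDecay_add]; ring
    _ ≤ _ := mul_le_mul (key _ (hfg₁ p)) (key _ (hfg₂ p))
        (mul_nonneg (polyDecay_nonneg _ _) (polyDecay_nonneg _ _)) (polyDecay_nonneg _ _)

/-- The double integral defining the matrix element at a fixed frequency is an integral against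
the cross-Wigner function. -/
theorem integral_coherentState_weylIntegrand {q : PhaseSpace d → ℝ} (hq : HasQuadraticGrowth q)
    (z w : PhaseSpace d) (ξ : BaseSpace d) :
    ∫ y, (∫ x, starRingEnd ℂ (coherentState z x) * weylIntegrand q x y ξ) * coherentState w y =
      ∫ X, (q (WithLp.toLp 2 (X, ξ)) : ℂ) * wignerKernel z w (WithLp.toLp 2 (X, ξ)) := by
  -- After a linear change of variables, `d + 1` powers of decay are needed in each of the two new
  -- variables.
  set L := (d + 1) + (d + 1) with hL
  obtain ⟨F, hF⟩ : ∃ F : BaseSpace d → BaseSpace d → ℂ, ∀ x y, F x y =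
      starRingEnd ℂ (coherentState z x) * weylIntegrand q x y ξ * coherentState w y :=
    ⟨_, fun _ _ => rfl⟩
  have hFc : Continuous (fun p : BaseSpace d × BaseSpace d => F p.1 p.2) := by
    simp_rw [hF]
    exact ((Complex.continuous_conj.comp (Continuous.coherentState' continuous_const continuous_fst)).mul
      (continuous_weylIntegrand hq.contDiff.continuous continuous_fst continuous_snd
        continuous_const)).mul (Continuous.coherentState' continuous_const continuous_snd)
  obtain ⟨A, hA, hAq⟩ := hq.norm_le
  obtain ⟨C, hC, h⟩ := exists_norm_coherentState_le (d := d) (2 + L)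
  set B := A * (1 + ‖ξ‖) ^ 2 * (C * (1 + ‖z‖) ^ (2 + L)) * (C * (1 + ‖w‖) ^ (2 + L)) with hB
  have hFb : ∀ x y, ‖F x y‖ ≤ B * (polyDecay L x * polyDecay L y) := by
    intro x y
    simp only [hF, norm_mul, RCLike.norm_conj]
    have hx := polyDecay_nonneg (2 + L) x
    calc _ ≤ (C * polyDecay (2 + L) x * (1 + ‖z‖) ^ (2 + L)) *
          (A * (1 + ‖x‖) ^ 2 * (1 + ‖y‖) ^ 2 * (1 + ‖ξ‖) ^ 2) *
          (C * polyDecay (2 + L) y * (1 + ‖w‖) ^ (2 + L)) := by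
          gcongr
          · exact h z x
          · exact norm_weylIntegrand_le hA hAq x y ξ
          · exact h w y
      _ = B * (((1 + ‖x‖) ^ 2 * polyDecay (2 + L) x) * ((1 + ‖y‖) ^ 2 * polyDecay (2 + L) y)) := by
          rw [hB]; ring
      _ = _ := by rw [pow_mul_polyDecay_add, pow_mul_polyDecay_add]
  have hB0 : 0 ≤ B := by positivity
  -- The coordinates `p = x - y` and `X = (x + y)/2` are reached by two shears, each a translation
  -- in an inner integral: `x = y + p` here, and `y = X - p/2` once the integrals have been
  -- exchanged.
  have e1 : ∀ y, (∫ x, starRingEnd ℂ (coherentState z x) * weylIntegrand q x y ξ) *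
      coherentState w y = ∫ p, F (y + p) y := by
    intro y
    rw [← integral_mul_const, integral_add_left_eq_self (fun x => F x y) y]
    simp_rw [hF]
  simp_rw [e1]
  rw [integral_integral_swap]
  swap
  · refine integrable_of_le_polyDecay_mul (C := B) (f := fun p => p.1 + p.2) (g := fun p => p.1)
      (hFc.comp (by fun_prop : Continuous fun p : BaseSpace d × BaseSpace d => (p.1 + p.2, p.1)))
      hB0 (fun p => ?_) (fun p => ?_) (fun p => hFb _ _)
    · exact le_mul_of_one_le_left (by positivity) (by linarith [norm_nonneg (p.1 + p.2)])
    · have := one_add_norm_add_le (p.1 + p.2) (-p.1)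
      simpa using this
  have e2 : ∀ p : BaseSpace d, ∫ y, F (y + p) y =
      ∫ X, F (X + (1 / 2 : ℝ) • p) (X - (1 / 2 : ℝ) • p) := by
    intro p
    rw [← integral_sub_right_eq_self (fun y => F (y + p) y) ((1 / 2 : ℝ) • p)]
    congr 1
    funext X
    congr 1
    module
  simp_rw [e2]
  rw [integral_integral_swap]
  swap
  · have hc : Continuous fun p : BaseSpace d × BaseSpace d =>
        (p.2 + (1 / 2 : ℝ) • p.1, p.2 - (1 / 2 : ℝ) • p.1) := by fun_prop
    refine integrable_of_le_polyDecay_mul (C := B) (f := fun p => p.2 + (1 / 2 : ℝ) • p.1)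
      (g := fun p => p.2 - (1 / 2 : ℝ) • p.1)
      (hFc.comp hc) hB0 (fun p => ?_) (fun p => ?_) (fun p => hFb _ _)
    · have h1 := one_add_norm_add_le (p.2 + (1 / 2 : ℝ) • p.1) (-(p.2 - (1 / 2 : ℝ) • p.1))
      have h2 : p.2 + (1 / 2 : ℝ) • p.1 + -(p.2 - (1 / 2 : ℝ) • p.1) = p.1 := by module
      rwa [norm_neg, h2] at h1
    · have h1 := one_add_norm_half_add_le (p.2 + (1 / 2 : ℝ) • p.1) (p.2 - (1 / 2 : ℝ) • p.1)
      have h2 : (1 / 2 : ℝ) • (p.2 + (1 / 2 : ℝ) • p.1 + (p.2 - (1 / 2 : ℝ) • p.1)) = p.2 := by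
        module
      rwa [h2] at h1
  congr 1
  funext X
  rw [← integral_coherentState_mul, ← integral_const_mul]
  congr 1
  funext p
  have h1 : midPoint (X + (1 / 2 : ℝ) • p) (X - (1 / 2 : ℝ) • p) ξ = WithLp.toLp 2 (X, ξ) := by
    unfold midPoint
    congr 2
    module
  have h2 : X + (1 / 2 : ℝ) • p - (X - (1 / 2 : ℝ) • p) = p := by module
  simp only [hF, weylIntegrand, h1, h2]
  ring

/-- The coherent state transform conjugates the Weyl quantization to an integral operator. -/
theorem coherentTransform_weylUnit {q : PhaseSpace d → ℝ} (hq : HasQuadraticGrowth q)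
    (u : 𝓢(BaseSpace d, ℂ)) (z : PhaseSpace d) :
    coherentTransform (weylUnit q u) z = ∫ w, coherentTransform u w * weylKernel q z w := by
  have hqc := hq.contDiff.continuous
  obtain ⟨A, hA, hAq⟩ := hq.norm_le
  obtain ⟨C, hC, hI⟩ := exists_inner_integral_le hq u
  obtain ⟨C₁, hC₁, h₁⟩ := exists_norm_coherentState_le (d := d) (2 + (d + 1))
  obtain ⟨C₂, hC₂, h₂⟩ := u.exists_norm_le_polyDecay (2 + (d + 1))
  have hφ : Continuous fun x => starRingEnd ℂ (coherentState z x) :=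
    Complex.continuous_conj.comp (coherentState z).continuous
  have hφb : ∀ x, ‖starRingEnd ℂ (coherentState z x)‖ ≤
      C₁ * polyDecay (2 + (d + 1)) x * (1 + ‖z‖) ^ (2 + (d + 1)) := fun x => by
    rw [RCLike.norm_conj]; exact h₁ z x
  -- The integrand of the quantization need not be jointly integrable in `y` and `ξ`, so the order
  -- of the interchanges matters. The integral in `x` is moved inside `ξ` while the `y`-integral is
  -- kept whole, since that integral decays in `ξ`; then `x` and `y` are exchanged at fixed `ξ`.
  -- Expanding `u` into coherent states gives the cross-Wigner function, whose Gaussian decay allows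
  -- the integrals in `ξ` and `w` to be exchanged.
  have step1 : coherentTransform (weylUnit q u) z =
      ∫ ξ, ∫ x, starRingEnd ℂ (coherentState z x) * ∫ y, weylIntegrand q x y ξ * u y := by
    rw [coherentTransform, ← integral_integral_swap]
    · congr 1
      funext x
      rw [integral_const_mul]
      rfl
    · refine ((Integrable.mul_prod (integrable_polyDecay_base (d := d))
        (integrable_polyDecay_base (d := d))).const_mul
          (C₁ * (1 + ‖z‖) ^ (2 + (d + 1)) * C)).mono' ?_ (Eventually.of_forall fun p => ?_)
      · exact (hφ.comp continuous_fst).aestronglyMeasurable.mul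
          (stronglyMeasurable_inner_integral hqc u.continuous).aestronglyMeasurable
      · simp only [Function.uncurry, norm_mul]
        have := polyDecay_nonneg (2 + (d + 1)) p.1
        calc _ ≤ (C₁ * polyDecay (2 + (d + 1)) p.1 * (1 + ‖z‖) ^ (2 + (d + 1))) *
              (C * (1 + ‖p.1‖) ^ 2 * polyDecay (d + 1) p.2) := by
              gcongr
              · exact hφb _
              · exact hI _ _
          _ = C₁ * (1 + ‖z‖) ^ (2 + (d + 1)) * C *
              (((1 + ‖p.1‖) ^ 2 * polyDecay (2 + (d + 1)) p.1) * polyDecay (d + 1) p.2) := by ring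
          _ = _ := by rw [pow_mul_polyDecay_add]
  have step2 : ∀ ξ, ∫ x, starRingEnd ℂ (coherentState z x) * ∫ y, weylIntegrand q x y ξ * u y =
      ∫ y, (∫ x, starRingEnd ℂ (coherentState z x) * weylIntegrand q x y ξ) * u y := by
    intro ξ
    simp_rw [← integral_const_mul, ← integral_mul_const]
    rw [integral_integral_swap]
    · congr 1; funext y; congr 1; funext x; ring
    · refine ((Integrable.mul_prod (integrable_polyDecay_base (d := d))
        (integrable_polyDecay_base (d := d))).const_mul
          (C₁ * (1 + ‖z‖) ^ (2 + (d + 1)) * C₂ * A * (1 + ‖ξ‖) ^ 2)).mono' ?_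
          (Eventually.of_forall fun p => ?_)
      · exact ((hφ.comp continuous_fst).mul ((continuous_weylIntegrand hqc continuous_fst
          continuous_snd continuous_const).mul (u.continuous.comp continuous_snd))).aestronglyMeasurable
      · simp only [Function.uncurry, norm_mul]
        have := polyDecay_nonneg (2 + (d + 1)) p.1
        calc _ ≤ (C₁ * polyDecay (2 + (d + 1)) p.1 * (1 + ‖z‖) ^ (2 + (d + 1))) *
              ((A * (1 + ‖p.1‖) ^ 2 * (1 + ‖p.2‖) ^ 2 * (1 + ‖ξ‖) ^ 2) *
                (C₂ * polyDecay (2 + (d + 1)) p.2)) := by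
              gcongr
              · exact hφb _
              · exact norm_weylIntegrand_le hA hAq _ _ _
              · exact h₂ _
          _ = C₁ * (1 + ‖z‖) ^ (2 + (d + 1)) * C₂ * A * (1 + ‖ξ‖) ^ 2 *
              (((1 + ‖p.1‖) ^ 2 * polyDecay (2 + (d + 1)) p.1) *
                ((1 + ‖p.2‖) ^ 2 * polyDecay (2 + (d + 1)) p.2)) := by ring
          _ = _ := by rw [pow_mul_polyDecay_add, pow_mul_polyDecay_add]
  have step3 : ∀ ξ, ∫ y, (∫ x, starRingEnd ℂ (coherentState z x) * weylIntegrand q x y ξ) * u y =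
      ∫ w, coherentTransform u w *
        ∫ X, (q (WithLp.toLp 2 (X, ξ)) : ℂ) * wignerKernel z w (WithLp.toLp 2 (X, ξ)) := by
    intro ξ
    rw [integral_mul_schwartz_eq u
      (C := C₁ * (1 + ‖z‖) ^ (2 + (d + 1)) * A * (1 + ‖ξ‖) ^ 2 *
        ∫ x : BaseSpace d, polyDecay (d + 1) x) (M := 2)]
    · simp_rw [integral_coherentState_weylIntegrand hq]
    · refine (StronglyMeasurable.integral_prod_right (f := fun y x =>
        starRingEnd ℂ (coherentState z x) * weylIntegrand q x y ξ) ?_).aestronglyMeasurable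
      exact ((hφ.comp continuous_snd).mul (continuous_weylIntegrand hqc continuous_snd
        continuous_fst continuous_const)).stronglyMeasurable
    · intro y
      refine (norm_integral_le_of_norm_le ((integrable_polyDecay_base (d := d)).const_mul
        (C₁ * (1 + ‖z‖) ^ (2 + (d + 1)) * A * (1 + ‖ξ‖) ^ 2 * (1 + ‖y‖) ^ 2))
        (Eventually.of_forall fun x => ?_)).trans (le_of_eq ?_)
      · rw [norm_mul]
        have := polyDecay_nonneg (2 + (d + 1)) x
        calc _ ≤ (C₁ * polyDecay (2 + (d + 1)) x * (1 + ‖z‖) ^ (2 + (d + 1))) *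
              (A * (1 + ‖x‖) ^ 2 * (1 + ‖y‖) ^ 2 * (1 + ‖ξ‖) ^ 2) := by
              gcongr
              · exact hφb _
              · exact norm_weylIntegrand_le hA hAq _ _ _
          _ = C₁ * (1 + ‖z‖) ^ (2 + (d + 1)) * A * (1 + ‖ξ‖) ^ 2 * (1 + ‖y‖) ^ 2 *
              ((1 + ‖x‖) ^ 2 * polyDecay (2 + (d + 1)) x) := by ring
          _ = _ := by rw [pow_mul_polyDecay_add]
      · rw [integral_const_mul]; ring
  rw [step1]
  simp_rw [step2, step3]
  rw [integral_integral_swap]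
  · congr 1
    funext w
    rw [integral_const_mul, weylKernel, integral_phase_symm (integrable_symbol_mul_wignerKernel hq z w)]
  · obtain ⟨C₃, hC₃, h₃⟩ := exists_norm_symbol_mul_wignerKernel_le hq ((d + 1) + (d + 1))
    set K := 2 + ((d + 1) + (d + 1))
    set I₀ := ∫ x : BaseSpace d, polyDecay (d + 1) x
    have hI₀ : 0 ≤ I₀ := integral_nonneg fun x => polyDecay_nonneg _ x
    refine ((Integrable.mul_prod (integrable_polyDecay_base (d := d))
      (integrable_weight_mul_coherentTransform u K)).const_mul
        (C₃ * (1 + ‖z‖) ^ K * I₀)).mono' ?_ (Eventually.of_forall fun p => ?_)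
    · refine AEStronglyMeasurable.mul
        ((continuous_coherentTransform u).comp continuous_snd).aestronglyMeasurable
        (StronglyMeasurable.integral_prod_right (f := fun (p : BaseSpace d × PhaseSpace d) X =>
          (q (WithLp.toLp 2 (X, p.1)) : ℂ) *
            wignerKernel z p.2 (WithLp.toLp 2 (X, p.1))) ?_).aestronglyMeasurable
      have hm : Continuous fun p : (BaseSpace d × PhaseSpace d) × BaseSpace d =>
          (WithLp.toLp 2 (p.2, p.1.1) : PhaseSpace d) :=
        continuous_phase_mk.comp (by fun_prop)
      exact ((Complex.continuous_ofReal.comp (hqc.comp hm)).mul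
        (continuous_wignerKernel.comp (continuous_const.prodMk
          ((by fun_prop : Continuous fun p : (BaseSpace d × PhaseSpace d) × BaseSpace d =>
            p.1.2).prodMk hm)))).stronglyMeasurable
    · simp only [Function.uncurry]
      rw [norm_mul]
      have hJ : ‖∫ X, (q (WithLp.toLp 2 (X, p.1)) : ℂ) *
          wignerKernel z p.2 (WithLp.toLp 2 (X, p.1))‖ ≤
          C₃ * (1 + ‖z‖) ^ K * (1 + ‖p.2‖) ^ K * polyDecay (d + 1) p.1 * I₀ := by
        refine (norm_integral_le_of_norm_le ((integrable_polyDecay_base (d := d)).const_mul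
          (C₃ * (1 + ‖z‖) ^ K * (1 + ‖p.2‖) ^ K * polyDecay (d + 1) p.1))
          (Eventually.of_forall fun X => ?_)).trans (le_of_eq (integral_const_mul _ _))
        refine (h₃ z p.2 _).trans ?_
        rw [mul_assoc _ (polyDecay (d + 1) p.1), mul_comm (polyDecay (d + 1) p.1)]
        gcongr
        exact polyDecay_phase_le (d + 1) (WithLp.toLp 2 (X, p.1))
      calc _ ≤ ‖coherentTransform u p.2‖ *
            (C₃ * (1 + ‖z‖) ^ K * (1 + ‖p.2‖) ^ K * polyDecay (d + 1) p.1 * I₀) := by gcongr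
        _ = _ := by ring

end WeylKernel

end

noncomputable section

/-! ### Second order Taylor remainders -/

section Taylor

variable {V : Type*} [NormedAddCommGroup V] [NormedSpace ℝ V]

/-- The second order Taylor remainder of `q` at `m`. -/
def taylorRemainder (q : V → ℝ) (m Y : V) : ℝ := q (m + Y) - q m - fderiv ℝ q m Y

theorem contDiff_taylorRemainder {q : V → ℝ} (hq : ContDiff ℝ ∞ q) (m : V) :
    ContDiff ℝ ∞ (taylorRemainder q m) :=
  ((hq.comp (contDiff_const.add contDiff_id)).sub contDiff_const).sub (fderiv ℝ q m).contDiff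

theorem fderiv_taylorRemainder {q : V → ℝ} (hq : ContDiff ℝ ∞ q) (m : V) :
    fderiv ℝ (taylorRemainder q m) = fun Y => fderiv ℝ q (m + Y) - fderiv ℝ q m := by
  funext Y
  have h1 : DifferentiableAt ℝ q (m + Y) := (hq.differentiable (by simp)) _
  have h2 : HasFDerivAt (fun Y => q (m + Y)) (fderiv ℝ q (m + Y)) Y := by
    have := h1.hasFDerivAt.comp Y ((hasFDerivAt_id Y).const_add m)
    rw [ContinuousLinearMap.comp_id] at this
    exact this
  exact ((h2.sub_const (q m)).sub (fderiv ℝ q m).hasFDerivAt).fderiv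

theorem norm_fderiv_sub_le {q : V → ℝ} (hq : ContDiff ℝ ∞ q) {B : ℝ}
    (hB : ∀ x, ‖iteratedFDeriv ℝ 2 q x‖ ≤ B) (x y : V) :
    ‖fderiv ℝ q y - fderiv ℝ q x‖ ≤ B * ‖y - x‖ := by
  refine Convex.norm_image_sub_le_of_norm_fderiv_le (𝕜 := ℝ) (s := Set.univ) (fun z _ => ?_)
    (fun z _ => ?_) convex_univ (Set.mem_univ _) (Set.mem_univ _)
  · exact ((hq.fderiv_right (m := 1) (by norm_cast)).differentiable (by simp)) z
  · have h := hB z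
    rw [← norm_iteratedFDeriv_fderiv, ← norm_iteratedFDeriv_fderiv] at h
    simpa using h

/-- The mean value inequality applied twice; this loses the factor `1/2` of Taylor's formula, which
plays no role. -/
theorem abs_taylorRemainder_le {q : V → ℝ} (hq : ContDiff ℝ ∞ q) {B : ℝ} (hB0 : 0 ≤ B)
    (hB : ∀ x, ‖iteratedFDeriv ℝ 2 q x‖ ≤ B) (m Y : V) :
    |taylorRemainder q m Y| ≤ B * ‖Y‖ ^ 2 := by
  have h := Convex.norm_image_sub_le_of_norm_fderiv_le (𝕜 := ℝ) (f := taylorRemainder q m)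
    (s := Metric.closedBall 0 ‖Y‖) (C := B * ‖Y‖) (x := 0) (y := Y)
    (fun z _ => ((contDiff_taylorRemainder hq m).differentiable (by simp)) z)
    (fun z hz => by
      rw [fderiv_taylorRemainder hq]
      refine (norm_fderiv_sub_le hq hB _ _).trans ?_
      rw [add_sub_cancel_left]
      gcongr
      simpa using hz) (convex_closedBall 0 ‖Y‖) (by simp) (by simp)
  have h0 : taylorRemainder q m 0 = 0 := by simp [taylorRemainder]
  rw [h0, sub_zero, sub_zero, Real.norm_eq_abs] at h
  rwa [sq, ← mul_assoc]

/-- From order two on, the derivatives are those of `q`; orders zero and one follow from the mean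
value inequality. The bound thus involves neither `q` nor its gradient at `m`, which could be large.
-/
theorem norm_iteratedFDeriv_taylorRemainder_le {q : V → ℝ} (hq : ContDiff ℝ ∞ q) {B : ℝ}
    (hB0 : 0 ≤ B) {N : ℕ} (hN : 2 ≤ N) (hB : ∀ k, 2 ≤ k → k ≤ N → ∀ x, ‖iteratedFDeriv ℝ k q x‖ ≤ B)
    (m : V) (k : ℕ) (hk : k ≤ N) (Y : V) :
    ‖iteratedFDeriv ℝ k (taylorRemainder q m) Y‖ ≤ B * (1 + ‖Y‖) ^ 2 := by
  have hB2 := hB 2 le_rfl hN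
  have hY := norm_nonneg Y
  match k, hk with
  | 0, _ =>
    rw [norm_iteratedFDeriv_zero]
    refine (abs_taylorRemainder_le hq hB0 hB2 m Y).trans ?_
    gcongr
    linarith
  | 1, _ =>
    rw [← norm_iteratedFDeriv_fderiv, norm_iteratedFDeriv_zero, fderiv_taylorRemainder hq]
    refine (norm_fderiv_sub_le hq hB2 _ _).trans ?_
    rw [add_sub_cancel_left]
    gcongr
    nlinarith
  | k + 2, hk =>
    have h : fderiv ℝ (fderiv ℝ (taylorRemainder q m)) =
        fun Y => fderiv ℝ (fderiv ℝ q) (m + Y) := by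
      rw [fderiv_taylorRemainder hq]
      funext Y
      rw [fderiv_sub_const, fderiv_comp_add_left]
    rw [← norm_iteratedFDeriv_fderiv, ← norm_iteratedFDeriv_fderiv, h, iteratedFDeriv_comp_add_left,
      norm_iteratedFDeriv_fderiv, norm_iteratedFDeriv_fderiv]
    refine (hB (k + 2) (by omega) hk _).trans (le_mul_of_one_le_right hB0 ?_)
    nlinarith

theorem hasQuadraticGrowth_of_bounded {q : V → ℝ} (hq : ContDiff ℝ ∞ q)
    (hB : ∀ n : ℕ, 2 ≤ n → ∃ B, ∀ x, ‖iteratedFDeriv ℝ n q x‖ ≤ B) : HasQuadraticGrowth q := by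
  refine ⟨hq, fun N => ?_⟩
  choose! B hB using hB
  -- The range is extended to `N + 2` so that order two is covered also when `N < 2`.
  obtain ⟨B', hB'⟩ : ∃ B', 0 ≤ B' ∧ ∀ k, 2 ≤ k → k ≤ N + 2 → ∀ x, ‖iteratedFDeriv ℝ k q x‖ ≤ B' := by
    refine ⟨∑ k ∈ Finset.range (N + 3), |B k|, Finset.sum_nonneg fun _ _ => abs_nonneg _,
      fun k h2 hk x => (hB k h2 x).trans ((le_abs_self _).trans ?_)⟩
    exact Finset.single_le_sum (f := fun k => |B k|) (fun _ _ => abs_nonneg _)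
      (Finset.mem_range.2 (by omega))
  have hB2 := hB'.2 2 le_rfl (by omega)
  refine ⟨B' + (|q 0| + ‖fderiv ℝ q 0‖), by have := hB'.1; positivity, fun k hk x => ?_⟩
  have hx := norm_nonneg x
  have h1 : (1 : ℝ) ≤ (1 + ‖x‖) ^ 2 := by nlinarith
  have h2 : ‖x‖ ≤ (1 + ‖x‖) ^ 2 := by nlinarith
  have h3 : ‖x‖ ^ 2 ≤ (1 + ‖x‖) ^ 2 := by nlinarith
  match k, hk with
  | 0, _ =>
    rw [norm_iteratedFDeriv_zero]
    have h := abs_taylorRemainder_le hq hB'.1 hB2 0 x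
    have hT : q x = taylorRemainder q 0 x + (q 0 + fderiv ℝ q 0 x) := by
      simp [taylorRemainder]
    rw [hT, Real.norm_eq_abs]
    calc _ ≤ |taylorRemainder q 0 x| + (|q 0| + |fderiv ℝ q 0 x|) :=
          (abs_add_le _ _).trans (by gcongr; exact abs_add_le _ _)
      _ ≤ B' * (1 + ‖x‖) ^ 2 + (|q 0| * (1 + ‖x‖) ^ 2 + ‖fderiv ℝ q 0‖ * (1 + ‖x‖) ^ 2) := by
          gcongr
          · exact h.trans (mul_le_mul_of_nonneg_left h3 hB'.1)
          · exact le_mul_of_one_le_right (abs_nonneg _) h1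
          · exact ((fderiv ℝ q 0).le_opNorm x).trans (by gcongr)
      _ = _ := by ring
  | 1, _ =>
    rw [← norm_iteratedFDeriv_fderiv, norm_iteratedFDeriv_zero]
    have h := norm_fderiv_sub_le hq hB2 0 x
    rw [sub_zero] at h
    have : ‖fderiv ℝ q x‖ ≤ ‖fderiv ℝ q x - fderiv ℝ q 0‖ + ‖fderiv ℝ q 0‖ := by
      simpa using norm_add_le (fderiv ℝ q x - fderiv ℝ q 0) (fderiv ℝ q 0)
    refine this.trans ?_
    rw [add_mul]
    have h5 : B' * ‖x‖ ≤ B' * (1 + ‖x‖) ^ 2 := mul_le_mul_of_nonneg_left h2 hB'.1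
    have h6 : ‖fderiv ℝ q 0‖ ≤ (|q 0| + ‖fderiv ℝ q 0‖) * (1 + ‖x‖) ^ 2 := by
      refine le_trans ?_ (le_mul_of_one_le_right (by positivity) h1)
      linarith [abs_nonneg (q 0)]
    linarith
  | k + 2, hk =>
    refine (hB'.2 (k + 2) (by omega) (by omega) x).trans ?_
    refine le_trans ?_ (le_mul_of_one_le_right (by have := hB'.1; positivity) h1)
    have : 0 ≤ |q 0| + ‖fderiv ℝ q 0‖ := by positivity
    linarith

end Taylor

/-! ### Fourier transforms of Gaussians times affine functions -/

section GaussianMoments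

variable {V : Type*} [NormedAddCommGroup V] [InnerProductSpace ℝ V] [FiniteDimensional ℝ V]
  [MeasurableSpace V] [BorelSpace V]

theorem fourier_gaussianSchwartz (b : ℝ) (hb : 0 < b) (ξ : V) :
    𝓕 (fun y : V => (gaussianSchwartz b hb : 𝓢(V, ℂ)) y) ξ =
      (((Real.pi / b) ^ ((Module.finrank ℝ V : ℝ) / 2) * Real.exp (-Real.pi ^ 2 * ‖ξ‖ ^ 2 / b) : ℝ) : ℂ) := by
  have h := fourier_gaussian_innerProductSpace (V := V) (b := (b : ℂ)) (by simpa using hb) ξ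
  simp_rw [gaussianSchwartz_apply]
  push_cast
  rw [h, Complex.ofReal_cpow (by positivity)]
  push_cast
  rfl

/-- The Gaussian solves `∂_a g = -2b ⟨y, a⟩ g`, and the Fourier transform turns `∂_a` into
multiplication by `2πi ⟨ξ, a⟩`. -/
theorem fourier_inner_mul_gaussianSchwartz (b : ℝ) (hb : 0 < b) (a ξ : V) :
    𝓕 (fun y : V => ((inner ℝ y a : ℝ) : ℂ) * (gaussianSchwartz b hb : 𝓢(V, ℂ)) y) ξ =
      -(Real.pi / b * inner ℝ ξ a : ℝ) * Complex.I *
        𝓕 (fun y : V => (gaussianSchwartz b hb : 𝓢(V, ℂ)) y) ξ := by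
  set g : 𝓢(V, ℂ) := gaussianSchwartz b hb with hg
  have h := congrArg (fun f : 𝓢(V, ℂ) => f ξ) (SchwartzMap.fourier_lineDerivOp_eq g a)
  have hder : ∀ y, (LineDeriv.lineDerivOp a g : 𝓢(V, ℂ)) y =
      -(2 * b : ℝ) * (((inner ℝ y a : ℝ) : ℂ) * g y) := by
    intro y
    rw [SchwartzMap.lineDerivOp_apply_eq_fderiv]
    have h1 : HasFDerivAt (fun y : V => ‖y‖ ^ 2) (2 • innerSL ℝ y) y := by
      simpa using (hasStrictFDerivAt_norm_sq y).hasFDerivAt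
    have h2 : HasFDerivAt (fun y : V => ((Real.exp (-b * ‖y‖ ^ 2) : ℝ) : ℂ)) _ y :=
      Complex.ofRealCLM.hasFDerivAt.comp y ((h1.const_mul (-b)).exp)
    have h3 : (g : V → ℂ) = fun y : V => ((Real.exp (-b * ‖y‖ ^ 2) : ℝ) : ℂ) := by
      funext y; simp [hg]
    rw [h3, h2.fderiv]
    simp
    ring
  have h1 : (𝓕 (LineDeriv.lineDerivOp a g : 𝓢(V, ℂ))) ξ =
      -(2 * b : ℝ) * 𝓕 (fun y : V => ((inner ℝ y a : ℝ) : ℂ) * g y) ξ := by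
    rw [SchwartzMap.fourier_coe, Real.fourier_eq', Real.fourier_eq', ← integral_const_mul]
    congr 1
    funext y
    rw [hder]
    simp only [smul_eq_mul]
    ring
  simp only [h1] at h
  have h2 : ((2 * Real.pi * Complex.I) • SchwartzMap.smulLeftCLM ℂ (inner ℝ · a) (𝓕 g)) ξ =
      2 * Real.pi * Complex.I * (((inner ℝ ξ a : ℝ) : ℂ) * 𝓕 (fun y : V => g y) ξ) := by
    rw [smul_apply, SchwartzMap.smulLeftCLM_apply_apply
      (Function.hasTemperateGrowth_inner_left a)]
    rfl
  rw [h2] at h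
  have hb' : (b : ℂ) ≠ 0 := by exact_mod_cast hb.ne'
  have : 𝓕 (fun y : V => ((inner ℝ y a : ℝ) : ℂ) * g y) ξ =
      -(1 / (2 * b)) * (-(2 * b : ℝ) * 𝓕 (fun y : V => ((inner ℝ y a : ℝ) : ℂ) * g y) ξ) := by
    push_cast; field_simp
  rw [this, h]
  push_cast
  field_simp

end GaussianMoments

end

noncomputable section

/-! ### Taylor expansion inside a Fourier transform. -/

section FourierAffine

variable {V : Type*} [NormedAddCommGroup V] [InnerProductSpace ℝ V] [FiniteDimensional ℝ V]
  [MeasurableSpace V] [BorelSpace V]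

theorem integrable_mul_schwartz {f : V → ℂ} (hf : AEStronglyMeasurable f) (u : 𝓢(V, ℂ)) {A : ℝ}
    {M : ℕ} (hfb : ∀ y, ‖f y‖ ≤ A * (1 + ‖y‖) ^ M) : Integrable (fun y => f y * u y) := by
  obtain ⟨C, hC, h⟩ := u.exists_norm_le_polyDecay (M + (Module.finrank ℝ V + 1))
  have hA : 0 ≤ A := by simpa using (norm_nonneg _).trans (hfb 0)
  refine ((integrable_polyDecay (V := V) (N := Module.finrank ℝ V + 1) (by omega)
    volume).const_mul (A * C)).mono' (hf.mul u.continuous.aestronglyMeasurable)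
    (Eventually.of_forall fun y => ?_)
  rw [norm_mul]
  calc _ ≤ (A * (1 + ‖y‖) ^ M) * (C * polyDecay (M + (Module.finrank ℝ V + 1)) y) := by
        gcongr
        · exact hfb y
        · exact h y
    _ = A * C * ((1 + ‖y‖) ^ M * polyDecay (M + (Module.finrank ℝ V + 1)) y) := by ring
    _ = _ := by rw [pow_mul_polyDecay_add]

theorem integrable_cexp_smul {f : V → ℂ} (hf : Integrable f) (ξ : V) :
    Integrable (fun v => Complex.exp (((-2 * Real.pi * inner ℝ v ξ : ℝ) : ℂ) * Complex.I) • f v) := by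
  have hc : Continuous fun v : V =>
      Complex.exp (((-2 * Real.pi * inner ℝ v ξ : ℝ) : ℂ) * Complex.I) := by fun_prop
  refine hf.norm.mono' (hc.aestronglyMeasurable.smul hf.aestronglyMeasurable) (Eventually.of_forall fun v => ?_)
  rw [norm_smul, Complex.norm_exp_ofReal_mul_I, one_mul]

/-- Splitting off the first order Taylor polynomial in a Fourier transform against a Schwartz
function. -/
theorem fourier_translate_mul_schwartz {q : V → ℝ} (hq : HasQuadraticGrowth q) (u : 𝓢(V, ℂ))
    (m ξ : V) :
    𝓕 (fun y => (q (m + y) : ℂ) * u y) ξ = 𝓕 (fun y => (taylorRemainder q m y : ℂ) * u y) ξ +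
      ((q m : ℂ) * 𝓕 (fun y => u y) ξ +
        𝓕 (fun y => ((inner ℝ y ((InnerProductSpace.toDual ℝ V).symm (fderiv ℝ q m)) : ℝ) : ℂ) * u y) ξ) := by
  set a := (InnerProductSpace.toDual ℝ V).symm (fderiv ℝ q m)
  obtain ⟨A, hA, hAq⟩ := hq.norm_le
  have hc : Continuous (fun y => (q (m + y) : ℂ)) :=
    Complex.continuous_ofReal.comp (hq.contDiff.continuous.comp (by fun_prop))
  have i1 : Integrable (fun y => (q (m + y) : ℂ) * u y) := by
    refine integrable_mul_schwartz hc.aestronglyMeasurable u (A := A * (1 + ‖m‖) ^ 2) (M := 2)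
      (fun y => ?_)
    rw [Complex.norm_real]
    refine (hAq _).trans ?_
    rw [mul_assoc, ← mul_pow]
    gcongr
    exact one_add_norm_add_le m y
  have i2 : Integrable (fun y => (q m : ℂ) * u y) := u.integrable.const_mul _
  have i3 : Integrable (fun y => ((inner ℝ y a : ℝ) : ℂ) * u y) := by
    refine integrable_mul_schwartz (Continuous.aestronglyMeasurable (by fun_prop)) u (A := ‖a‖)
      (M := 1) (fun y => ?_)
    rw [Complex.norm_real, pow_one]
    refine (norm_inner_le_norm _ _).trans ?_
    nlinarith [norm_nonneg a, norm_nonneg y]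
  have hT : ∀ y, (taylorRemainder q m y : ℂ) * u y =
      (q (m + y) : ℂ) * u y - ((q m : ℂ) * u y + ((inner ℝ y a : ℝ) : ℂ) * u y) := by
    intro y
    have : fderiv ℝ q m y = inner ℝ y a := by
      rw [real_inner_comm]
      simp [a]
    rw [taylorRemainder, this]
    push_cast
    ring
  have i4 : Integrable (fun v => Complex.exp (((-2 * Real.pi * inner ℝ v ξ : ℝ) : ℂ) * Complex.I) •
      ((q m : ℂ) * u v) + Complex.exp (((-2 * Real.pi * inner ℝ v ξ : ℝ) : ℂ) * Complex.I) •
      (((inner ℝ v a : ℝ) : ℂ) * u v)) := (integrable_cexp_smul i2 ξ).add (integrable_cexp_smul i3 ξ)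
  simp_rw [hT, Real.fourier_eq', smul_sub, smul_add]
  rw [integral_sub (integrable_cexp_smul i1 ξ) i4,
    integral_add (integrable_cexp_smul i2 ξ) (integrable_cexp_smul i3 ξ), ← integral_const_mul]
  have : ∀ v, Complex.exp (((-2 * Real.pi * inner ℝ v ξ : ℝ) : ℂ) * Complex.I) • ((q m : ℂ) * u v) =
      (q m : ℂ) * Complex.exp (((-2 * Real.pi * inner ℝ v ξ : ℝ) : ℂ) * Complex.I) • u v := by
    intro v
    simp only [smul_eq_mul]
    ring
  simp_rw [this]
  ring

end FourierAffine

/-! ### Comparison of the Weyl and Toeplitz kernels. -/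

section Kernels

variable {d : ℕ}

/-- The phase of the scalar product of two coherent states. -/
def cohPhase (z w : PhaseSpace d) : ℂ :=
  Complex.exp (((-(2 * Real.pi) * inner ℝ (z.snd - w.snd) ((1 / 2 : ℝ) • (z.fst + w.fst)) : ℝ) : ℂ)
    * Complex.I)

/-- The scalar product of the coherent states at `z` and `w`. -/
def overlap (z w : PhaseSpace d) : ℂ :=
  cohPhase z w * (Real.exp (-(Real.pi / 2) * ‖z - w‖ ^ 2) : ℝ)

/-- The image of `z - w` under the symplectic rotation. -/
def sympDiff (z w : PhaseSpace d) : PhaseSpace d :=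
  WithLp.toLp 2 (z.snd - w.snd, -(z.fst - w.fst))

theorem norm_sympDiff_sq (z w : PhaseSpace d) : ‖sympDiff z w‖ ^ 2 = ‖z - w‖ ^ 2 := by
  rw [WithLp.prod_norm_sq_eq_of_L2, WithLp.prod_norm_sq_eq_of_L2]
  simp only [sympDiff, WithLp.toLp_fst, WithLp.toLp_snd, norm_neg, WithLp.sub_fst, WithLp.sub_snd]
  ring

theorem norm_sympDiff (z w : PhaseSpace d) : ‖sympDiff z w‖ = ‖z - w‖ :=
  (sq_eq_sq₀ (norm_nonneg _) (norm_nonneg _)).1 (norm_sympDiff_sq z w)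

theorem norm_cohPhase (z w : PhaseSpace d) : ‖cohPhase z w‖ = 1 := Complex.norm_exp_ofReal_mul_I _

theorem norm_overlap (z w : PhaseSpace d) :
    ‖overlap z w‖ = Real.exp (-(Real.pi / 2) * ‖z - w‖ ^ 2) := by
  rw [overlap, norm_mul, norm_cohPhase, one_mul, Complex.norm_real,
    Real.norm_of_nonneg (by positivity)]

theorem conj_cexp_ofReal_mul_I (t : ℝ) :
    starRingEnd ℂ (Complex.exp ((t : ℂ) * Complex.I)) = Complex.exp (((-t : ℝ) : ℂ) * Complex.I) := by
  rw [← Complex.exp_conj, map_mul, Complex.conj_ofReal, Complex.conj_I]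
  push_cast
  ring_nf

theorem conj_cohPhase (z w : PhaseSpace d) : starRingEnd ℂ (cohPhase z w) = cohPhase w z := by
  rw [cohPhase, cohPhase, conj_cexp_ofReal_mul_I, add_comm w.fst, ← neg_sub w.snd, inner_neg_left]
  ring_nf

theorem conj_overlap (z w : PhaseSpace d) : starRingEnd ℂ (overlap z w) = overlap w z := by
  rw [overlap, map_mul, conj_cohPhase, Complex.conj_ofReal, overlap, norm_sub_rev]

theorem continuous_overlap :
    Continuous (fun p : PhaseSpace d × PhaseSpace d => overlap p.1 p.2) := by
  unfold overlap cohPhase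
  have h1 := continuous_phase_fst (d := d)
  have h2 := continuous_phase_snd (d := d)
  fun_prop

theorem conj_wignerKernel (z w ρ : PhaseSpace d) :
    starRingEnd ℂ (wignerKernel z w ρ) = wignerKernel w z ρ := by
  rw [wignerKernel, map_mul, Complex.conj_ofReal, conj_cexp_ofReal_mul_I, wignerKernel,
    add_comm w z, add_comm w.snd, ← neg_sub z.fst, ← neg_sub z.snd w.snd, inner_neg_left,
    inner_neg_left]
  ring_nf

/-- Centring the integration variable at the midpoint `m` of the two positions completes the square;
what remains is the Fourier transform of a Gaussian at the difference of the frequencies. -/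
theorem coherentTransform_coherentState (z w : PhaseSpace d) :
    coherentTransform (coherentState w) z = overlap z w := by
  set m := (1 / 2 : ℝ) • (z.fst + w.fst) with hm
  set η := -(z.snd - w.snd) with hη
  rw [coherentTransform, ← integral_add_left_eq_self _ m]
  have hpt : ∀ t : BaseSpace d, starRingEnd ℂ (coherentState z (m + t)) * coherentState w (m + t) =
      ((2 : ℝ) ^ ((d : ℝ) / 2) * Real.exp (-(Real.pi / 2) * ‖z.fst - w.fst‖ ^ 2) : ℝ) * cohPhase z w *
        Complex.exp (-((2 * Real.pi : ℝ) : ℂ) * (‖t‖ : ℂ) ^ 2 +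
        (2 * Real.pi * Complex.I) * ((inner ℝ η t : ℝ) : ℂ)) := by
    intro t
    simp only [coherentState_apply, map_mul, Complex.conj_ofReal, conj_planeWave]
    have hg : gaussWindow (m + t - z.fst) * gaussWindow (m + t - w.fst) =
        (2 : ℝ) ^ ((d : ℝ) / 2) * Real.exp (-(Real.pi / 2) * ‖z.fst - w.fst‖ ^ 2) *
          Real.exp (-(2 * Real.pi) * ‖t‖ ^ 2) := by
      have hn : ‖m + t - z.fst‖ ^ 2 + ‖m + t - w.fst‖ ^ 2 =
          2 * ‖t‖ ^ 2 + 1 / 2 * ‖z.fst - w.fst‖ ^ 2 := by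
        have e1 : m + t - z.fst = t - (1 / 2 : ℝ) • (z.fst - w.fst) := by rw [hm]; module
        have e2 : m + t - w.fst = t + (1 / 2 : ℝ) • (z.fst - w.fst) := by rw [hm]; module
        rw [e1, e2]
        generalize z.fst - w.fst = c
        rw [norm_add_sq_real, norm_sub_sq_real, norm_smul]
        norm_num
        ring
      have h2 : (2 : ℝ) ^ ((d : ℝ) / 4) * (2 : ℝ) ^ ((d : ℝ) / 4) = (2 : ℝ) ^ ((d : ℝ) / 2) := by
        rw [← Real.rpow_add (by norm_num)]
        ring_nf
      unfold gaussWindow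
      calc _ = ((2 : ℝ) ^ ((d : ℝ) / 4) * (2 : ℝ) ^ ((d : ℝ) / 4)) *
            Real.exp (-Real.pi * (‖m + t - z.fst‖ ^ 2 + ‖m + t - w.fst‖ ^ 2)) := by
            rw [mul_add, Real.exp_add]; ring
        _ = _ := by
            rw [hn, h2, mul_assoc, ← Real.exp_add]
            ring_nf
    have hp : planeWave (-z.snd) (m + t) * planeWave w.snd (m + t) =
        cohPhase z w * Complex.exp ((2 * Real.pi * Complex.I) * ((inner ℝ η t : ℝ) : ℂ)) := by
      have hin : inner ℝ (-z.snd) (m + t) + inner ℝ w.snd (m + t) =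
          -inner ℝ (z.snd - w.snd) m + inner ℝ η t := by
        rw [hη]
        simp only [inner_add_right, inner_sub_left, inner_neg_left]
        ring
      simp only [planeWave, cohPhase, ← Complex.exp_add]
      congr 1
      rw [← add_mul]
      have : ((2 * Real.pi * inner ℝ (-z.snd) (m + t) : ℝ) : ℂ) +
          ((2 * Real.pi * inner ℝ w.snd (m + t) : ℝ) : ℂ) =
          ((2 * Real.pi * (-inner ℝ (z.snd - w.snd) m + inner ℝ η t) : ℝ) : ℂ) := by
        rw [← hin]; push_cast; ring
      rw [this, ← hm]
      push_cast
      ring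
    calc _ = ((gaussWindow (m + t - z.fst) * gaussWindow (m + t - w.fst) : ℝ) : ℂ) *
          (planeWave (-z.snd) (m + t) * planeWave w.snd (m + t)) := by push_cast; ring
      _ = _ := by
          rw [hg, hp, Complex.exp_add]
          push_cast
          ring
  simp_rw [hpt]
  rw [integral_const_mul, GaussianFourier.integral_cexp_neg_mul_sq_norm_add
    (by simp [Real.pi_pos])]
  have hpi : (Real.pi : ℂ) ≠ 0 := by exact_mod_cast Real.pi_ne_zero
  have hb : (Real.pi : ℂ) / ((2 * Real.pi : ℝ) : ℂ) = ((2⁻¹ : ℝ) : ℂ) := by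
    push_cast
    field_simp
  have he : (2 * (Real.pi : ℂ) * Complex.I) ^ 2 * (‖η‖ : ℂ) ^ 2 / (4 * ((2 * Real.pi : ℝ) : ℂ)) =
      ((-(Real.pi / 2) * ‖η‖ ^ 2 : ℝ) : ℂ) := by
    rw [mul_pow, Complex.I_sq]
    push_cast
    field_simp
    ring
  have h2 : (((2⁻¹ : ℝ) : ℂ) ^ ((d : ℂ) / 2)) = (((2⁻¹ : ℝ) ^ ((d : ℝ) / 2) : ℝ) : ℂ) := by
    rw [Complex.ofReal_cpow (by norm_num)]
    push_cast
    rfl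
  have h3 : (2 : ℝ) ^ ((d : ℝ) / 2) * (2⁻¹ : ℝ) ^ ((d : ℝ) / 2) = 1 := by
    rw [← Real.mul_rpow (by norm_num) (by norm_num)]
    norm_num
  rw [hb, he, finrank_euclideanSpace_fin, h2, overlap, WithLp.prod_norm_sq_eq_of_L2 (z - w),
    WithLp.sub_fst, WithLp.sub_snd, mul_add, Real.exp_add, hη, norm_neg, ← Complex.ofReal_exp]
  calc _ = (((2 : ℝ) ^ ((d : ℝ) / 2) * (2⁻¹ : ℝ) ^ ((d : ℝ) / 2) : ℝ) : ℂ) * (cohPhase z w *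
        ((Real.exp (-(Real.pi / 2) * ‖z.fst - w.fst‖ ^ 2) *
          Real.exp (-(Real.pi / 2) * ‖z.snd - w.snd‖ ^ 2) : ℝ) : ℂ)) := by push_cast; ring
    _ = _ := by rw [h3]; push_cast; ring

theorem inner_sympDiff (z w Y : PhaseSpace d) :
    inner ℝ Y (sympDiff z w) = inner ℝ (z.snd - w.snd) Y.fst - inner ℝ (z.fst - w.fst) Y.snd := by
  rw [WithLp.prod_inner_apply]
  change inner ℝ Y.fst (z.snd - w.snd) + inner ℝ Y.snd (-(z.fst - w.fst)) = _
  rw [inner_neg_right, real_inner_comm, real_inner_comm (z.fst - w.fst)]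
  ring

/-- Seen from the midpoint, the cross-Wigner function is a fixed Gaussian times a plane wave of
frequency `sympDiff z w`. The Weyl kernel therefore becomes a Fourier transform of the translated
symbol times a Schwartz function. -/
theorem wignerKernel_add (z w Y : PhaseSpace d) :
    wignerKernel z w ((1 / 2 : ℝ) • (z + w) + Y) = cohPhase z w * (2 ^ d : ℝ) *
      (Complex.exp (((-2 * Real.pi * inner ℝ Y (sympDiff z w) : ℝ) : ℂ) * Complex.I) *
        (gaussianSchwartz (2 * Real.pi) (by positivity) : 𝓢(PhaseSpace d, ℂ)) Y) := by
  rw [gaussianSchwartz_apply, wignerKernel, add_sub_cancel_left, cohPhase, inner_sympDiff]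
  have h1 : ((1 / 2 : ℝ) • (z + w) + Y).snd - (1 / 2 : ℝ) • (z.snd + w.snd) = Y.snd :=
    add_sub_cancel_left _ _
  have h2 : ((1 / 2 : ℝ) • (z + w) + Y).fst = (1 / 2 : ℝ) • (z.fst + w.fst) + Y.fst := rfl
  rw [h1, h2, inner_add_right]
  set A := inner ℝ (z.snd - w.snd) ((1 / 2 : ℝ) • (z.fst + w.fst))
  have h3 : ((2 * Real.pi * (inner ℝ (z.fst - w.fst) Y.snd - (A + inner ℝ (z.snd - w.snd) Y.fst)) : ℝ)
      : ℂ) * Complex.I = ((-(2 * Real.pi) * A : ℝ) : ℂ) * Complex.I +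
      ((-2 * Real.pi * (inner ℝ (z.snd - w.snd) Y.fst - inner ℝ (z.fst - w.fst) Y.snd) : ℝ) : ℂ) *
        Complex.I := by
    push_cast; ring
  rw [h3, Complex.exp_add]
  push_cast
  ring

/-- The Toeplitz counterpart of `wignerKernel_add`: the Gaussian is wider and the frequency is
halved, and the decay in `z - w` that this loses reappears as an explicit prefactor. -/
theorem overlap_mul_overlap (z w Y : PhaseSpace d) :
    overlap z ((1 / 2 : ℝ) • (z + w) + Y) * overlap ((1 / 2 : ℝ) • (z + w) + Y) w =
      cohPhase z w * (Real.exp (-(Real.pi / 4) * ‖z - w‖ ^ 2) : ℝ) *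
      (Complex.exp (((-2 * Real.pi * inner ℝ Y ((1 / 2 : ℝ) • sympDiff z w) : ℝ) : ℂ) * Complex.I) *
        (gaussianSchwartz Real.pi Real.pi_pos : 𝓢(PhaseSpace d, ℂ)) Y) := by
  set v := (1 / 2 : ℝ) • (z + w) + Y with hv
  have hphase : cohPhase z v * cohPhase v w = cohPhase z w *
      Complex.exp (((-2 * Real.pi * inner ℝ Y ((1 / 2 : ℝ) • sympDiff z w) : ℝ) : ℂ) * Complex.I) := by
    simp only [cohPhase, ← Complex.exp_add, ← add_mul]
    congr 2
    have h1 : v.fst = (1 / 2 : ℝ) • (z.fst + w.fst) + Y.fst := rfl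
    have h2 : v.snd = (1 / 2 : ℝ) • (z.snd + w.snd) + Y.snd := rfl
    rw [inner_smul_right Y, inner_sympDiff, h1, h2, real_inner_comm Y.snd, ← Complex.ofReal_add,
      ← Complex.ofReal_add]
    congr 1
    simp only [inner_add_left, inner_add_right, inner_sub_left, inner_sub_right, inner_smul_left,
      inner_smul_right, conj_trivial]
    ring
  have hexp : Real.exp (-(Real.pi / 2) * ‖z - v‖ ^ 2) * Real.exp (-(Real.pi / 2) * ‖v - w‖ ^ 2) =
      Real.exp (-(Real.pi / 4) * ‖z - w‖ ^ 2) * Real.exp (-Real.pi * ‖Y‖ ^ 2) := by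
    rw [← Real.exp_add, ← Real.exp_add]
    congr 1
    have e1 : z - v = (1 / 2 : ℝ) • (z - w) - Y := by rw [hv]; module
    have e2 : v - w = (1 / 2 : ℝ) • (z - w) + Y := by rw [hv]; module
    rw [e1, e2]
    generalize z - w = c
    rw [norm_add_sq_real, norm_sub_sq_real, norm_smul]
    norm_num
    ring
  rw [gaussianSchwartz_apply]
  calc _ = (cohPhase z v * cohPhase v w) * ((Real.exp (-(Real.pi / 2) * ‖z - v‖ ^ 2) *
        Real.exp (-(Real.pi / 2) * ‖v - w‖ ^ 2) : ℝ) : ℂ) := by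
        rw [overlap, overlap]; push_cast; ring
    _ = _ := by rw [hphase, hexp]; push_cast; ring

/-- The matrix element, between the coherent states at `z` and `w`, of the Toeplitz operator with
symbol `q`. -/
def toeplitzKernel (q : PhaseSpace d → ℝ) (z w : PhaseSpace d) : ℂ :=
  ∫ v, overlap z v * q v * overlap v w

theorem weylKernel_eq_fourier (q : PhaseSpace d → ℝ) (z w : PhaseSpace d) :
    weylKernel q z w = cohPhase z w * (2 ^ d : ℝ) *
      𝓕 (fun Y => (q ((1 / 2 : ℝ) • (z + w) + Y) : ℂ) *
        (gaussianSchwartz (2 * Real.pi) (by positivity) : 𝓢(PhaseSpace d, ℂ)) Y) (sympDiff z w) := by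
  rw [weylKernel, ← integral_add_left_eq_self _ ((1 / 2 : ℝ) • (z + w)), Real.fourier_eq',
    ← integral_const_mul]
  congr 1
  funext Y
  rw [wignerKernel_add, smul_eq_mul]
  ring

theorem toeplitzKernel_eq_fourier (q : PhaseSpace d → ℝ) (z w : PhaseSpace d) :
    toeplitzKernel q z w = cohPhase z w * (Real.exp (-(Real.pi / 4) * ‖z - w‖ ^ 2) : ℝ) *
      𝓕 (fun Y => (q ((1 / 2 : ℝ) • (z + w) + Y) : ℂ) *
        (gaussianSchwartz Real.pi Real.pi_pos : 𝓢(PhaseSpace d, ℂ)) Y)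
          ((1 / 2 : ℝ) • sympDiff z w) := by
  rw [toeplitzKernel, ← integral_add_left_eq_self _ ((1 / 2 : ℝ) • (z + w)), Real.fourier_eq',
    ← integral_const_mul]
  congr 1
  funext Y
  rw [mul_right_comm, overlap_mul_overlap, smul_eq_mul]
  ring

/-- The difference of the matrix elements of the Weyl and the Toeplitz operator with symbol `q`. -/
def remainderKernel (q : PhaseSpace d → ℝ) (z w : PhaseSpace d) : ℂ :=
  weylKernel q z w - toeplitzKernel q z w

/-- Both kernels are Fourier transforms of the symbol translated to the midpoint, times a Gaussian.
Splitting off the affine Taylor polynomial, its constant part contributes equally by `hG`, and its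
linear part contributes equally because the first moments of the two even Gaussians are matched.
Only the remainders are left. -/
theorem remainderKernel_eq {q : PhaseSpace d → ℝ} (hq : HasQuadraticGrowth q) (z w : PhaseSpace d) :
    remainderKernel q z w = cohPhase z w * ((2 ^ d : ℝ) *
      𝓕 (fun Y => (taylorRemainder q ((1 / 2 : ℝ) • (z + w)) Y : ℂ) *
        (gaussianSchwartz (2 * Real.pi) (by positivity) : 𝓢(PhaseSpace d, ℂ)) Y) (sympDiff z w) -
      (Real.exp (-(Real.pi / 4) * ‖z - w‖ ^ 2) : ℝ) *
      𝓕 (fun Y => (taylorRemainder q ((1 / 2 : ℝ) • (z + w)) Y : ℂ) *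
        (gaussianSchwartz Real.pi Real.pi_pos : 𝓢(PhaseSpace d, ℂ)) Y)
          ((1 / 2 : ℝ) • sympDiff z w)) := by
  have hdim : ((Module.finrank ℝ (PhaseSpace d) : ℝ) / 2) = d := by
    rw [finrank_phaseSpace]; push_cast; ring
  have hpi := Real.pi_pos
  -- The case of the symbol `1`: both sides equal `e^{-π|z-w|²/2}`, the modulus of the overlap. On
  -- the right, half of the exponent is the prefactor and half is the Fourier transform.
  have hG : (2 ^ d : ℝ) * 𝓕 (fun Y : PhaseSpace d =>
      (gaussianSchwartz (2 * Real.pi) (by positivity) : 𝓢(PhaseSpace d, ℂ)) Y) (sympDiff z w) =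
      (Real.exp (-(Real.pi / 4) * ‖z - w‖ ^ 2) : ℝ) * 𝓕 (fun Y : PhaseSpace d =>
      (gaussianSchwartz Real.pi Real.pi_pos : 𝓢(PhaseSpace d, ℂ)) Y)
        ((1 / 2 : ℝ) • sympDiff z w) := by
    rw [fourier_gaussianSchwartz, fourier_gaussianSchwartz, hdim, Real.rpow_natCast,
      Real.rpow_natCast, norm_smul, norm_sympDiff, div_self hpi.ne', one_pow, one_mul]
    have h1 : Real.pi / (2 * Real.pi) = 2⁻¹ := by field_simp
    rw [h1]
    have h2 : (2 : ℝ) ^ d * (2⁻¹ : ℝ) ^ d = 1 := by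
      rw [← mul_pow]; norm_num
    have h3 : (2 : ℝ) ^ d * ((2⁻¹ : ℝ) ^ d * Real.exp (-Real.pi ^ 2 * ‖z - w‖ ^ 2 / (2 * Real.pi))) =
        Real.exp (-(Real.pi / 4) * ‖z - w‖ ^ 2) *
          Real.exp (-Real.pi ^ 2 * (‖(1 / 2 : ℝ)‖ * ‖z - w‖) ^ 2 / Real.pi) := by
      rw [← mul_assoc, h2, one_mul, ← Real.exp_add]
      congr 1
      norm_num
      field_simp
      ring
    exact_mod_cast h3
  rw [remainderKernel, weylKernel_eq_fourier, toeplitzKernel_eq_fourier,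
    fourier_translate_mul_schwartz hq, fourier_translate_mul_schwartz hq,
    fourier_inner_mul_gaussianSchwartz, fourier_inner_mul_gaussianSchwartz, inner_smul_left]
  -- The linear part: the narrower Gaussian yields the moment factor `1/2`, the wider one yields `1`
  -- at half the frequency.
  have h2 : Real.pi / (2 * Real.pi) = 1 / 2 := by field_simp
  rw [h2, div_self hpi.ne', one_mul]
  simp only [conj_trivial]
  generalize 𝓕 (fun Y : PhaseSpace d =>
      (gaussianSchwartz (2 * Real.pi) (by positivity) : 𝓢(PhaseSpace d, ℂ)) Y) (sympDiff z w) = G₁ at *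
  generalize 𝓕 (fun Y : PhaseSpace d =>
      (gaussianSchwartz Real.pi Real.pi_pos : 𝓢(PhaseSpace d, ℂ)) Y)
        ((1 / 2 : ℝ) • sympDiff z w) = G₂ at *
  generalize ((1 / 2 * inner ℝ (sympDiff z w) ((InnerProductSpace.toDual ℝ (PhaseSpace d)).symm
    (fderiv ℝ q ((1 / 2 : ℝ) • (z + w)))) : ℝ) : ℂ) = c
  linear_combination (cohPhase z w * (q ((1 / 2 : ℝ) • (z + w)) - c * Complex.I)) * hG

/-- The Weyl and the Toeplitz quantization differ by an operator whose matrix elements between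
coherent states are controlled by the derivatives of the symbol of order at least two. -/
theorem exists_norm_remainderKernel_le (d : ℕ) : ∃ C, 0 ≤ C ∧ ∀ (q : PhaseSpace d → ℝ) (B : ℝ),
    HasQuadraticGrowth q → 0 ≤ B →
    (∀ k, 2 ≤ k → k ≤ 2 * d + 2 → ∀ x, ‖iteratedFDeriv ℝ k q x‖ ≤ B) →
    ∀ z w, ‖remainderKernel q z w‖ ≤ C * B * polyDecay (2 * d + 1) (z - w) := by
  obtain ⟨C₁, hC₁, h₁⟩ := exists_fourier_mul_schwartz_le
    (gaussianSchwartz (2 * Real.pi) (by positivity) : 𝓢(PhaseSpace d, ℂ)) (2 * d + 1) 2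
  -- No decay is asked of the Toeplitz term, since its Gaussian prefactor in `z - w` provides it.
  obtain ⟨C₂, hC₂, h₂⟩ := exists_fourier_mul_schwartz_le
    (gaussianSchwartz Real.pi Real.pi_pos : 𝓢(PhaseSpace d, ℂ)) 0 2
  obtain ⟨C₃, hC₃, h₃⟩ := exists_exp_le_polyDecay (V := PhaseSpace d) (Real.pi / 4)
    (by positivity) (2 * d + 1)
  refine ⟨2 ^ d * C₁ + C₃ * C₂, by positivity, fun q B hq hB0 hB z w => ?_⟩
  set m := (1 / 2 : ℝ) • (z + w)
  have hρ : ContDiff ℝ ∞ (fun Y => (taylorRemainder q m Y : ℂ)) :=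
    Complex.ofRealCLM.contDiff.comp (contDiff_taylorRemainder hq.contDiff m)
  have hρb : ∀ k ≤ 2 * d + 1, ∀ Y, ‖iteratedFDeriv ℝ k (fun Y => (taylorRemainder q m Y : ℂ)) Y‖ ≤
      B * (1 + ‖Y‖) ^ 2 := by
    intro k hk Y
    rw [norm_iteratedFDeriv_ofReal (contDiff_taylorRemainder hq.contDiff m)]
    exact norm_iteratedFDeriv_taylorRemainder_le hq.contDiff hB0 (by omega) hB m k (by omega) Y
  have e1 := h₁ _ B hB0 hρ hρb (sympDiff z w)
  have e2 := h₂ _ B hB0 hρ (fun k hk => hρb k (by omega)) ((1 / 2 : ℝ) • sympDiff z w)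
  have hp : polyDecay (2 * d + 1) (sympDiff z w) = polyDecay (2 * d + 1) (z - w) := by
    simp only [polyDecay, norm_sympDiff]
  have hp0 : polyDecay 0 ((1 / 2 : ℝ) • sympDiff z w) = 1 := by simp [polyDecay]
  rw [hp] at e1
  rw [hp0, mul_one] at e2
  have hpd := polyDecay_nonneg (2 * d + 1) (z - w)
  rw [remainderKernel_eq hq, norm_mul, norm_cohPhase, one_mul]
  refine (norm_sub_le _ _).trans ?_
  rw [norm_mul, norm_mul, Complex.norm_real, Complex.norm_real, Real.norm_of_nonneg (by positivity),
    Real.norm_of_nonneg (by positivity)]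
  calc _ ≤ 2 ^ d * (C₁ * B * polyDecay (2 * d + 1) (z - w)) +
        (C₃ * polyDecay (2 * d + 1) (z - w)) * (C₂ * B) := by
        gcongr
        exact h₃ _
    _ = _ := by ring

/-- Because `q` is real, both kernels are Hermitian; this makes the remainder operator symmetric. -/
theorem conj_remainderKernel (q : PhaseSpace d → ℝ) (z w : PhaseSpace d) :
    starRingEnd ℂ (remainderKernel q z w) = remainderKernel q w z := by
  rw [remainderKernel, remainderKernel, map_sub, weylKernel, weylKernel, toeplitzKernel,
    toeplitzKernel, ← integral_conj, ← integral_conj]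
  simp only [map_mul, Complex.conj_ofReal, conj_wignerKernel, conj_overlap]
  congr 2
  funext v
  ring

theorem stronglyMeasurable_remainderKernel {q : PhaseSpace d → ℝ} (hq : Continuous q) :
    StronglyMeasurable (fun p : PhaseSpace d × PhaseSpace d => remainderKernel q p.1 p.2) := by
  refine StronglyMeasurable.sub ?_ ?_
  · refine StronglyMeasurable.integral_prod_right (f := fun (p : PhaseSpace d × PhaseSpace d) ρ =>
      (q ρ : ℂ) * wignerKernel p.1 p.2 ρ) ?_
    exact ((Complex.continuous_ofReal.comp (hq.comp continuous_snd)).mul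
      (continuous_wignerKernel.comp (by fun_prop :
        Continuous fun p : (PhaseSpace d × PhaseSpace d) × PhaseSpace d =>
          (p.1.1, p.1.2, p.2)))).stronglyMeasurable
  · refine StronglyMeasurable.integral_prod_right (f := fun (p : PhaseSpace d × PhaseSpace d) v =>
      overlap p.1 v * (q v : ℂ) * overlap v p.2) ?_
    exact (((continuous_overlap.comp (by fun_prop :
        Continuous fun p : (PhaseSpace d × PhaseSpace d) × PhaseSpace d => (p.1.1, p.2))).mul
      (Complex.continuous_ofReal.comp (hq.comp continuous_snd))).mul
      (continuous_overlap.comp (by fun_prop :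
        Continuous fun p : (PhaseSpace d × PhaseSpace d) × PhaseSpace d =>
          (p.2, p.1.2)))).stronglyMeasurable

end Kernels

end

noncomputable section

/-! ### A criterion for essential self-adjointness. -/

section SelfAdjointCriterion

open scoped InnerProductSpace LinearPMap

variable {H : Type*} [NormedAddCommGroup H] [InnerProductSpace ℂ H]

/-- Points of the closure of the graph are limits of sequences in the graph. -/
theorem LinearPMap.IsClosable.exists_seq_tendsto {A : H →ₗ.[ℂ] H} (hA : A.IsClosable)
    (u : A.closure.domain) : ∃ x : ℕ → A.domain, Tendsto (fun n => (x n : H)) atTop (𝓝 u) ∧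
      Tendsto (fun n => A (x n)) atTop (𝓝 (A.closure u)) := by
  have h1 : ((u : H), A.closure u) ∈ A.graph.topologicalClosure := by
    rw [hA.graph_closure_eq_closure_graph]; exact A.closure.mem_graph u
  rw [← SetLike.mem_coe, Submodule.topologicalClosure_coe, mem_closure_iff_seq_limit] at h1
  obtain ⟨p, hp, hlim⟩ := h1
  have h2 : ∀ n, ∃ x : A.domain, (x : H) = (p n).1 ∧ A x = (p n).2 := by
    intro n; simpa using hp n
  choose x hx1 hx2 using h2
  refine ⟨x, ?_, ?_⟩
  · simp only [hx1]; exact (continuous_fst.tendsto _).comp hlim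
  · simp only [hx2]; exact (continuous_snd.tendsto _).comp hlim

variable [CompleteSpace H]

/-- A symmetric operator is contained in its adjoint, which is closed. -/
theorem LinearPMap.isClosable_of_isFormalAdjoint_self {A : H →ₗ.[ℂ] H}
    (hd : Dense (A.domain : Set H)) (hs : A.IsFormalAdjoint A) : A.IsClosable :=
  (LinearPMap.adjoint_isClosed hd).isClosable.leIsClosable (hs.le_adjoint hd)

theorem LinearPMap.isFormalAdjoint_closure_self {A : H →ₗ.[ℂ] H}
    (hd : Dense (A.domain : Set H)) (hs : A.IsFormalAdjoint A) :
    A.closure.IsFormalAdjoint A.closure := by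
  intro u v
  have hA := LinearPMap.isClosable_of_isFormalAdjoint_self hd hs
  obtain ⟨x, hx, hAx⟩ := hA.exists_seq_tendsto u
  obtain ⟨y, hy, hAy⟩ := hA.exists_seq_tendsto v
  refine tendsto_nhds_unique (hAx.inner hy) ?_
  simpa only [hs _ _] using hx.inner hAy

/-- A symmetric operator with `A + c` bounded below and of dense range has self-adjoint closure,
and `A + c` has a bounded symmetric inverse. -/
theorem LinearPMap.exists_resolvent {A : H →ₗ.[ℂ] H}
    (hd : Dense (A.domain : Set H)) (hs : A.IsFormalAdjoint A) {c δ : ℝ} (hδ : 0 < δ)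
    (hb : ∀ u : A.domain, δ * ‖(u : H)‖ ≤ ‖A u + (c : ℂ) • (u : H)‖)
    (hr : ∀ v : H, (∀ u : A.domain, ⟪v, A u + (c : ℂ) • (u : H)⟫_ℂ = 0) → v = 0) :
    IsSelfAdjoint A.closure ∧ ∃ B : H →L[ℂ] H, (B : H →ₗ[ℂ] H).IsSymmetric ∧
      (∀ f, (B f, f - (c : ℂ) • B f) ∈ A.closure.graph) ∧
      ∀ u : A.closure.domain, B (A.closure u + (c : ℂ) • (u : H)) = u := by
  have hA := LinearPMap.isClosable_of_isFormalAdjoint_self hd hs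
  have hsc := LinearPMap.isFormalAdjoint_closure_self hd hs
  set Q := A.closure with hQ
  have hbc : ∀ u : Q.domain, δ * ‖(u : H)‖ ≤ ‖Q u + (c : ℂ) • (u : H)‖ := by
    intro u
    obtain ⟨x, hx, hAx⟩ := hA.exists_seq_tendsto u
    exact le_of_tendsto_of_tendsto' (hx.norm.const_mul δ)
      (hAx.add (hx.const_smul (c : ℂ))).norm fun n => hb (x n)
  have hdense : Dense (Set.range fun u : A.domain => A u + (c : ℂ) • (u : H)) := by
    let L : A.domain →ₗ[ℂ] H := A.toFun + (c : ℂ) • A.domain.subtype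
    have hL : (Set.range fun u : A.domain => A u + (c : ℂ) • (u : H)) = (LinearMap.range L : Set H) := by
      ext y; simp [L]
    rw [hL, Submodule.dense_iff_topologicalClosure_eq_top,
      Submodule.topologicalClosure_eq_top_iff, Submodule.eq_bot_iff]
    intro v hv
    refine hr v fun u => ?_
    rw [Submodule.mem_orthogonal'] at hv
    exact hv _ ⟨u, rfl⟩
  -- Surjectivity of `Q + c`: approximate `f` from the dense range; the lower bound makes the
  -- preimages Cauchy, and the graph is closed.
  have hex : ∀ f, ∃ u : H, (u, f - (c : ℂ) • u) ∈ Q.graph := by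
    intro f
    obtain ⟨g, hg, hlim⟩ := mem_closure_iff_seq_limit.mp (hdense f)
    choose x hx using hg
    have hc : CauchySeq fun n => (x n : H) := by
      have hgc := hlim.cauchySeq
      rw [Metric.cauchySeq_iff] at hgc ⊢
      intro ε hε
      obtain ⟨N, hN⟩ := hgc (δ * ε) (by positivity)
      refine ⟨N, fun m hm n hn => ?_⟩
      have h1 := hN m hm n hn
      have h2 := hb (x m - x n)
      rw [dist_eq_norm] at h1 ⊢
      rw [← hx m, ← hx n] at h1
      have h3 : A (x m - x n) + (c : ℂ) • ((x m - x n : A.domain) : H)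
          = (A (x m) + (c : ℂ) • (x m : H)) - (A (x n) + (c : ℂ) • (x n : H)) := by
        rw [LinearPMap.map_sub, Submodule.coe_sub, smul_sub]; abel
      rw [h3] at h2
      exact lt_of_mul_lt_mul_left (h2.trans_lt h1) hδ.le
    obtain ⟨u, hu⟩ := cauchySeq_tendsto_of_complete hc
    refine ⟨u, ?_⟩
    rw [hQ, ← hA.graph_closure_eq_closure_graph, ← SetLike.mem_coe,
      Submodule.topologicalClosure_coe]
    have h4 : Tendsto (fun n => ((x n : H), A (x n))) atTop (𝓝 (u, f - (c : ℂ) • u)) := by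
      refine hu.prodMk_nhds ?_
      have := hlim.sub (hu.const_smul (c : ℂ))
      refine this.congr fun n => ?_
      rw [← hx n]; exact add_sub_cancel_right _ _
    exact mem_closure_of_tendsto h4 (Eventually.of_forall fun n => A.mem_graph (x n))
  have huniq : ∀ f u v, (u, f - (c : ℂ) • u) ∈ Q.graph → (v, f - (c : ℂ) • v) ∈ Q.graph → u = v := by
    intro f u v hu hv
    have h1 := Q.graph.sub_mem hu hv
    rw [Prod.mk_sub_mk] at h1
    obtain ⟨w, hw1, hw2⟩ := (Q.mem_graph_iff).mp h1
    have h2 := hbc w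
    rw [hw2, hw1] at h2
    have h3 : f - (c : ℂ) • u - (f - (c : ℂ) • v) + (c : ℂ) • (u - v) = 0 := by
      rw [smul_sub]; abel
    simp only [h3, norm_zero] at h2
    have h4 : ‖u - v‖ ≤ 0 := by
      by_contra hne
      push Not at hne
      have := mul_pos hδ hne
      linarith
    exact sub_eq_zero.mp (norm_le_zero_iff.mp h4)
  choose b hbg using hex
  let BL : H →ₗ[ℂ] H :=
    { toFun := b
      map_add' := fun f g => by
        refine huniq (f + g) _ _ (hbg _) ?_
        have := Q.graph.add_mem (hbg f) (hbg g)
        rw [Prod.mk_add_mk] at this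
        convert this using 2
        rw [smul_add]; abel
      map_smul' := fun r f => by
        refine huniq (r • f) _ _ (hbg _) ?_
        have := Q.graph.smul_mem r (hbg f)
        rw [Prod.smul_mk] at this
        simp only [RingHom.id_apply]
        convert this using 2
        rw [smul_sub, smul_comm] }
  have hbound : ∀ f, ‖BL f‖ ≤ δ⁻¹ * ‖f‖ := by
    intro f
    obtain ⟨w, hw1, hw2⟩ := (Q.mem_graph_iff).mp (hbg f)
    have h2 := hbc w
    rw [hw2, hw1] at h2
    simp only [sub_add_cancel] at h2
    change ‖b f‖ ≤ _
    rw [inv_mul_eq_div, le_div_iff₀ hδ, mul_comm]; exact h2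
  let B : H →L[ℂ] H := BL.mkContinuous δ⁻¹ hbound
  have hBg : ∀ f, (B f, f - (c : ℂ) • B f) ∈ Q.graph := hbg
  have hBQ : ∀ u : Q.domain, B (Q u + (c : ℂ) • (u : H)) = u := by
    intro u
    refine huniq (Q u + (c : ℂ) • (u : H)) _ _ (hBg _) ?_
    rw [add_sub_cancel_right]; exact Q.mem_graph u
  have hBs : (B : H →ₗ[ℂ] H).IsSymmetric := by
    intro f g
    obtain ⟨x, hx1, hx2⟩ := (Q.mem_graph_iff).mp (hBg f)
    obtain ⟨y, hy1, hy2⟩ := (Q.mem_graph_iff).mp (hBg g)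
    have h1 := hsc x y
    simp only at hx1 hx2 hy1 hy2
    rw [hx2, hy2, hx1, hy1, inner_sub_left, inner_sub_right, inner_smul_left, inner_smul_right,
      Complex.conj_ofReal] at h1
    have h2 : ⟪f, B g⟫_ℂ = ⟪B f, g⟫_ℂ := by linear_combination h1
    exact h2.symm
  refine ⟨?_, B, hBs, hBg, hBQ⟩
  rw [LinearPMap.isSelfAdjoint_def]
  have hdQ : Dense (Q.domain : Set H) := hd.mono (A.le_closure).1
  refine le_antisymm ?_ (hsc.le_adjoint hdQ)
  -- Given `y` in the domain of `Q†`, put `w = (Q† + c) y`. Symmetry of `B` shows that `y` and `B w`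
  -- have the same scalar products with every vector, so `y = B w` lies in the domain of `Q`.
  refine LinearPMap.le_of_le_graph fun p hp => ?_
  obtain ⟨y, hy1, hy2⟩ := (Q†.mem_graph_iff).mp hp
  have hfa := LinearPMap.adjoint_isFormalAdjoint hdQ
  set w := Q† y + (c : ℂ) • (y : H) with hw
  have hyB : (y : H) = B w := by
    refine ext_inner_left ℂ fun g => ?_
    obtain ⟨x, hx1, hx2⟩ := (Q.mem_graph_iff).mp (hBg g)
    simp only at hx1 hx2
    have h1 := hfa.symm x y
    have h2 : ⟪g, B w⟫_ℂ = ⟪B g, w⟫_ℂ := (hBs g w).symm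
    rw [h2, hw, inner_add_right, inner_smul_right]
    rw [hx2, hx1, inner_sub_left, inner_smul_left, Complex.conj_ofReal] at h1
    linear_combination h1
  have h5 := hBg w
  rw [← hyB] at h5
  have h6 : w - (c : ℂ) • (y : H) = Q† y := by rw [hw]; abel
  rw [h6, hy1, hy2] at h5
  exact h5

end SelfAdjointCriterion
end

noncomputable section

/-! ### Spectral measures of operators with compact resolvent. -/

section DiagonalSpectralMeasure

open scoped InnerProductSpace

/-- The spectral theorem for compact symmetric operators, in the form of a basis: Hilbert bases of
all eigenspaces, indexed by every complex number, are put together. Symmetry makes the eigenvalues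
that occur real, and injectivity excludes zero. -/
theorem exists_hilbertBasis_eigenvectors.{u} {H : Type u} [NormedAddCommGroup H]
    [InnerProductSpace ℂ H] [CompleteSpace H] {B : H →L[ℂ] H} (hc : IsCompactOperator B)
    (hs : (B : H →ₗ[ℂ] H).IsSymmetric) (hi : Function.Injective B) :
    ∃ (ι : Type u) (b : HilbertBasis ι ℂ H) (β : ι → ℝ),
      ∀ i, B (b i) = (β i : ℂ) • b i ∧ β i ≠ 0 := by
  let E : ℂ → Submodule ℂ H := fun μ => Module.End.eigenspace (B : Module.End ℂ H) μ
  have hEc : ∀ μ, CompleteSpace (E μ) := by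
    intro μ
    have : IsClosed (E μ : Set H) := by
      have : (E μ : Set H) = {x | B x = μ • x} := by
        ext x; simp [E]
      rw [this]
      exact isClosed_eq B.continuous (continuous_const_smul μ)
    exact this.completeSpace_coe
  choose w b hb using fun μ => exists_hilbertBasis ℂ (E μ)
  have hon : Orthonormal ℂ fun a : Σ μ, w μ => (E a.1).subtypeₗᵢ (b a.1 a.2) :=
    hs.orthogonalFamily_eigenspaces.orthonormal_sigma_orthonormal fun μ => (b μ).orthonormal
  have hbot : (Submodule.span ℂ (Set.range fun a : Σ μ, w μ => (E a.1).subtypeₗᵢ (b a.1 a.2)))ᗮ = ⊥ := by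
    rw [eq_bot_iff, ← ContinuousLinearMap.orthogonalComplement_iSup_eigenspaces_eq_bot hc hs]
    intro x hx
    rw [Submodule.mem_orthogonal'] at hx ⊢
    intro y hy
    induction hy using Submodule.iSup_induction' with
    | mem μ y hy =>
      have h1 := (E μ).subtypeL.hasSum ((b μ).hasSum_repr ⟨y, hy⟩)
      have h2 := (innerSL ℂ x).hasSum h1
      refine h2.unique ?_
      convert! hasSum_zero with i
      have := hx _ (Submodule.subset_span ⟨⟨μ, i⟩, rfl⟩)
      change ⟪x, (b μ i : H)⟫_ℂ = 0 at this
      simp [this]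
    | zero => simp
    | add y z _ _ h1 h2 => rw [inner_add_right, h1, h2, add_zero]
  refine ⟨Σ μ, w μ, HilbertBasis.mkOfOrthogonalEqBot hon hbot, fun a => a.1.re, fun a => ?_⟩
  rw [HilbertBasis.coe_mkOfOrthogonalEqBot]
  have hne : (b a.1 a.2 : H) ≠ 0 := by
    intro h0
    have := (b a.1).orthonormal.ne_zero a.2
    exact this (Subtype.ext h0)
  have hBa : B (b a.1 a.2 : H) = a.1 • (b a.1 a.2 : H) :=
    Module.End.mem_eigenspace_iff.mp (b a.1 a.2).2
  have hre : ((a.1.re : ℝ) : ℂ) = a.1 := by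
    have : Module.End.HasEigenvalue (B : Module.End ℂ H) a.1 :=
      Module.End.hasEigenvalue_of_hasEigenvector ⟨(b a.1 a.2).2, hne⟩
    exact Complex.conj_eq_iff_re.mp (hs.conj_eigenvalue_eq_self this)
  refine ⟨?_, ?_⟩
  · rw [hre]; exact hBa
  · intro (h0 : a.1.re = 0)
    rw [h0, Complex.ofReal_zero] at hre
    have h3 : ∀ x : H, a.1 • x = 0 := fun x => by rw [← hre, zero_smul]
    exact hne (hi (by rw [hBa, h3, map_zero]))

variable {H : Type*} [NormedAddCommGroup H] [InnerProductSpace ℂ H] {ι : Type*}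

theorem Complex.conj_mul_self_eq_norm_sq (z : ℂ) : starRingEnd ℂ z * z = ((‖z‖ ^ 2 : ℝ) : ℂ) := by
  rw [Complex.conj_mul', Complex.ofReal_pow]

theorem HilbertBasis.summable_norm_sq_inner (b : HilbertBasis ι ℂ H) (u : H) :
    Summable fun i => ‖⟪b i, u⟫_ℂ‖ ^ 2 := b.orthonormal.inner_products_summable u

variable [CompleteSpace H]

/-- The orthogonal projection onto the closed span of the basis vectors `b i` with `t i ∈ S`. -/
def HilbertBasis.spectralProj (b : HilbertBasis ι ℂ H) (t : ι → ℝ) (S : Set ℝ) : H →L[ℂ] H :=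
  (Submodule.span ℂ (b '' (t ⁻¹' S))).topologicalClosure.starProjection

open scoped Classical in
theorem HilbertBasis.spectralProj_self (b : HilbertBasis ι ℂ H) (t : ι → ℝ) (S : Set ℝ) (i : ι) :
    b.spectralProj t S (b i) = if t i ∈ S then b i else 0 := by
  split_ifs with h
  · exact Submodule.starProjection_eq_self_iff.mpr
      (Submodule.le_topologicalClosure _ (Submodule.subset_span ⟨i, h, rfl⟩))
  · refine (Submodule.starProjection_apply_eq_zero_iff _).mpr ?_
    rw [Submodule.orthogonal_closure, Submodule.mem_orthogonal']
    intro y hy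
    induction hy using Submodule.span_induction with
    | mem y hy =>
      obtain ⟨j, hj, rfl⟩ := hy
      exact b.orthonormal.2 fun hij => h (hij ▸ hj)
    | zero => simp
    | add y z _ _ h1 h2 => rw [inner_add_right, h1, h2, add_zero]
    | smul c y _ h1 => rw [inner_smul_right, h1, mul_zero]

theorem HilbertBasis.hasSum_spectralProj (b : HilbertBasis ι ℂ H) (t : ι → ℝ) (S : Set ℝ) (u : H) :
    HasSum ((t ⁻¹' S).indicator fun i => ⟪b i, u⟫_ℂ • b i) (b.spectralProj t S u) := by
  classical
  have := (b.spectralProj t S).hasSum (b.hasSum_repr u)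
  convert! this using 2 with i
  simp only [map_smul, b.spectralProj_self, b.repr_apply_apply, Set.indicator, Set.mem_preimage]
  split_ifs <;> simp

/-- The spectral measure of a diagonal operator. -/
def HilbertBasis.diagonalPVM (b : HilbertBasis ι ℂ H) (t : ι → ℝ) : ProjectionValuedMeasure H where
  proj := b.spectralProj t
  isStarProjection _ _ := isStarProjection_starProjection
  proj_univ := by
    ext u
    refine (b.hasSum_spectralProj t Set.univ u).unique ?_
    simpa [b.repr_apply_apply] using b.hasSum_repr u
  hasSum_iUnion S _ hd u := by
    classical
    -- As the `S n` are disjoint, `t i` lies in at most one of them. The double family over `ℕ × ι`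
    -- is thus supported on the graph of `k`; the default `0` is harmless because the term vanishes
    -- there.
    let k : ι → ℕ := fun i => if h : ∃ n, t i ∈ S n then h.choose else 0
    have hk : ∀ i n, t i ∈ S n → k i = n := by
      intro i n hn
      have h : ∃ n, t i ∈ S n := ⟨n, hn⟩
      by_contra hne
      have h1 : k i = h.choose := dif_pos h
      rw [h1] at hne
      exact Set.disjoint_left.mp (hd hne) h.choose_spec hn
    let g : ℕ × ι → H := fun p => (t ⁻¹' S p.1).indicator (fun i => ⟪b i, u⟫_ℂ • b i) p.2
    have hg : HasSum g (b.spectralProj t (⋃ n, S n) u) := by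
      have hinj : Function.Injective fun i : ι => (k i, i) := fun i j h => congrArg Prod.snd h
      rw [← hinj.hasSum_iff]
      · convert! b.hasSum_spectralProj t (⋃ n, S n) u using 1
        ext i
        simp only [Function.comp, g, Set.indicator, Set.mem_preimage, Set.mem_iUnion]
        by_cases h : ∃ n, t i ∈ S n
        · obtain ⟨n, hn⟩ := h
          rw [if_pos (by rw [hk i n hn]; exact hn), if_pos ⟨n, hn⟩]
        · rw [if_neg h, if_neg fun h' : t i ∈ S (k i) => h ⟨_, h'⟩]
      · rintro ⟨n, i⟩ hni
        refine Set.indicator_of_notMem (fun h => hni ⟨i, ?_⟩) _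
        exact Prod.ext (hk i n h) rfl
    exact hg.prod_fiberwise fun n => b.hasSum_spectralProj t (S n) u

/-- In the diagonal case the scalar measures are discrete, so the conditions on the domain and on
the form become statements about series. -/
theorem HilbertBasis.scalarMeasure_diagonalPVM (b : HilbertBasis ι ℂ H) (t : ι → ℝ) (u : H) :
    (b.diagonalPVM t).scalarMeasure u =
      Measure.sum fun i => ENNReal.ofReal (‖⟪b i, u⟫_ℂ‖ ^ 2) • Measure.dirac (t i) := by
  ext S hS
  rw [ProjectionValuedMeasure.scalarMeasure, Measure.ofMeasurable_apply S hS,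
    Measure.sum_apply _ hS]
  have h1 : HasSum (fun i => (⟪u, (t ⁻¹' S).indicator (fun i => ⟪b i, u⟫_ℂ • b i) i⟫_ℂ).re)
      (⟪u, (b.diagonalPVM t).proj S u⟫_ℂ).re :=
    Complex.reCLM.hasSum ((innerSL ℂ u).hasSum (b.hasSum_spectralProj t S u))
  have h2 : ∀ i, (⟪u, (t ⁻¹' S).indicator (fun i => ⟪b i, u⟫_ℂ • b i) i⟫_ℂ).re =
      (t ⁻¹' S).indicator (fun i => ‖⟪b i, u⟫_ℂ‖ ^ 2) i := by
    intro i
    by_cases h : t i ∈ S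
    · rw [Set.indicator_of_mem (by exact h), Set.indicator_of_mem (by exact h), inner_smul_right,
        mul_comm, ← inner_conj_symm, Complex.conj_mul_self_eq_norm_sq, Complex.ofReal_re]
    · rw [Set.indicator_of_notMem (by exact h), Set.indicator_of_notMem (by exact h)]; simp
  simp only [h2] at h1
  rw [← h1.tsum_eq, ENNReal.ofReal_tsum_of_nonneg _ h1.summable]
  · refine tsum_congr fun i => ?_
    by_cases h : t i ∈ S
    · rw [Set.indicator_of_mem (by exact h)]; simp [h, hS]
    · rw [Set.indicator_of_notMem (by exact h)]; simp [h, hS]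
  · intro i; exact Set.indicator_nonneg (fun _ _ => by positivity) _

/-- An operator with compact resolvent has a spectral measure. -/
theorem exists_isSpectralMeasureOf {Q : H →ₗ.[ℂ] H} {B : H →L[ℂ] H} {c : ℝ}
    (hc : IsCompactOperator B) (hs : (B : H →ₗ[ℂ] H).IsSymmetric)
    (hBg : ∀ f, (B f, f - (c : ℂ) • B f) ∈ Q.graph)
    (hBQ : ∀ u : Q.domain, B (Q u + (c : ℂ) • (u : H)) = u) :
    ∃ P : ProjectionValuedMeasure H, P.IsSpectralMeasureOf Q := by
  have hi : Function.Injective B := by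
    refine (injective_iff_map_eq_zero B).mpr fun f hf => ?_
    have h1 := hBg f
    rw [hf, smul_zero, sub_zero] at h1
    exact Q.graph_fst_eq_zero_snd h1 rfl
  obtain ⟨ι, b, β, hβ⟩ := exists_hilbertBasis_eigenvectors hc hs hi
  have hcoef : ∀ f i, ⟪b i, B f⟫_ℂ = β i * ⟪b i, f⟫_ℂ := by
    intro f i
    have : ⟪b i, B f⟫_ℂ = ⟪B (b i), f⟫_ℂ := (hs (b i) f).symm
    rw [this, (hβ i).1, inner_smul_left, Complex.conj_ofReal]
  -- `B` inverts `Q + c`, so an eigenvalue `β` of `B` corresponds to the eigenvalue `1/β - c` of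
  -- `Q`.
  set t : ι → ℝ := fun i => (β i)⁻¹ - c with ht
  have htβ : ∀ i, t i * β i = 1 - c * β i := by
    intro i; rw [ht]; have := (hβ i).2; field_simp
  have hdom : ∀ u, u ∈ Q.domain ↔ ∃ f, u = B f := by
    intro u
    constructor
    · intro hu; exact ⟨_, (hBQ ⟨u, hu⟩).symm⟩
    · rintro ⟨f, rfl⟩; exact LinearPMap.mem_domain_of_mem_graph (hBg f)
  have hsum : ∀ u, u ∈ Q.domain ↔ Summable fun i => ‖⟪b i, u⟫_ℂ‖ ^ 2 * t i ^ 2 := by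
    intro u
    rw [hdom]
    constructor
    · rintro ⟨f, rfl⟩
      have h1 := b.summable_norm_sq_inner (f - (c : ℂ) • B f)
      refine h1.congr fun i => ?_
      have : ⟪b i, f - (c : ℂ) • B f⟫_ℂ = ((t i : ℝ) : ℂ) * ⟪b i, B f⟫_ℂ := by
        have h10 : (t i : ℂ) * β i = 1 - c * β i := by exact_mod_cast htβ i
        rw [inner_sub_right, inner_smul_right, hcoef]
        linear_combination (-⟪b i, f⟫_ℂ) * h10
      rw [this, norm_mul, Complex.norm_real, mul_pow, Real.norm_eq_abs, sq_abs, mul_comm]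
    · intro hu
      -- A preimage of `u` under `B` must have coefficients `⟨b i, u⟩ / β i`. They are square
      -- summable because `(β i)⁻² = (t i + c)² ≤ 2 (t i)² + 2 c²`.
      have h2 : Summable fun i => ‖((β i)⁻¹ : ℂ) * ⟪b i, u⟫_ℂ‖ ^ 2 := by
        refine Summable.of_nonneg_of_le (fun i => by positivity) (fun i => ?_)
          ((hu.mul_left 2).add ((b.summable_norm_sq_inner u).mul_left (2 * c ^ 2)))
        rw [norm_mul, ← Complex.ofReal_inv, Complex.norm_real, mul_pow, Real.norm_eq_abs, sq_abs]
        have : (β i)⁻¹ = t i + c := by simp [ht]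
        rw [this]
        nlinarith [sq_nonneg ‖⟪b i, u⟫_ℂ‖, mul_nonneg (sq_nonneg ‖⟪b i, u⟫_ℂ‖) (sq_nonneg (t i - c))]
      let a : lp (fun _ : ι => ℂ) 2 := ⟨fun i => ((β i)⁻¹ : ℂ) * ⟪b i, u⟫_ℂ,
        (memℓp_gen_iff (by norm_num)).mpr (by simpa using h2)⟩
      refine ⟨b.repr.symm a, ?_⟩
      have ha : ∀ i, ⟪b i, b.repr.symm a⟫_ℂ = ((β i)⁻¹ : ℂ) * ⟪b i, u⟫_ℂ := by
        intro i
        rw [← b.repr_apply_apply]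
        exact congrArg (fun x : lp (fun _ : ι => ℂ) 2 => x i) (b.repr.apply_symm_apply a)
      refine (b.hasSum_repr u).unique ?_
      convert! b.hasSum_repr (B (b.repr.symm a)) using 2 with i
      rw [b.repr_apply_apply, b.repr_apply_apply, hcoef, ha,
        mul_inv_cancel_left₀ (by exact_mod_cast (hβ i).2)]
  refine ⟨b.diagonalPVM t, fun u => ?_, fun u => ?_⟩
  · rw [b.scalarMeasure_diagonalPVM, lintegral_sum_measure, hsum]
    have h3 : ∀ i, ∫⁻ s, ENNReal.ofReal (s ^ 2)
        ∂(ENNReal.ofReal (‖⟪b i, u⟫_ℂ‖ ^ 2) • Measure.dirac (t i)) =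
        ENNReal.ofReal (‖⟪b i, u⟫_ℂ‖ ^ 2 * t i ^ 2) := by
      intro i
      rw [lintegral_smul_measure, lintegral_dirac' _ (by fun_prop), smul_eq_mul,
        ← ENNReal.ofReal_mul (by positivity)]
    simp only [h3]
    constructor
    · intro h
      rw [← ENNReal.ofReal_tsum_of_nonneg (fun i => by positivity) h]
      exact ENNReal.ofReal_lt_top
    · intro h
      have := ENNReal.summable_toReal h.ne
      refine this.congr fun i => ENNReal.toReal_ofReal (by positivity)
  · have hu := (hsum u).mp u.2
    rw [b.scalarMeasure_diagonalPVM]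
    have hint : Integrable (fun s : ℝ => s)
        (Measure.sum fun i => ENNReal.ofReal (‖⟪b i, (u : H)⟫_ℂ‖ ^ 2) • Measure.dirac (t i)) := by
      refine ⟨by fun_prop, ?_⟩
      rw [HasFiniteIntegral, lintegral_sum_measure]
      have h3 : ∀ i, ∫⁻ s : ℝ, ‖s‖ₑ
          ∂(ENNReal.ofReal (‖⟪b i, (u : H)⟫_ℂ‖ ^ 2) • Measure.dirac (t i)) =
          ENNReal.ofReal (‖⟪b i, (u : H)⟫_ℂ‖ ^ 2 * |t i|) := by
        intro i
        rw [lintegral_smul_measure, lintegral_dirac' _ (by fun_prop), smul_eq_mul,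
          ENNReal.ofReal_mul (by positivity), ← Real.norm_eq_abs, ofReal_norm]
      simp only [h3]
      have hs' : Summable fun i => ‖⟪b i, (u : H)⟫_ℂ‖ ^ 2 * |t i| := by
        refine Summable.of_nonneg_of_le (fun i => by positivity) (fun i => ?_)
          (hu.add (b.summable_norm_sq_inner u))
        rw [← sq_abs (t i)]
        nlinarith [sq_nonneg ‖⟪b i, (u : H)⟫_ℂ‖,
          mul_nonneg (sq_nonneg ‖⟪b i, (u : H)⟫_ℂ‖) (sq_nonneg (|t i| - 1)),
          mul_nonneg (sq_nonneg ‖⟪b i, (u : H)⟫_ℂ‖) (abs_nonneg (t i))]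
      rw [← ENNReal.ofReal_tsum_of_nonneg (fun i => by positivity) hs']
      exact ENNReal.ofReal_lt_top
    have h4 := hasSum_integral_measure hint
    have h5 : ∀ i, ∫ s : ℝ, s ∂(ENNReal.ofReal (‖⟪b i, (u : H)⟫_ℂ‖ ^ 2) • Measure.dirac (t i)) =
        ‖⟪b i, (u : H)⟫_ℂ‖ ^ 2 * t i := by
      intro i
      rw [integral_smul_measure, integral_dirac, ENNReal.toReal_ofReal (by positivity), smul_eq_mul]
    simp only [h5] at h4
    have h6 := b.hasSum_inner_mul_inner (u : H) (Q u)
    refine h6.unique ?_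
    have h7 := Complex.ofRealCLM.hasSum h4
    convert! h7 using 2 with i
    have h8 : (β i : ℂ) * ⟪b i, Q u⟫_ℂ = β i * (t i * ⟪b i, (u : H)⟫_ℂ) := by
      have h9 := hcoef (Q u + (c : ℂ) • (u : H)) i
      rw [hBQ, inner_add_right, inner_smul_right] at h9
      have h10 : (t i : ℂ) * β i = 1 - c * β i := by exact_mod_cast htβ i
      linear_combination -h9 + (-⟪b i, (u : H)⟫_ℂ) * h10
    have h11 := mul_left_cancel₀ (by exact_mod_cast (hβ i).2) h8
    rw [h11, ← inner_conj_symm (u : H)]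
    have := Complex.conj_mul_self_eq_norm_sq ⟪b i, (u : H)⟫_ℂ
    simp only [Complex.ofRealCLM_apply, Complex.ofReal_mul]
    rw [← this]; ring

end DiagonalSpectralMeasure
end

noncomputable section

/-! ### Form bounds on spectral subspaces. -/

section SpectralSubspace

open scoped InnerProductSpace

variable {H : Type*} [NormedAddCommGroup H] [InnerProductSpace ℂ H] [CompleteSpace H]

namespace ProjectionValuedMeasure

theorem proj_proj (P : ProjectionValuedMeasure H) {S : Set ℝ} (hS : MeasurableSet S) (u : H) :
    P.proj S (P.proj S u) = P.proj S u := by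
  have := congrArg (fun T : H →L[ℂ] H => T u) (P.isStarProjection S hS).isIdempotentElem.eq
  simpa using this

theorem scalarMeasure_apply (P : ProjectionValuedMeasure H) (u : H) {S : Set ℝ}
    (hS : MeasurableSet S) : P.scalarMeasure u S = ENNReal.ofReal (‖P.proj S u‖ ^ 2) := by
  rw [scalarMeasure, Measure.ofMeasurable_apply S hS]
  have h2 : ContinuousLinearMap.adjoint (P.proj S) = P.proj S := (P.isStarProjection S hS).isSelfAdjoint
  rw [← P.proj_proj hS, ← ContinuousLinearMap.adjoint_inner_left, h2, P.proj_proj hS,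
    inner_self_eq_norm_sq_to_K]
  norm_cast

theorem scalarMeasure_univ (P : ProjectionValuedMeasure H) (u : H) :
    P.scalarMeasure u Set.univ = ENNReal.ofReal (‖u‖ ^ 2) := by
  rw [P.scalarMeasure_apply u MeasurableSet.univ, P.proj_univ]; rfl

instance (P : ProjectionValuedMeasure H) (u : H) : IsFiniteMeasure (P.scalarMeasure u) :=
  ⟨by rw [P.scalarMeasure_univ]; exact ENNReal.ofReal_lt_top⟩

/-- The complement of `S` has mass `‖u‖² - ‖P(S) u‖² = 0`. -/
theorem ae_mem_of_proj_eq (P : ProjectionValuedMeasure H) {u : H} {S : Set ℝ}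
    (hS : MeasurableSet S) (hu : P.proj S u = u) : ∀ᵐ t ∂P.scalarMeasure u, t ∈ S := by
  rw [ae_iff]
  change P.scalarMeasure u Sᶜ = 0
  rw [measure_compl hS (measure_ne_top _ _), P.scalarMeasure_univ, P.scalarMeasure_apply u hS, hu,
    tsub_self]

/-- A finite measure on a bounded interval has a finite second moment, which gives membership in the
domain; its first moment is then at most `b` times its mass. -/
theorem mem_domain_of_ae_mem_Icc {P : ProjectionValuedMeasure H} {Q : H →ₗ.[ℂ] H}
    (hP : P.IsSpectralMeasureOf Q) {u : H} {a b : ℝ}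
    (h : ∀ᵐ t ∂P.scalarMeasure u, t ∈ Set.Icc a b) :
    ∃ hu : u ∈ Q.domain, (⟪u, Q ⟨u, hu⟩⟫_ℂ).re ≤ b * ‖u‖ ^ 2 := by
  have h1 : u ∈ Q.domain := by
    rw [hP.1]
    refine (lintegral_mono_ae (g := fun _ => ENNReal.ofReal (a ^ 2 + b ^ 2)) ?_).trans_lt ?_
    · filter_upwards [h] with t ht
      refine ENNReal.ofReal_le_ofReal ?_
      rcases le_total 0 t with h0 | h0
      · nlinarith [ht.1, ht.2, sq_nonneg a]
      · nlinarith [ht.1, ht.2, sq_nonneg b]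
    · rw [lintegral_const]
      exact ENNReal.mul_lt_top ENNReal.ofReal_lt_top (measure_lt_top _ _)
  refine ⟨h1, ?_⟩
  rw [hP.2 ⟨u, h1⟩, Complex.ofReal_re]
  have hint : Integrable (fun t : ℝ => t) (P.scalarMeasure u) := by
    refine Integrable.of_bound (by fun_prop) (|a| + |b|) ?_
    filter_upwards [h] with t ht
    rw [Real.norm_eq_abs, abs_le]
    constructor
    · linarith [ht.1, neg_abs_le a, abs_nonneg b]
    · linarith [ht.2, le_abs_self b, abs_nonneg a]
  calc ∫ t, t ∂P.scalarMeasure u ≤ ∫ _, b ∂P.scalarMeasure u :=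
        integral_mono_ae hint (integrable_const _) (h.mono fun t ht => ht.2)
    _ = b * ‖u‖ ^ 2 := by
        rw [integral_const, Measure.real, P.scalarMeasure_univ, ENNReal.toReal_ofReal (by positivity),
          smul_eq_mul, mul_comm]

/-- There is no spectrum below the lower bound of the form. The half-line is cut into bounded
windows, on whose spectral subspaces the form is defined. There it is at most `-κ - 1` on unit
vectors, against the lower bound `-κ`; the shift by one supplies the strict gap. -/
theorem proj_Iic_eq_zero {P : ProjectionValuedMeasure H} {Q : H →ₗ.[ℂ] H}
    (hP : P.IsSpectralMeasureOf Q) {κ : ℝ}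
    (hκ : ∀ u : Q.domain, -κ * ‖(u : H)‖ ^ 2 ≤ (⟪(u : H), Q u⟫_ℂ).re) (v : H) :
    P.proj (Set.Iic (-κ - 1)) v = 0 := by
  set a := -κ - 1 with ha
  let S : ℕ → Set ℝ := fun n => Set.Ioc (a - n - 1) (a - n)
  have hSm : ∀ n, MeasurableSet (S n) := fun n => measurableSet_Ioc
  have hSU : (⋃ n, S n) = Set.Iic a := by
    ext t
    simp only [S, Set.mem_iUnion, Set.mem_Ioc, Set.mem_Iic]
    constructor
    · rintro ⟨n, _, h2⟩
      have : (0 : ℝ) ≤ n := n.cast_nonneg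
      linarith
    · intro h
      refine ⟨⌊a - t⌋₊, ?_, ?_⟩
      · linarith [Nat.lt_floor_add_one (a - t)]
      · linarith [Nat.floor_le (sub_nonneg.mpr h)]
  have hSd : Pairwise (Function.onFun Disjoint S) := by
    intro m n hmn
    refine Set.disjoint_left.mpr fun t ht ht' => hmn ?_
    simp only [S, Set.mem_Ioc] at ht ht'
    have h1 : (m : ℝ) < n + 1 := by linarith
    have h2 : (n : ℝ) < m + 1 := by linarith
    have h3 : m < n + 1 := by exact_mod_cast h1
    have h4 : n < m + 1 := by exact_mod_cast h2
    omega
  have h0 : ∀ n, P.proj (S n) v = 0 := by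
    intro n
    set u := P.proj (S n) v with hu
    have hae := P.ae_mem_of_proj_eq (hSm n) (u := u) (by rw [hu, P.proj_proj (hSm n)])
    obtain ⟨hud, hle⟩ := mem_domain_of_ae_mem_Icc hP (u := u) (a := a - n - 1) (b := a)
      (hae.mono fun t ht => ⟨ht.1.le, ht.2.trans (by simp)⟩)
    have h1 := hκ ⟨u, hud⟩
    simp only at h1
    have h2 : ‖u‖ ^ 2 ≤ 0 := by rw [ha] at hle; nlinarith
    have h3 : ‖u‖ = 0 := by nlinarith [norm_nonneg u]
    exact norm_eq_zero.mp h3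
  have h1 := P.hasSum_iUnion S hSm hSd v
  simp only [h0, hSU] at h1
  exact h1.unique hasSum_zero

/-- On the spectral subspace `1_{Q ≤ c}` of a semibounded operator, the form of `Q` is at most
`c`. -/
theorem mem_domain_of_mem_lowSubspace {P : ProjectionValuedMeasure H} {Q : H →ₗ.[ℂ] H}
    (hP : P.IsSpectralMeasureOf Q) {κ : ℝ}
    (hκ : ∀ u : Q.domain, -κ * ‖(u : H)‖ ^ 2 ≤ (⟪(u : H), Q u⟫_ℂ).re) {c : ℝ} {u : H}
    (hu : u ∈ P.lowSubspace c) :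
    ∃ hu : u ∈ Q.domain, (⟪u, Q ⟨u, hu⟩⟫_ℂ).re ≤ c * ‖u‖ ^ 2 := by
  obtain ⟨v, rfl⟩ := hu
  refine mem_domain_of_ae_mem_Icc hP (a := -κ - 1) ?_
  have h1 := P.ae_mem_of_proj_eq measurableSet_Iic (u := P.proj (Set.Iic c) v)
    (P.proj_proj measurableSet_Iic v)
  have h2 : ∀ᵐ t ∂P.scalarMeasure (P.proj (Set.Iic c) v), t ∉ Set.Iic (-κ - 1) := by
    rw [ae_iff]
    simp only [not_not, Set.ofPred_mem_eq]
    rw [P.scalarMeasure_apply _ measurableSet_Iic, proj_Iic_eq_zero hP hκ]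
    simp
  filter_upwards [h1, h2] with t ht1 ht2
  exact ⟨(not_le.mp ht2).le, ht1⟩

end ProjectionValuedMeasure

end SpectralSubspace
end

noncomputable section

/-! ### Continuous Parseval frames: counting, compactness, Schur test. -/

section ParsevalFrame

open scoped InnerProductSpace

/-- Estimates by the inequality `2ab ≤ a² + b²` give sums `‖x‖² + ‖y‖²`; restricting to unit vectors
and rescaling turns them into products. -/
theorem norm_sesquilinear_le {H : Type*} [NormedAddCommGroup H] [InnerProductSpace ℂ H]
    {Φ : H → H → ℂ} {C : ℝ} (hl : ∀ (r : ℝ) x y, ‖Φ ((r : ℂ) • x) y‖ = |r| * ‖Φ x y‖)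
    (hr : ∀ (r : ℝ) x y, ‖Φ x ((r : ℂ) • y)‖ = |r| * ‖Φ x y‖)
    (h : ∀ x y, ‖x‖ = 1 → ‖y‖ = 1 → ‖Φ x y‖ ≤ C) (x y : H) : ‖Φ x y‖ ≤ C * (‖x‖ * ‖y‖) := by
  rcases eq_or_ne x 0 with rfl | hx
  · have := hl 0 0 y
    simp only [Complex.ofReal_zero, zero_smul, abs_zero, zero_mul] at this
    simp [this]
  rcases eq_or_ne y 0 with rfl | hy
  · have := hr 0 x 0
    simp only [Complex.ofReal_zero, zero_smul, abs_zero, zero_mul] at this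
    simp [this]
  have hx' : 0 < ‖x‖ := norm_pos_iff.mpr hx
  have hy' : 0 < ‖y‖ := norm_pos_iff.mpr hy
  have h1 := h (((‖x‖⁻¹ : ℝ) : ℂ) • x) (((‖y‖⁻¹ : ℝ) : ℂ) • y)
    (by rw [norm_smul, Complex.norm_real, norm_inv, norm_norm, inv_mul_cancel₀ hx'.ne'])
    (by rw [norm_smul, Complex.norm_real, norm_inv, norm_norm, inv_mul_cancel₀ hy'.ne'])
  rw [hl, hr, abs_of_pos (inv_pos.mpr hx'), abs_of_pos (inv_pos.mpr hy')] at h1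
  calc ‖Φ x y‖ = ‖x‖ * ‖y‖ * (‖x‖⁻¹ * (‖y‖⁻¹ * ‖Φ x y‖)) := by field_simp
    _ ≤ ‖x‖ * ‖y‖ * C := by gcongr
    _ = _ := by ring

variable {H : Type*} [NormedAddCommGroup H] [InnerProductSpace ℂ H]
  {Z : Type*} [NormedAddCommGroup Z] [MeasureSpace Z]

/-- A continuous Parseval frame of vectors of norm at most one. -/
structure IsParsevalFrame (ψ : Z → H) : Prop where
  continuous : Continuous ψ
  norm_le_one : ∀ z, ‖ψ z‖ ≤ 1
  integrable : ∀ u, Integrable (fun z => ‖⟪ψ z, u⟫_ℂ‖ ^ 2)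
  integral : ∀ u, ∫ z, ‖⟪ψ z, u⟫_ℂ‖ ^ 2 = ‖u‖ ^ 2

namespace IsParsevalFrame

variable {ψ : Z → H} (hψ : IsParsevalFrame ψ)
include hψ

theorem continuous_inner (u : H) : Continuous fun z => ⟪ψ z, u⟫_ℂ :=
  hψ.continuous.inner continuous_const

/-- Polarization of Parseval's identity. -/
theorem inner_eq_integral (v u : H) : Integrable (fun z => ⟪v, ψ z⟫_ℂ * ⟪ψ z, u⟫_ℂ) ∧
    ∫ z, ⟪v, ψ z⟫_ℂ * ⟪ψ z, u⟫_ℂ = ⟪v, u⟫_ℂ := by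
  have h0 : ∀ z, ⟪v, ψ z⟫_ℂ * ⟪ψ z, u⟫_ℂ = ((‖⟪ψ z, v + u⟫_ℂ‖ ^ 2 : ℝ) - (‖⟪ψ z, v - u⟫_ℂ‖ ^ 2 : ℝ) +
      ((‖⟪ψ z, v - Complex.I • u⟫_ℂ‖ ^ 2 : ℝ) - (‖⟪ψ z, v + Complex.I • u⟫_ℂ‖ ^ 2 : ℝ)) *
        Complex.I : ℂ) / 4 := by
    intro z
    have := inner_eq_sum_norm_sq_div_four (𝕜 := ℂ) ⟪ψ z, v⟫_ℂ ⟪ψ z, u⟫_ℂ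
    rw [RCLike.inner_apply, inner_conj_symm] at this
    simp only [inner_add_right, inner_sub_right, inner_smul_right]
    rw [mul_comm, this]
    simp
  have hi : ∀ x, Integrable fun z => ((‖⟪ψ z, x⟫_ℂ‖ ^ 2 : ℝ) : ℂ) := fun x => (hψ.integrable x).ofReal
  have hI : ∀ x, ∫ z, ((‖⟪ψ z, x⟫_ℂ‖ ^ 2 : ℝ) : ℂ) = ((‖x‖ ^ 2 : ℝ) : ℂ) := fun x => by
    rw [← hψ.integral]; exact integral_ofReal
  have hd : ∀ x y, Integrable fun z => ((‖⟪ψ z, x⟫_ℂ‖ ^ 2 : ℝ) : ℂ) - ((‖⟪ψ z, y⟫_ℂ‖ ^ 2 : ℝ) : ℂ) :=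
    fun x y => (hi x).sub (hi y)
  have hD : ∀ x y, ∫ z, (((‖⟪ψ z, x⟫_ℂ‖ ^ 2 : ℝ) : ℂ) - ((‖⟪ψ z, y⟫_ℂ‖ ^ 2 : ℝ) : ℂ)) =
      ((‖x‖ ^ 2 : ℝ) : ℂ) - ((‖y‖ ^ 2 : ℝ) : ℂ) := fun x y => by
    rw [integral_sub (hi x) (hi y), hI, hI]
  simp only [h0]
  have h1 := (hd (v - Complex.I • u) (v + Complex.I • u)).mul_const Complex.I
  refine ⟨((hd (v + u) (v - u)).add h1).div_const 4, ?_⟩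
  rw [integral_div, integral_add (hd _ _) h1, integral_mul_const, hD, hD,
    inner_eq_sum_norm_sq_div_four (𝕜 := ℂ) v u]
  simp

theorem lintegral_eq (u : H) : ∫⁻ z, ENNReal.ofReal (‖⟪ψ z, u⟫_ℂ‖ ^ 2) = ENNReal.ofReal (‖u‖ ^ 2) := by
  rw [← hψ.integral u, ofReal_integral_eq_lintegral_ofReal (hψ.integrable u)
    (Eventually.of_forall fun z => by positivity)]

/-- Volume bound for the number of orthonormal vectors that live where `q` is small. -/
theorem card_le_volume [BorelSpace Z] {q : Z → ℝ} (hq : Continuous q) {k : ℝ} (hk : 0 < k)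
    {ι : Type*} [Fintype ι] {e : ι → H} (he : Orthonormal ℂ e)
    (hqe : ∀ i, ∫⁻ z, ENNReal.ofReal (q z * ‖⟪ψ z, e i⟫_ℂ‖ ^ 2) ≤ ENNReal.ofReal k) :
    (Fintype.card ι : ℝ≥0∞) ≤ 2 * volume {z | q z ≤ 2 * k} := by
  set Ω := {z | q z ≤ 2 * k} with hΩ
  have hΩm : MeasurableSet Ω := (isClosed_le hq continuous_const).measurableSet
  have hm : ∀ u, Measurable fun z => ENNReal.ofReal (‖⟪ψ z, u⟫_ℂ‖ ^ 2) := fun u =>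
    ((hψ.continuous_inner u).norm.pow 2).measurable.ennreal_ofReal
  have h1 : ∀ i, (2 : ℝ≥0∞)⁻¹ ≤ ∫⁻ z in Ω, ENNReal.ofReal (‖⟪ψ z, e i⟫_ℂ‖ ^ 2) := by
    intro i
    -- Chebyshev: outside `Ω` the symbol exceeds `2k`, while its total integral against the mass
    -- density is at most `k`.
    have htail : ∫⁻ z in Ωᶜ, ENNReal.ofReal (‖⟪ψ z, e i⟫_ℂ‖ ^ 2) ≤ 2⁻¹ := by
      calc ∫⁻ z in Ωᶜ, ENNReal.ofReal (‖⟪ψ z, e i⟫_ℂ‖ ^ 2)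
          ≤ ∫⁻ z in Ωᶜ, ENNReal.ofReal ((2 * k)⁻¹) * ENNReal.ofReal (q z * ‖⟪ψ z, e i⟫_ℂ‖ ^ 2) := by
            refine setLIntegral_mono' hΩm.compl fun z hz => ?_
            rw [← ENNReal.ofReal_mul (by positivity)]
            refine ENNReal.ofReal_le_ofReal ?_
            have h1 : 2 * k < q z := not_le.mp hz
            rw [← mul_assoc]
            refine le_mul_of_one_le_left (by positivity) ?_
            rw [inv_mul_eq_div, one_le_div (by positivity)]; exact h1.le
        _ ≤ ENNReal.ofReal ((2 * k)⁻¹) * ∫⁻ z, ENNReal.ofReal (q z * ‖⟪ψ z, e i⟫_ℂ‖ ^ 2) := by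
            rw [lintegral_const_mul' _ _ ENNReal.ofReal_ne_top]
            gcongr
            exact Measure.restrict_le_self
        _ ≤ ENNReal.ofReal ((2 * k)⁻¹) * ENNReal.ofReal k := by gcongr; exact hqe i
        _ = 2⁻¹ := by
            rw [← ENNReal.ofReal_mul (by positivity)]
            have : (2 * k)⁻¹ * k = 2⁻¹ := by field_simp
            rw [this, ENNReal.ofReal_inv_of_pos two_pos]; norm_num
    have htot := hψ.lintegral_eq (e i)
    rw [he.1 i, one_pow, ENNReal.ofReal_one, ← lintegral_add_compl _ hΩm] at htot
    have h2 : (1 : ℝ≥0∞) ≤ (∫⁻ z in Ω, ENNReal.ofReal (‖⟪ψ z, e i⟫_ℂ‖ ^ 2)) + 2⁻¹ := by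
      rw [← htot]; gcongr
    rw [← ENNReal.one_sub_inv_two]
    exact tsub_le_iff_right.mpr h2
  have h2 : (Fintype.card ι : ℝ≥0∞) * 2⁻¹ ≤ volume Ω := by
    calc (Fintype.card ι : ℝ≥0∞) * 2⁻¹ = ∑ _i : ι, (2 : ℝ≥0∞)⁻¹ := by simp
      _ ≤ ∑ i, ∫⁻ z in Ω, ENNReal.ofReal (‖⟪ψ z, e i⟫_ℂ‖ ^ 2) := Finset.sum_le_sum fun i _ => h1 i
      _ = ∫⁻ z in Ω, ∑ i, ENNReal.ofReal (‖⟪ψ z, e i⟫_ℂ‖ ^ 2) :=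
          (lintegral_finsetSum _ fun i _ => hm _).symm
      -- Bessel's inequality for the vector `ψ z` in the orthonormal family `e`.
      _ ≤ ∫⁻ _ in Ω, 1 := by
          refine lintegral_mono fun z => ?_
          rw [← ENNReal.ofReal_sum_of_nonneg fun i _ => by positivity]
          refine ENNReal.ofReal_le_one.mpr ?_
          have h3 := he.sum_inner_products_le (x := ψ z) (s := Finset.univ)
          simp only [norm_inner_symm (e _)] at h3
          exact h3.trans (pow_le_one₀ (norm_nonneg _) (hψ.norm_le_one z))
      _ = volume Ω := by simp
  calc (Fintype.card ι : ℝ≥0∞) = 2 * (Fintype.card ι * 2⁻¹) := by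
        rw [mul_comm, mul_assoc, ENNReal.inv_mul_cancel two_ne_zero ENNReal.ofNat_ne_top, mul_one]
    _ ≤ 2 * volume Ω := by gcongr

/-- An operator whose domain is compressed by the frame into a small part of `Z` is close to a
compact operator. -/
theorem isCompactOperator_of_lintegral_le [CompleteSpace H]
    [BorelSpace Z] [IsFiniteMeasureOnCompacts (volume : Measure Z)] {q : Z → ℝ} (hqt : Tendsto q (cocompact Z) atTop) (B : H →L[ℂ] H) {M : ℝ} (hM : 0 ≤ M)
    (hB : ∀ f, ∫⁻ z, ENNReal.ofReal (q z * ‖⟪ψ z, B f⟫_ℂ‖ ^ 2) ≤ ENNReal.ofReal (M * ‖f‖ ^ 2)) :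
    IsCompactOperator B := by
  have hclosed : IsClosed {T : H →L[ℂ] H | IsCompactOperator T} := isClosed_setOfPred_isCompactOperator
  refine hclosed.closure_subset ?_
  rw [Metric.mem_closure_iff]
  intro ε hε
  -- Cutting at the level `L²` of `q` leaves a tail of mass at most `M ‖f‖² / L²`, and hence an
  -- operator error of order `(1 + M)/L`.
  obtain ⟨L, hL0, hL1, hLε⟩ : ∃ L : ℝ, 0 < L ∧ 1 ≤ L ∧ (1 + M) / L < ε := by
    refine ⟨(1 + M) / ε + 1, by positivity, by linarith [show 0 ≤ (1 + M) / ε by positivity], ?_⟩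
    rw [div_lt_iff₀ (by positivity)]
    have : ε * ((1 + M) / ε + 1) = 1 + M + ε := by field_simp
    linarith
  have hev : ∀ᶠ z in cocompact Z, L ^ 2 ≤ q z := hqt.eventually_ge_atTop _
  obtain ⟨D, hD, hDq⟩ := mem_cocompact.mp hev
  let T : Z → H →L[ℂ] H := fun z => (innerSL ℂ (ψ z)).smulRight (ψ z)
  have hTc : Continuous T := by
    refine isBoundedBilinearMap_smulRight.continuous.comp
      (((innerSL ℂ).continuous.comp hψ.continuous).prodMk hψ.continuous)
  let S := compactOperator (RingHom.id ℂ) H H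
  have hTS : ∀ z, T z ∈ S := fun z => by
    have h1 : IsCompactOperator (innerSL ℂ (ψ z)) := 
      isCompactOperator_of_locallyCompactSpace_dom (innerSL ℂ (ψ z))
    exact h1.clm_comp (ContinuousLinearMap.toSpanSingleton ℂ (ψ z))
  let g : Z → S := fun z => ⟨T z, hTS z⟩
  have hg : IntegrableOn g D := (hTc.subtype_mk hTS).continuousOn.integrableOn_compact hD
  have hT : IntegrableOn T D := hTc.continuousOn.integrableOn_compact hD
  have : CompleteSpace S := hclosed.completeSpace_coe
  -- Localisation to the compact set `D`: an integral of rank one operators taken in the closed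
  -- subspace of compact operators, hence compact.
  let PD : H →L[ℂ] H := ∫ z in D, T z
  have hPS : PD ∈ S := by
    have : PD = S.subtypeL (∫ z in D, g z) := by
      rw [← ContinuousLinearMap.integral_comp_comm _ hg]; rfl
    rw [this]; exact (∫ z in D, g z).2
  refine ⟨PD.comp B, IsCompactOperator.comp_clm hPS B, ?_⟩
  rw [dist_eq_norm]
  refine lt_of_le_of_lt ?_ hLε
  have hinner : ∀ v u, ⟪v, PD u⟫_ℂ = ∫ z in D, ⟪v, ψ z⟫_ℂ * ⟪ψ z, u⟫_ℂ := by
    intro v u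
    have h1 : PD u = ∫ z in D, T z u := ContinuousLinearMap.integral_apply hT u
    have h2 : IntegrableOn (fun z => T z u) D := (ContinuousLinearMap.apply ℂ H u).integrable_comp hT
    rw [h1]
    have h3 := ContinuousLinearMap.integral_comp_comm (innerSL ℂ v) h2
    simp only [innerSL_apply_apply] at h3
    rw [← h3]
    refine integral_congr_ae (Eventually.of_forall fun z => ?_)
    simp [T, inner_smul_right, mul_comm]
  have hdiff : ∀ v u, ⟪v, u - PD u⟫_ℂ = ∫ z in Dᶜ, ⟪v, ψ z⟫_ℂ * ⟪ψ z, u⟫_ℂ := by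
    intro v u
    obtain ⟨h1, h2⟩ := hψ.inner_eq_integral v u
    rw [inner_sub_right, hinner, ← h2, ← integral_add_compl hD.measurableSet h1]
    ring
  have htail : ∀ f, ∫ z in Dᶜ, ‖⟪ψ z, B f⟫_ℂ‖ ^ 2 ≤ M * ‖f‖ ^ 2 / L ^ 2 := by
    intro f
    rw [integral_eq_lintegral_of_nonneg_ae (Eventually.of_forall fun z => by positivity)
      (hψ.integrable (B f)).aestronglyMeasurable.restrict]
    refine ENNReal.toReal_le_of_le_ofReal (by positivity) ?_
    calc ∫⁻ z in Dᶜ, ENNReal.ofReal (‖⟪ψ z, B f⟫_ℂ‖ ^ 2)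
        ≤ ∫⁻ z in Dᶜ, ENNReal.ofReal ((L ^ 2)⁻¹) * ENNReal.ofReal (q z * ‖⟪ψ z, B f⟫_ℂ‖ ^ 2) := by
          refine setLIntegral_mono' hD.measurableSet.compl fun z hz => ?_
          rw [← ENNReal.ofReal_mul (by positivity)]
          refine ENNReal.ofReal_le_ofReal ?_
          have h1 : L ^ 2 ≤ q z := hDq hz
          rw [← mul_assoc]
          refine le_mul_of_one_le_left (by positivity) ?_
          rw [inv_mul_eq_div, one_le_div (by positivity)]; exact h1
      _ ≤ ENNReal.ofReal ((L ^ 2)⁻¹) * ∫⁻ z, ENNReal.ofReal (q z * ‖⟪ψ z, B f⟫_ℂ‖ ^ 2) := by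
          rw [lintegral_const_mul' _ _ ENNReal.ofReal_ne_top]
          gcongr
          exact Measure.restrict_le_self
      _ ≤ ENNReal.ofReal ((L ^ 2)⁻¹) * ENNReal.ofReal (M * ‖f‖ ^ 2) := by gcongr; exact hB f
      _ = ENNReal.ofReal (M * ‖f‖ ^ 2 / L ^ 2) := by
          rw [← ENNReal.ofReal_mul (by positivity)]; congr 1; ring
  have hform : ∀ v f, ‖⟪v, (B - PD.comp B) f⟫_ℂ‖ ≤ (1 + M) / L * (‖v‖ * ‖f‖) := by
    refine norm_sesquilinear_le (fun r x y => ?_) (fun r x y => ?_) fun v f hv hf => ?_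
    · rw [inner_smul_left, norm_mul, Complex.conj_ofReal, Complex.norm_real, Real.norm_eq_abs]
    · rw [map_smul, inner_smul_right, norm_mul, Complex.norm_real, Real.norm_eq_abs]
    · change ‖⟪v, B f - PD (B f)⟫_ℂ‖ ≤ _
      rw [hdiff]
      -- The weights `L⁻¹` and `L` balance the full mass of `v` against the tail of `B f`, which is
      -- of size `L⁻²`.
      have hi : IntegrableOn (fun z => 2⁻¹ * (L⁻¹ * ‖⟪ψ z, v⟫_ℂ‖ ^ 2 + L * ‖⟪ψ z, B f⟫_ℂ‖ ^ 2)) Dᶜ :=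
        ((((hψ.integrable v).const_mul _).add ((hψ.integrable (B f)).const_mul _)).const_mul
          _).integrableOn
      refine (norm_integral_le_of_norm_le hi (Eventually.of_forall fun z => ?_)).trans ?_
      · rw [norm_mul, norm_inner_symm]
        set x := ‖⟪ψ z, v⟫_ℂ‖
        set y := ‖⟪ψ z, B f⟫_ℂ‖
        have h1 : 0 ≤ L⁻¹ * (x - L * y) ^ 2 := by positivity
        have h2 : L⁻¹ * (x - L * y) ^ 2 = L⁻¹ * x ^ 2 + L * y ^ 2 - 2 * (x * y) := by
          field_simp; ring
        linarith
      · rw [integral_const_mul, integral_add ((hψ.integrable v).const_mul _).integrableOn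
          ((hψ.integrable (B f)).const_mul _).integrableOn, integral_const_mul, integral_const_mul]
        have h3 := htail f
        have h4 : ∫ z in Dᶜ, ‖⟪ψ z, v⟫_ℂ‖ ^ 2 ≤ 1 := by
          refine (setIntegral_le_integral (hψ.integrable v)
            (Eventually.of_forall fun z => by positivity)).trans_eq ?_
          rw [hψ.integral, hv, one_pow]
        rw [hf, one_pow, mul_one] at h3
        calc 2⁻¹ * (L⁻¹ * (∫ z in Dᶜ, ‖⟪ψ z, v⟫_ℂ‖ ^ 2) + L * ∫ z in Dᶜ, ‖⟪ψ z, B f⟫_ℂ‖ ^ 2)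
            ≤ 2⁻¹ * (L⁻¹ * 1 + L * (M / L ^ 2)) := by gcongr
          _ = 2⁻¹ * ((1 + M) / L) := by field_simp
          _ ≤ (1 + M) / L := by
            have : 0 ≤ (1 + M) / L := by positivity
            linarith
  refine ContinuousLinearMap.opNorm_le_bound _ (by positivity) fun f => ?_
  have h1 := hform ((B - PD.comp B) f) f
  rw [inner_self_eq_norm_sq_to_K] at h1
  simp only [Complex.coe_algebraMap, norm_pow, Complex.norm_real, norm_norm] at h1
  rcases eq_or_lt_of_le (norm_nonneg ((B - PD.comp B) f)) with h2 | h2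
  · rw [← h2]; positivity
  · nlinarith

end IsParsevalFrame

variable [NormedSpace ℝ Z] [FiniteDimensional ℝ Z] [BorelSpace Z]
  [(volume : Measure Z).IsAddHaarMeasure]

theorem integrable_mul_comp_sub {f : Z → ℝ} (hf : Integrable f) {κ : Z → ℝ} (hκ : Integrable κ) :
    Integrable (fun p : Z × Z => f p.2 * κ (p.1 - p.2)) ∧
      ∫ p : Z × Z, f p.2 * κ (p.1 - p.2) = (∫ z, f z) * ∫ z, κ z := by
  have h1 : Integrable (fun p : Z × Z => f p.2 * κ (p.1 - p.2)) :=
    hf.convolution_integrand (ContinuousLinearMap.mul ℝ ℝ) hκ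
  refine ⟨h1, ?_⟩
  rw [Measure.volume_eq_prod, integral_prod_symm _ h1]
  simp only [integral_const_mul, integral_sub_right_eq_self (fun z => κ z), integral_mul_const]

/-- The Schur test, in quadratic form. -/
theorem integrable_kernel_form {K : Z → Z → ℂ} (hK : AEStronglyMeasurable (fun p : Z × Z => K p.1 p.2))
    {κ : Z → ℝ} (hκ : Integrable κ) (hκe : ∀ z, κ (-z) = κ z) (hKκ : ∀ z w, ‖K z w‖ ≤ κ (z - w))
    {a b : Z → ℂ} (ha : AEStronglyMeasurable a) (hb : AEStronglyMeasurable b)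
    (ha2 : Integrable fun z => ‖a z‖ ^ 2) (hb2 : Integrable fun z => ‖b z‖ ^ 2) :
    Integrable (fun p : Z × Z => a p.1 * (K p.1 p.2 * b p.2)) ∧
      ‖∫ p : Z × Z, a p.1 * (K p.1 p.2 * b p.2)‖ ≤
        (∫ z, κ z) / 2 * ((∫ z, ‖a z‖ ^ 2) + ∫ z, ‖b z‖ ^ 2) := by
  obtain ⟨h1, h1'⟩ := integrable_mul_comp_sub hb2 hκ
  obtain ⟨h2, h2'⟩ := integrable_mul_comp_sub ha2 hκ
  have h3 : Integrable (fun p : Z × Z => ‖a p.1‖ ^ 2 * κ (p.1 - p.2)) := by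
    have := h2.swap
    refine this.congr (Eventually.of_forall fun p => ?_)
    simp only [Function.comp, Prod.fst_swap, Prod.snd_swap]
    rw [← hκe (p.1 - p.2), neg_sub]
  have h3' : ∫ p : Z × Z, ‖a p.1‖ ^ 2 * κ (p.1 - p.2) = (∫ z, ‖a z‖ ^ 2) * ∫ z, κ z := by
    rw [← h2', Measure.volume_eq_prod, ← integral_prod_swap]
    refine integral_congr_ae (Eventually.of_forall fun p => ?_)
    simp only [Prod.fst_swap, Prod.snd_swap]
    rw [← hκe (p.2 - p.1), neg_sub]
  have h4 : Integrable (fun p : Z × Z => 2⁻¹ * (‖a p.1‖ ^ 2 * κ (p.1 - p.2) +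
      ‖b p.2‖ ^ 2 * κ (p.1 - p.2))) := (h3.add h1).const_mul _
  have h5 : ∀ p : Z × Z, ‖a p.1 * (K p.1 p.2 * b p.2)‖ ≤ 2⁻¹ * (‖a p.1‖ ^ 2 * κ (p.1 - p.2) +
      ‖b p.2‖ ^ 2 * κ (p.1 - p.2)) := by
    intro p
    rw [norm_mul, norm_mul]
    have h6 := hKκ p.1 p.2
    have h7 := norm_nonneg (K p.1 p.2)
    calc ‖a p.1‖ * (‖K p.1 p.2‖ * ‖b p.2‖) = ‖K p.1 p.2‖ * (‖a p.1‖ * ‖b p.2‖) := by ring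
      _ ≤ κ (p.1 - p.2) * (‖a p.1‖ * ‖b p.2‖) := by gcongr
      _ ≤ κ (p.1 - p.2) * (2⁻¹ * (‖a p.1‖ ^ 2 + ‖b p.2‖ ^ 2)) := by
          refine mul_le_mul_of_nonneg_left ?_ (h7.trans h6)
          nlinarith [sq_nonneg (‖a p.1‖ - ‖b p.2‖)]
      _ = _ := by ring
  refine ⟨h4.mono' ?_ (Eventually.of_forall h5), ?_⟩
  · exact ha.comp_fst.mul (hK.mul hb.comp_snd)
  · refine (norm_integral_le_of_norm_le h4 (Eventually.of_forall h5)).trans_eq ?_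
    rw [integral_const_mul, integral_add h3 h1, h1', h3']
    ring

end ParsevalFrame
end

noncomputable section

/-! ### Unbounded Toeplitz operators with a bounded perturbation. -/

section FrameOperator

open scoped InnerProductSpace

variable {H : Type*} [NormedAddCommGroup H] [InnerProductSpace ℂ H]

theorem abs_re_inner_clm_apply_le (R : H →L[ℂ] H) (u : H) : |(⟪u, R u⟫_ℂ).re| ≤ ‖R‖ * ‖u‖ ^ 2 := by
  refine (Complex.abs_re_le_norm _).trans ((norm_inner_le_norm _ _).trans ?_)
  calc ‖u‖ * ‖R u‖ ≤ ‖u‖ * (‖R‖ * ‖u‖) := by gcongr; exact R.le_opNorm u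
    _ = _ := by ring

variable {Z : Type*} [NormedAddCommGroup Z] [MeasureSpace Z]

/-- The operator `A` is, up to the bounded symmetric operator `R`, the Toeplitz operator with
symbol `q` of the frame `ψ`. -/
structure IsFrameOperator (ψ : Z → H) (A : H →ₗ.[ℂ] H) (q : Z → ℝ) (R : H →L[ℂ] H) : Prop where
  frame : IsParsevalFrame ψ
  dense_domain : Dense (A.domain : Set H)
  mem_domain : ∀ z, ψ z ∈ A.domain
  continuous_symbol : Continuous q
  symbol_nonneg : ∀ z, 0 ≤ q z
  isSymmetric : (R : H →ₗ[ℂ] H).IsSymmetric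
  integrable : ∀ (b : H) (u : A.domain), Integrable fun z => ⟪b, ψ z⟫_ℂ * (q z * ⟪ψ z, u⟫_ℂ)
  inner_eq : ∀ (b : H) (u : A.domain),
    ⟪b, A u⟫_ℂ = (∫ z, ⟪b, ψ z⟫_ℂ * (q z * ⟪ψ z, u⟫_ℂ)) + ⟪b, R u⟫_ℂ

namespace IsFrameOperator

variable {ψ : Z → H} {A : H →ₗ.[ℂ] H} {q : Z → ℝ} {R : H →L[ℂ] H}
  (hA : IsFrameOperator ψ A q R)
include hA

theorem isFormalAdjoint : A.IsFormalAdjoint A := by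
  intro u v
  rw [hA.inner_eq, ← inner_conj_symm, hA.inner_eq, map_add, ← integral_conj, inner_conj_symm]
  congr 1
  · refine integral_congr_ae (Eventually.of_forall fun z => ?_)
    simp only [map_mul, inner_conj_symm, Complex.conj_ofReal]
    ring
  · exact hA.isSymmetric u v

theorem integrable_form (u : A.domain) : Integrable fun z => q z * ‖⟪ψ z, (u : H)⟫_ℂ‖ ^ 2 := by
  have h1 := (hA.integrable u u).re
  refine h1.congr (Eventually.of_forall fun z => ?_)
  change (⟪(u : H), ψ z⟫_ℂ * (q z * ⟪ψ z, u⟫_ℂ)).re = _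
  rw [← inner_conj_symm, mul_left_comm, Complex.conj_mul_self_eq_norm_sq, ← Complex.ofReal_mul,
    Complex.ofReal_re]

theorem re_inner_eq (u : A.domain) : (⟪(u : H), A u⟫_ℂ).re =
    (∫ z, q z * ‖⟪ψ z, (u : H)⟫_ℂ‖ ^ 2) + (⟪(u : H), R u⟫_ℂ).re := by
  rw [hA.inner_eq, Complex.add_re]
  congr 1
  have : ∀ z, ⟪(u : H), ψ z⟫_ℂ * (q z * ⟪ψ z, u⟫_ℂ) = ((q z * ‖⟪ψ z, (u : H)⟫_ℂ‖ ^ 2 : ℝ) : ℂ) := by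
    intro z
    rw [← inner_conj_symm, mul_left_comm, Complex.conj_mul_self_eq_norm_sq, ← Complex.ofReal_mul]
  simp only [this]
  have h2 := integral_ofReal (𝕜 := ℂ) (f := fun z => q z * ‖⟪ψ z, (u : H)⟫_ℂ‖ ^ 2) (μ := volume)
  exact (congrArg Complex.re h2).trans (Complex.ofReal_re _)

theorem neg_le_re_inner (u : A.domain) : -‖R‖ * ‖(u : H)‖ ^ 2 ≤ (⟪(u : H), A u⟫_ℂ).re := by
  rw [hA.re_inner_eq]
  have h1 : 0 ≤ ∫ z, q z * ‖⟪ψ z, (u : H)⟫_ℂ‖ ^ 2 :=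
    integral_nonneg fun z => mul_nonneg (hA.symbol_nonneg z) (by positivity)
  have h2 := abs_le.mp (abs_re_inner_clm_apply_le R u)
  linarith [h2.1]

/-- Cauchy–Schwarz applied to the form of `A + c`, which is bounded below by `c - ‖R‖`. -/
theorem mul_norm_le (c : ℝ) (u : A.domain) :
    (c - ‖R‖) * ‖(u : H)‖ ≤ ‖A u + (c : ℂ) • (u : H)‖ := by
  rcases eq_or_lt_of_le (norm_nonneg (u : H)) with h | h
  · rw [← h, mul_zero]; exact norm_nonneg _
  have h1 := hA.neg_le_re_inner u
  have h2 : (⟪(u : H), A u + (c : ℂ) • (u : H)⟫_ℂ).re ≤ ‖(u : H)‖ * ‖A u + (c : ℂ) • (u : H)‖ :=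
    (Complex.re_le_norm _).trans (norm_inner_le_norm _ _)
  rw [inner_add_right, inner_smul_right, inner_self_eq_norm_sq_to_K, Complex.add_re] at h2
  simp only [Complex.coe_algebraMap, ← Complex.ofReal_pow, ← Complex.ofReal_mul,
    Complex.ofReal_re] at h2
  nlinarith

variable [CompleteSpace H]

/-- On the original domain this is the identity for the form, with `R` estimated by its norm.
Approximation in the graph norm and Fatou's lemma carry the inequality to the closure, and an
inequality is all that the counting and the compactness require. -/
theorem lintegral_closure_le (u : A.closure.domain) :
    ∫⁻ z, ENNReal.ofReal (q z * ‖⟪ψ z, (u : H)⟫_ℂ‖ ^ 2) ≤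
      ENNReal.ofReal ((⟪(u : H), A.closure u⟫_ℂ).re + ‖R‖ * ‖(u : H)‖ ^ 2) := by
  have hcl := LinearPMap.isClosable_of_isFormalAdjoint_self hA.dense_domain hA.isFormalAdjoint
  obtain ⟨x, hx, hAx⟩ := hcl.exists_seq_tendsto u
  have h1 : ∀ n, ∫⁻ z, ENNReal.ofReal (q z * ‖⟪ψ z, (x n : H)⟫_ℂ‖ ^ 2) ≤
      ENNReal.ofReal ((⟪(x n : H), A (x n)⟫_ℂ).re + ‖R‖ * ‖(x n : H)‖ ^ 2) := by
    intro n
    rw [← ofReal_integral_eq_lintegral_ofReal (hA.integrable_form _)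
      (Eventually.of_forall fun z => mul_nonneg (hA.symbol_nonneg z) (by positivity))]
    refine ENNReal.ofReal_le_ofReal ?_
    rw [hA.re_inner_eq]
    linarith [(abs_le.mp (abs_re_inner_clm_apply_le R (x n : H))).1]
  have h2 : Tendsto (fun n => ENNReal.ofReal ((⟪(x n : H), A (x n)⟫_ℂ).re + ‖R‖ * ‖(x n : H)‖ ^ 2))
      atTop (𝓝 (ENNReal.ofReal ((⟪(u : H), A.closure u⟫_ℂ).re + ‖R‖ * ‖(u : H)‖ ^ 2))) := by
    refine ENNReal.tendsto_ofReal (Tendsto.add ?_ ((hx.norm.pow 2).const_mul _))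
    exact (Complex.continuous_re.tendsto _).comp (hx.inner hAx)
  have h3 : ∀ z, liminf (fun n => ENNReal.ofReal (q z * ‖⟪ψ z, (x n : H)⟫_ℂ‖ ^ 2)) atTop =
      ENNReal.ofReal (q z * ‖⟪ψ z, (u : H)⟫_ℂ‖ ^ 2) := by
    intro z
    refine (ENNReal.tendsto_ofReal (Tendsto.const_mul _ ?_)).liminf_eq
    exact ((Filter.Tendsto.inner tendsto_const_nhds hx).norm.pow 2)
  calc ∫⁻ z, ENNReal.ofReal (q z * ‖⟪ψ z, (u : H)⟫_ℂ‖ ^ 2)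
      = ∫⁻ z, liminf (fun n => ENNReal.ofReal (q z * ‖⟪ψ z, (x n : H)⟫_ℂ‖ ^ 2)) atTop := by
        simp only [h3]
    _ ≤ liminf (fun n => ∫⁻ z, ENNReal.ofReal (q z * ‖⟪ψ z, (x n : H)⟫_ℂ‖ ^ 2)) atTop :=
        lintegral_liminf_le' fun n => (hA.integrable_form (x n)).aemeasurable.ennreal_ofReal
    _ ≤ liminf (fun n => ENNReal.ofReal
          ((⟪(x n : H), A (x n)⟫_ℂ).re + ‖R‖ * ‖(x n : H)‖ ^ 2)) atTop :=
        liminf_le_liminf (Eventually.of_forall h1)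
    _ = _ := h2.liminf_eq

theorem neg_le_re_inner_closure (u : A.closure.domain) :
    -‖R‖ * ‖(u : H)‖ ^ 2 ≤ (⟪(u : H), A.closure u⟫_ℂ).re := by
  have hcl := LinearPMap.isClosable_of_isFormalAdjoint_self hA.dense_domain hA.isFormalAdjoint
  obtain ⟨x, hx, hAx⟩ := hcl.exists_seq_tendsto u
  exact le_of_tendsto_of_tendsto' ((hx.norm.pow 2).const_mul _)
    ((Complex.continuous_re.tendsto _).comp (hx.inner hAx)) fun n => hA.neg_le_re_inner (x n)

/-- The spectral subspaces of a frame operator have dimension at most the phase space volume. -/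
theorem finrank_lowSubspace_le [BorelSpace Z] {P : ProjectionValuedMeasure H}
    (hP : P.IsSpectralMeasureOf A.closure) {c k : ℝ} (hk : 0 < k) (hck : c + ‖R‖ ≤ k)
    (hvol : volume {z | q z ≤ 2 * k} < ⊤) :
    FiniteDimensional ℂ (P.lowSubspace c) ∧
      (Module.finrank ℂ (P.lowSubspace c) : ℝ≥0∞) ≤ 2 * volume {z | q z ≤ 2 * k} := by
  have hcard : ∀ n : ℕ, ∀ e : Fin n → H, Orthonormal ℂ e → (∀ i, e i ∈ P.lowSubspace c) →
      (n : ℝ≥0∞) ≤ 2 * volume {z | q z ≤ 2 * k} := by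
    intro n e he hmem
    have := hA.frame.card_le_volume hA.continuous_symbol hk he fun i => ?_
    · simpa using this
    obtain ⟨hu, hle⟩ := ProjectionValuedMeasure.mem_domain_of_mem_lowSubspace hP
      hA.neg_le_re_inner_closure (hmem i)
    refine (hA.lintegral_closure_le ⟨e i, hu⟩).trans (ENNReal.ofReal_le_ofReal ?_)
    rw [he.1 i, one_pow, mul_one] at hle
    simp only [he.1 i, one_pow, mul_one]
    linarith
  have hfin : ∀ W : Submodule ℂ H, FiniteDimensional ℂ W → W ≤ P.lowSubspace c →
      (Module.finrank ℂ W : ℝ≥0∞) ≤ 2 * volume {z | q z ≤ 2 * k} := by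
    intro W _ hW
    let e := stdOrthonormalBasis ℂ W
    refine hcard _ (fun i => (e i : H)) (e.orthonormal.comp_linearIsometry W.subtypeₗᵢ)
      fun i => hW (e i).2
  have h2 : 2 * volume {z | q z ≤ 2 * k} ≠ ⊤ := (ENNReal.mul_lt_top (by simp) hvol).ne
  -- The rank is bounded through finite independent sets, because `finrank` takes the value zero in
  -- infinite dimension and would give nothing by itself.
  have hfd : FiniteDimensional ℂ (P.lowSubspace c) := by
    obtain ⟨N, hN⟩ := ENNReal.exists_nat_gt h2
    have hrank : Module.rank ℂ (P.lowSubspace c) ≤ N := by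
      refine rank_le fun s hs => ?_
      have hW := hfin ((Submodule.span ℂ (s : Set (P.lowSubspace c))).map
        (P.lowSubspace c).subtype) inferInstance (Submodule.map_subtype_le _ _)
      rw [← (Submodule.equivSubtypeMap (P.lowSubspace c) _).finrank_eq,
        finrank_span_finset_eq_card hs] at hW
      exact_mod_cast hW.trans hN.le
    exact Module.rank_lt_aleph0_iff.mp (hrank.trans_lt Cardinal.natCast_lt_aleph0)
  exact ⟨hfd, hfin _ hfd le_rfl⟩

variable [NormedSpace ℝ Z] [FiniteDimensional ℝ Z] [BorelSpace Z]
  [(volume : Measure Z).IsAddHaarMeasure]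

/-- If the symbol varies slowly along the frame, then `A + c` has dense range for large `c`. -/
theorem eq_zero_of_forall_inner_eq_zero {κ : Z → ℝ} (hκ : Integrable κ)
    (hκe : ∀ z, κ (-z) = κ z)
    (hK : ∀ z w, ‖((q w - q z : ℝ) : ℂ) * ⟪ψ z, ψ w⟫_ℂ‖ ≤ (√(q z) + 1) * κ (z - w))
    {s : ℝ} (hs : 2 * (∫ z, κ z) + 1 + ‖R‖ ^ 2 ≤ s) (hs1 : 1 < s) {v : H}
    (hv : ∀ u : A.domain, ⟪v, A u + ((s ^ 2 : ℝ) : ℂ) • (u : H)⟫_ℂ = 0) : v = 0 := by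
  have hs0 : 0 < s := by linarith
  have hden : ∀ z, 0 < q z + s ^ 2 := fun z => by have := hA.symbol_nonneg z; positivity
  have hκ0 : ∀ z, 0 ≤ κ z := by
    intro z
    have h1 := (norm_nonneg _).trans (hK z 0)
    rw [sub_zero] at h1
    exact nonneg_of_mul_nonneg_right h1 (by positivity)
  set f : Z → ℂ := fun z => ⟪ψ z, v⟫_ℂ with hf
  have hfc : Continuous f := hA.frame.continuous_inner v
  set K : Z → Z → ℂ := fun z w =>
    (((q z + s ^ 2)⁻¹ : ℝ) : ℂ) * (((q w - q z : ℝ) : ℂ) * ⟪ψ z, ψ w⟫_ℂ) with hKdef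
  have hKm : Continuous fun p : Z × Z => K p.1 p.2 := by
    have hq := hA.continuous_symbol
    have h1 : Continuous fun p : Z × Z => ⟪ψ p.1, ψ p.2⟫_ℂ :=
      (hA.frame.continuous.comp continuous_fst).inner (hA.frame.continuous.comp continuous_snd)
    have h2 : Continuous fun p : Z × Z => (q p.1 + s ^ 2)⁻¹ :=
      ((hq.comp continuous_fst).add continuous_const).inv₀ fun p => (hden p.1).ne'
    exact (Complex.continuous_ofReal.comp h2).mul ((Complex.continuous_ofReal.comp
      ((hq.comp continuous_snd).sub (hq.comp continuous_fst))).mul h1)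
  have hKb : ∀ z w, ‖K z w‖ ≤ 2 / s * κ (z - w) := by
    intro z w
    have h0 := hA.symbol_nonneg z
    rw [hKdef, norm_mul, Complex.norm_real, Real.norm_of_nonneg (inv_nonneg.mpr (hden z).le)]
    calc (q z + s ^ 2)⁻¹ * ‖((q w - q z : ℝ) : ℂ) * ⟪ψ z, ψ w⟫_ℂ‖
        ≤ (q z + s ^ 2)⁻¹ * ((√(q z) + 1) * κ (z - w)) := by
          have := (hden z).le
          gcongr
          exact hK z w
      _ = ((√(q z) + 1) / (q z + s ^ 2)) * κ (z - w) := by ring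
      -- `√q s ≤ (q + s²)/2`, and `s ≤ s²` because `s > 1`.
      _ ≤ 2 / s * κ (z - w) := by
          refine mul_le_mul_of_nonneg_right ?_ (hκ0 _)
          rw [div_le_div_iff₀ (hden z) hs0]
          nlinarith [Real.sq_sqrt h0, sq_nonneg (√(q z) - s), Real.sqrt_nonneg (q z)]
  -- the equation `(A + s²) * v = 0` tested on the frame vectors
  have heq : ∀ z, f z = -((∫ w, K z w * f w) + (((q z + s ^ 2)⁻¹ : ℝ) : ℂ) * ⟪ψ z, R v⟫_ℂ) := by
    intro z
    have h1 := hv ⟨ψ z, hA.mem_domain z⟩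
    have h2 := hA.integrable v ⟨ψ z, hA.mem_domain z⟩
    rw [inner_add_right, hA.inner_eq, inner_smul_right] at h1
    obtain ⟨h3, h4⟩ := hA.frame.inner_eq_integral v (ψ z)
    simp only at h1 h2
    -- Subtracting `q z` times the reproducing identity replaces the symbol by its increment, which
    -- the decay of the overlaps controls.
    have h5 : (∫ w, ⟪v, ψ w⟫_ℂ * (((q w - q z : ℝ) : ℂ) * ⟪ψ w, ψ z⟫_ℂ)) =
        (∫ w, ⟪v, ψ w⟫_ℂ * (q w * ⟪ψ w, ψ z⟫_ℂ)) - q z * ⟪v, ψ z⟫_ℂ := by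
      rw [← h4, ← integral_const_mul, ← integral_sub h2 (h3.const_mul _)]
      refine integral_congr_ae (Eventually.of_forall fun w => ?_)
      simp only [Complex.ofReal_sub]; ring
    have h6 : ((q z + s ^ 2 : ℝ) : ℂ) * ⟪v, ψ z⟫_ℂ =
        -((∫ w, ⟪v, ψ w⟫_ℂ * (((q w - q z : ℝ) : ℂ) * ⟪ψ w, ψ z⟫_ℂ)) + ⟪v, R (ψ z)⟫_ℂ) := by
      rw [h5]; push_cast at h1 ⊢; linear_combination h1
    have h7 := congrArg (starRingEnd ℂ) h6
    rw [map_mul, map_neg, map_add, Complex.conj_ofReal, ← integral_conj, inner_conj_symm,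
      inner_conj_symm] at h7
    have hRs : ⟪R (ψ z), v⟫_ℂ = ⟪ψ z, R v⟫_ℂ := hA.isSymmetric _ _
    have hne : ((q z + s ^ 2 : ℝ) : ℂ) ≠ 0 := by exact_mod_cast (hden z).ne'
    rw [hRs] at h7
    rw [← inv_mul_cancel_left₀ hne (f z), hf]
    simp only
    rw [h7, mul_neg, mul_add, ← Complex.ofReal_inv, ← integral_const_mul]
    congr 2
    refine integral_congr_ae (Eventually.of_forall fun w => ?_)
    simp only [hKdef, map_mul, Complex.conj_ofReal, inner_conj_symm]
    ring
  have hf2 := hA.frame.integrable v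
  have hI := hA.frame.integral v
  have hsf : ∀ z, ‖starRingEnd ℂ (f z)‖ = ‖⟪ψ z, v⟫_ℂ‖ := fun z => RCLike.norm_conj _
  -- The equation is multiplied by the conjugate of `f` and integrated. By the Schur test the kernel
  -- term is at most `(2/s) (∫ κ) ‖v‖²`, and the term with `R` is of order `s⁻²`.
  obtain ⟨h1, h2⟩ := integrable_kernel_form (Z := Z) (K := K) (κ := fun z => 2 / s * κ z)
    hKm.aestronglyMeasurable (hκ.const_mul (2 / s)) (fun z => by simp only [hκe]) hKb
    (a := fun z => starRingEnd ℂ (f z)) (b := f)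
    (Complex.continuous_conj.comp hfc).aestronglyMeasurable hfc.aestronglyMeasurable
    (by simpa only [hsf] using hf2) hf2
  have h1' := h1
  rw [Measure.volume_eq_prod] at h1' h2
  rw [integral_prod _ h1'] at h2
  have hGi := h1'.integral_prod_left
  have hI' : ∫ z, ‖f z‖ ^ 2 = ‖v‖ ^ 2 := hI
  simp only [hsf, hI, hI', integral_const_mul (2 / s)] at h2
  have hRi := hA.frame.integrable (R v)
  set E : Z → ℂ := fun z => starRingEnd ℂ (f z) * ((((q z + s ^ 2)⁻¹ : ℝ) : ℂ) * ⟪ψ z, R v⟫_ℂ) with hE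
  have hEc : Continuous E := by
    have h2 : Continuous fun z => (q z + s ^ 2)⁻¹ :=
      (hA.continuous_symbol.add continuous_const).inv₀ fun z => (hden z).ne'
    exact (Complex.continuous_conj.comp hfc).mul
      ((Complex.continuous_ofReal.comp h2).mul (hA.frame.continuous_inner _))
  have hdom : Integrable fun z => (s ^ 2)⁻¹ / 2 * (‖⟪ψ z, v⟫_ℂ‖ ^ 2 + ‖⟪ψ z, R v⟫_ℂ‖ ^ 2) :=
    (hf2.add hRi).const_mul _
  have hEb : ∀ z, ‖E z‖ ≤ (s ^ 2)⁻¹ / 2 * (‖⟪ψ z, v⟫_ℂ‖ ^ 2 + ‖⟪ψ z, R v⟫_ℂ‖ ^ 2) := by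
    intro z
    rw [hE, norm_mul, norm_mul, hsf, Complex.norm_real,
      Real.norm_of_nonneg (inv_nonneg.mpr (hden z).le)]
    have h5 : (q z + s ^ 2)⁻¹ ≤ (s ^ 2)⁻¹ := by
      have := hA.symbol_nonneg z
      gcongr; linarith
    calc ‖⟪ψ z, v⟫_ℂ‖ * ((q z + s ^ 2)⁻¹ * ‖⟪ψ z, R v⟫_ℂ‖)
        = (q z + s ^ 2)⁻¹ * (‖⟪ψ z, v⟫_ℂ‖ * ‖⟪ψ z, R v⟫_ℂ‖) := by ring
      _ ≤ (s ^ 2)⁻¹ * ((‖⟪ψ z, v⟫_ℂ‖ ^ 2 + ‖⟪ψ z, R v⟫_ℂ‖ ^ 2) / 2) := by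
          gcongr
          nlinarith [sq_nonneg (‖⟪ψ z, v⟫_ℂ‖ - ‖⟪ψ z, R v⟫_ℂ‖)]
      _ = _ := by ring
  have hEi : Integrable E := hdom.mono' hEc.aestronglyMeasurable (Eventually.of_forall hEb)
  have hEn : ‖∫ z, E z‖ ≤ (s ^ 2)⁻¹ / 2 * (‖v‖ ^ 2 + ‖R v‖ ^ 2) := by
    refine (norm_integral_le_of_norm_le hdom (Eventually.of_forall hEb)).trans_eq ?_
    rw [integral_const_mul, integral_add hf2 hRi, hI, hA.frame.integral]
  have hsum : ((‖v‖ ^ 2 : ℝ) : ℂ) =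
      -((∫ z, ∫ w, starRingEnd ℂ (f z) * (K z w * f w)) + ∫ z, E z) := by
    have h9 : ((‖v‖ ^ 2 : ℝ) : ℂ) = ∫ z, ((‖⟪ψ z, v⟫_ℂ‖ ^ 2 : ℝ) : ℂ) := by
      rw [← hI]; exact (integral_ofReal (𝕜 := ℂ)).symm
    rw [h9, ← integral_add hGi hEi, ← integral_neg]
    refine integral_congr_ae (Eventually.of_forall fun z => ?_)
    have h10 := heq z
    simp only [integral_const_mul]
    rw [← Complex.conj_mul_self_eq_norm_sq, hE]
    change starRingEnd ℂ (f z) * f z = _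
    refine (congrArg (starRingEnd ℂ (f z) * ·) h10).trans ?_
    simp only
    ring
  have hRv : ‖R v‖ ^ 2 ≤ ‖R‖ ^ 2 * ‖v‖ ^ 2 := by
    rw [← mul_pow]; gcongr; exact R.le_opNorm v
  have hkey : ‖v‖ ^ 2 ≤ (2 * (∫ z, κ z) / s + (1 + ‖R‖ ^ 2) / 2 / s ^ 2) * ‖v‖ ^ 2 := by
    have h11 := congrArg norm hsum
    rw [Complex.norm_real, norm_pow, norm_norm, norm_neg] at h11
    refine h11.trans_le ((norm_add_le _ _).trans ((add_le_add h2 hEn).trans ?_))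
    have : (s ^ 2)⁻¹ / 2 * (‖v‖ ^ 2 + ‖R v‖ ^ 2) ≤
        (s ^ 2)⁻¹ / 2 * (‖v‖ ^ 2 + ‖R‖ ^ 2 * ‖v‖ ^ 2) := by gcongr
    refine (add_le_add_right this _).trans_eq ?_
    field_simp
    ring
  have hlt : 2 * (∫ z, κ z) / s + (1 + ‖R‖ ^ 2) / 2 / s ^ 2 < 1 := by
    have h12 : (1 + ‖R‖ ^ 2) / 2 / s ^ 2 ≤ (1 + ‖R‖ ^ 2) / 2 / s := by
      gcongr
      nlinarith
    have h13 : 2 * (∫ z, κ z) / s + (1 + ‖R‖ ^ 2) / 2 / s < 1 := by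
      rw [← add_div, div_lt_one hs0]
      nlinarith [sq_nonneg ‖R‖]
    linarith
  have hv0 : ‖v‖ ^ 2 ≤ 0 := by
    by_contra hne
    push Not at hne
    nlinarith
  have : ‖v‖ = 0 := by nlinarith [norm_nonneg v]
  exact norm_eq_zero.mp this

/-- A frame operator whose symbol is slowly varying and tends to infinity is essentially
self-adjoint, and its closure has a spectral measure. -/
theorem isSelfAdjoint_closure {κ : Z → ℝ} (hκ : Integrable κ) (hκe : ∀ z, κ (-z) = κ z)
    (hK : ∀ z w, ‖((q w - q z : ℝ) : ℂ) * ⟪ψ z, ψ w⟫_ℂ‖ ≤ (√(q z) + 1) * κ (z - w))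
    (hqt : Tendsto q (cocompact Z) atTop) :
    IsSelfAdjoint A.closure ∧ ∃ P : ProjectionValuedMeasure H, P.IsSpectralMeasureOf A.closure := by
  -- The first condition makes the range of `A + s²` dense; the second gives `s² > ‖R‖`, so that `A
  -- + s²` is bounded below.
  obtain ⟨s, hs, hs1⟩ : ∃ s : ℝ, 2 * (∫ z, κ z) + 1 + ‖R‖ ^ 2 ≤ s ∧ 1 + ‖R‖ < s :=
    ⟨max (2 * (∫ z, κ z) + 1 + ‖R‖ ^ 2) (2 + ‖R‖), le_max_left _ _,
      lt_of_lt_of_le (by linarith) (le_max_right _ _)⟩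
  have hR0 := norm_nonneg R
  obtain ⟨hsa, B, hBs, hBg, hBQ⟩ := LinearPMap.exists_resolvent hA.dense_domain hA.isFormalAdjoint
    (c := s ^ 2) (δ := s ^ 2 - ‖R‖) (by nlinarith) (hA.mul_norm_le _)
    fun v hv => hA.eq_zero_of_forall_inner_eq_zero hκ hκe hK hs (by linarith) hv
  refine ⟨hsa, exists_isSpectralMeasureOf ?_ hBs hBg hBQ⟩
  -- With `u = B f`, the form of the closure at `u` is `⟨B f, f - s² B f⟩`, whose second part has a
  -- favourable sign and is dropped.
  refine hA.frame.isCompactOperator_of_lintegral_le hqt B (M := ‖B‖ + ‖R‖ * ‖B‖ ^ 2)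
    (by positivity) fun f => ?_
  obtain ⟨u, hu1, hu2⟩ := A.closure.mem_graph_iff.mp (hBg f)
  simp only at hu1 hu2
  have h1 := hA.lintegral_closure_le u
  rw [hu1, hu2] at h1
  refine h1.trans (ENNReal.ofReal_le_ofReal ?_)
  rw [inner_sub_right, inner_smul_right, inner_self_eq_norm_sq_to_K, Complex.sub_re]
  simp only [Complex.coe_algebraMap, ← Complex.ofReal_pow, ← Complex.ofReal_mul,
    Complex.ofReal_re]
  have h2 : (⟪B f, f⟫_ℂ).re ≤ ‖B‖ * ‖f‖ ^ 2 := by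
    refine (Complex.re_le_norm _).trans ((norm_inner_le_norm _ _).trans ?_)
    calc ‖B f‖ * ‖f‖ ≤ (‖B‖ * ‖f‖) * ‖f‖ := by gcongr; exact B.le_opNorm f
      _ = _ := by ring
  have h3 : ‖R‖ * ‖B f‖ ^ 2 ≤ ‖R‖ * (‖B‖ * ‖f‖) ^ 2 := by gcongr; exact B.le_opNorm f
  have h4 : 0 ≤ s ^ 2 * ‖B f‖ ^ 2 := by positivity
  nlinarith

end IsFrameOperator

end FrameOperator
end

noncomputable section

/-! ### Frames from dense subspaces and operators from kernels. -/

section FrameConstruction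

open scoped InnerProductSpace

theorem lintegral_ofReal_norm_sq {α : Type*} {m : MeasurableSpace α} {μ : Measure α} (f : α → ℂ) :
    ∫⁻ z, ENNReal.ofReal (‖f z‖ ^ 2) ∂μ = eLpNorm f 2 μ ^ 2 := by
  have h := eLpNorm_nnreal_pow_eq_lintegral (f := f) (μ := μ) (p := 2) two_ne_zero
  have h2 : eLpNorm f 2 μ ^ 2 = eLpNorm f ((2 : NNReal) : ℝ≥0∞) μ ^ (((2 : NNReal) : ℝ)) := by
    rw [show (((2 : NNReal) : ℝ)) = ((2 : ℕ) : ℝ) by norm_num, ENNReal.rpow_natCast]; norm_num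
  rw [h2, h]
  refine lintegral_congr fun z => ?_
  rw [show (((2 : NNReal) : ℝ)) = ((2 : ℕ) : ℝ) by norm_num, ENNReal.rpow_natCast,
    ENNReal.ofReal_pow (norm_nonneg _), ofReal_norm]

variable {H : Type*} [NormedAddCommGroup H] [InnerProductSpace ℂ H]
  {Z : Type*} [NormedAddCommGroup Z] [MeasureSpace Z]

/-- Parseval's identity extends from a dense set. -/
theorem IsParsevalFrame.of_dense [BorelSpace Z] {ψ : Z → H} (hψ : Continuous ψ)
    (hψ1 : ∀ z, ‖ψ z‖ ≤ 1) {D : Set H} (hD : Dense D)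
    (hi : ∀ u ∈ D, Integrable fun z => ‖⟪ψ z, u⟫_ℂ‖ ^ 2)
    (hI : ∀ u ∈ D, ∫ z, ‖⟪ψ z, u⟫_ℂ‖ ^ 2 = ‖u‖ ^ 2) : IsParsevalFrame ψ := by
  set f : H → Z → ℂ := fun u z => ⟪ψ z, u⟫_ℂ with hf
  have hfc : ∀ u, Continuous (f u) := fun u => hψ.inner continuous_const
  have hfm : ∀ u, AEStronglyMeasurable (f u) := fun u => (hfc u).measurable.aestronglyMeasurable
  have hDN : ∀ u ∈ D, eLpNorm (f u) 2 volume = ‖u‖ₑ := by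
    intro u hu
    have h1 := lintegral_ofReal_norm_sq (μ := volume) (f u)
    rw [← ofReal_integral_eq_lintegral_ofReal (hi u hu) (Eventually.of_forall fun z => by positivity),
      hI u hu, ENNReal.ofReal_pow (norm_nonneg _), ofReal_norm] at h1
    exact ((ENNReal.pow_right_strictMono two_ne_zero).injective h1).symm
  -- Fatou's lemma gives the upper bound for every vector; applied to the differences `x n - u`, it
  -- then gives the lower bound through the triangle inequality.
  have hle : ∀ u, eLpNorm (f u) 2 volume ≤ ‖u‖ₑ := by
    intro u
    obtain ⟨x, hx, hxu⟩ := mem_closure_iff_seq_limit.mp (hD u)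
    have h1 := Lp.eLpNorm_lim_le_liminf_eLpNorm (p := 2) (fun n => hfm (x n)) (f u)
      (Eventually.of_forall fun z => Filter.Tendsto.inner tendsto_const_nhds hxu)
    refine h1.trans ?_
    simp only [hDN _ (hx _)]
    exact ((continuous_enorm.tendsto _).comp hxu).liminf_eq.le
  have heq : ∀ u, eLpNorm (f u) 2 volume = ‖u‖ₑ := by
    intro u
    refine le_antisymm (hle u) ?_
    obtain ⟨x, hx, hxu⟩ := mem_closure_iff_seq_limit.mp (hD u)
    have h1 : ∀ n, ‖x n‖ₑ ≤ eLpNorm (f u) 2 volume + ‖x n - u‖ₑ := by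
      intro n
      rw [← hDN _ (hx n)]
      have h2 : f (x n) = f u + f (x n - u) := by
        funext z; simp [f]
      rw [h2]
      refine (eLpNorm_add_le (hfm _) (hfm _) one_le_two).trans ?_
      gcongr
      exact hle _
    have h3 : Tendsto (fun n => eLpNorm (f u) 2 volume + ‖x n - u‖ₑ) atTop
        (𝓝 (eLpNorm (f u) 2 volume + 0)) := by
      refine tendsto_const_nhds.add ?_
      have := (continuous_enorm.tendsto _).comp (hxu.sub_const u)
      simpa [Function.comp_def] using this
    rw [add_zero] at h3
    exact le_of_tendsto_of_tendsto' ((continuous_enorm.tendsto _).comp hxu) h3 h1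
  have hL : ∀ u, ∫⁻ z, ENNReal.ofReal (‖f u z‖ ^ 2) = ENNReal.ofReal (‖u‖ ^ 2) := by
    intro u
    rw [lintegral_ofReal_norm_sq, heq, ENNReal.ofReal_pow (norm_nonneg _), ofReal_norm]
  have hm : ∀ u, AEStronglyMeasurable (fun z => ‖⟪ψ z, u⟫_ℂ‖ ^ 2) volume := fun u =>
    ((hfc u).norm.pow 2).measurable.aestronglyMeasurable
  refine ⟨hψ, hψ1, fun u => ⟨hm u, ?_⟩, fun u => ?_⟩
  · rw [hasFiniteIntegral_iff_ofReal (Eventually.of_forall fun z => by positivity), hL]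
    exact ENNReal.ofReal_lt_top
  · rw [integral_eq_lintegral_of_nonneg_ae (Eventually.of_forall fun z => by positivity)
      (hm u), hL, ENNReal.toReal_ofReal (by positivity)]

variable [CompleteSpace H] [NormedSpace ℝ Z] [FiniteDimensional ℝ Z] [BorelSpace Z]
  [(volume : Measure Z).IsAddHaarMeasure]

/-- A Hermitian kernel satisfying the Schur test defines a bounded symmetric operator. -/
theorem IsParsevalFrame.exists_clm_of_kernel {ψ : Z → H} (hψ : IsParsevalFrame ψ) {K : Z → Z → ℂ}
    (hK : AEStronglyMeasurable (fun p : Z × Z => K p.1 p.2))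
    (hKs : ∀ z w, starRingEnd ℂ (K z w) = K w z)
    {κ : Z → ℝ} (hκ : Integrable κ) (hκe : ∀ z, κ (-z) = κ z) (hKκ : ∀ z w, ‖K z w‖ ≤ κ (z - w)) :
    ∃ R : H →L[ℂ] H, (R : H →ₗ[ℂ] H).IsSymmetric ∧ ‖R‖ ≤ ∫ z, κ z ∧ ∀ b u,
      Integrable (fun p : Z × Z => ⟪b, ψ p.1⟫_ℂ * (K p.1 p.2 * ⟪ψ p.2, u⟫_ℂ)) ∧
      ⟪b, R u⟫_ℂ = ∫ p : Z × Z, ⟪b, ψ p.1⟫_ℂ * (K p.1 p.2 * ⟪ψ p.2, u⟫_ℂ) := by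
  have hκ0 : ∀ z, 0 ≤ κ z := fun z => by simpa using (norm_nonneg _).trans (hKκ z 0)
  have hκI : 0 ≤ ∫ z, κ z := integral_nonneg hκ0
  have hform : ∀ b u : H,
      Integrable (fun p : Z × Z => ⟪b, ψ p.1⟫_ℂ * (K p.1 p.2 * ⟪ψ p.2, u⟫_ℂ)) ∧
      ‖∫ p : Z × Z, ⟪b, ψ p.1⟫_ℂ * (K p.1 p.2 * ⟪ψ p.2, u⟫_ℂ)‖ ≤
        (∫ z, κ z) / 2 * (‖b‖ ^ 2 + ‖u‖ ^ 2) := by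
    intro b u
    have hb : ∀ z, ‖⟪b, ψ z⟫_ℂ‖ = ‖⟪ψ z, b⟫_ℂ‖ := fun z => norm_inner_symm _ _
    have h := integrable_kernel_form (Z := Z) hK hκ hκe hKκ (a := fun z => ⟪b, ψ z⟫_ℂ)
      (b := fun z => ⟪ψ z, u⟫_ℂ) (continuous_const.inner hψ.continuous).aestronglyMeasurable
      (hψ.continuous_inner u).aestronglyMeasurable (by simpa only [hb] using hψ.integrable b)
      (hψ.integrable u)
    simpa only [hb, hψ.integral] using h
  set Φ : H → H → ℂ := fun b u => ∫ p : Z × Z, ⟪b, ψ p.1⟫_ℂ * (K p.1 p.2 * ⟪ψ p.2, u⟫_ℂ) with hΦ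
  let L : H →ₗ⋆[ℂ] H →ₗ[ℂ] ℂ := LinearMap.mk₂'ₛₗ (starRingEnd ℂ) (RingHom.id ℂ) Φ
    (fun b c u => by
      simp only [hΦ]
      rw [← integral_add (hform b u).1 (hform c u).1]
      simp only [inner_add_left, add_mul])
    (fun r b u => by
      simp only [hΦ, inner_smul_left, mul_assoc, integral_const_mul, smul_eq_mul])
    (fun b u v => by
      simp only [hΦ]
      rw [← integral_add (hform b u).1 (hform b v).1]
      simp only [inner_add_right, mul_add])
    (fun r b u => by
      simp only [hΦ, inner_smul_right, smul_eq_mul, RingHom.id_apply]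
      rw [← integral_const_mul]
      congr 1
      funext p
      ring)
  have hLb : ∀ b u, ‖L b u‖ ≤ (∫ z, κ z) * (‖b‖ * ‖u‖) := by
    refine norm_sesquilinear_le (fun r x y => ?_) (fun r x y => ?_) fun x y hx hy => ?_
    · rw [LinearMap.map_smulₛₗ, LinearMap.smul_apply, norm_smul, RCLike.norm_conj,
        Complex.norm_real, Real.norm_eq_abs]
    · rw [map_smul, norm_smul, Complex.norm_real, Real.norm_eq_abs]
    · refine (hform x y).2.trans_eq ?_
      rw [hx, hy]; ring
  let R := InnerProductSpace.continuousLinearMapOfBilin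
    (L.mkContinuous₂ (∫ z, κ z) fun b u => by rw [mul_assoc]; exact hLb b u)
  have hR : ∀ b u, ⟪R b, u⟫_ℂ = Φ b u := fun b u =>
    InnerProductSpace.continuousLinearMapOfBilin_apply _ b u
  have hΦs : ∀ b u, starRingEnd ℂ (Φ b u) = Φ u b := by
    intro b u
    simp only [hΦ]
    rw [← integral_conj, Measure.volume_eq_prod, ← integral_prod_swap]
    refine integral_congr_ae (Eventually.of_forall fun p => ?_)
    simp only [map_mul, inner_conj_symm, hKs, Prod.fst_swap, Prod.snd_swap]
    ring
  have hR' : ∀ b u, ⟪b, R u⟫_ℂ = Φ b u := fun b u => by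
    rw [← inner_conj_symm, hR, hΦs]
  refine ⟨R, fun b u => ?_, ContinuousLinearMap.opNorm_le_bound _ hκI fun u => ?_,
    fun b u => ⟨(hform b u).1, hR' b u⟩⟩
  · exact (hR b u).trans (hR' b u).symm
  · have h1 := hLb u (R u)
    have h2 : L u (R u) = ⟪R u, R u⟫_ℂ := (hR u (R u)).symm
    rw [h2, inner_self_eq_norm_sq_to_K] at h1
    simp only [Complex.coe_algebraMap, norm_pow, Complex.norm_real, norm_norm] at h1
    rcases eq_or_lt_of_le (norm_nonneg (R u)) with h3 | h3
    · rw [← h3]; positivity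
    · nlinarith

end FrameConstruction
end

noncomputable section

/-! ### Coherent states at the semiclassical scale. -/

section DilatedCoherentStates

open scoped InnerProductSpace

variable {d : ℕ}

/-- The dilation `x ↦ u (s x)` of a Schwartz function. -/
def SchwartzMap.dilate (s : ℝˣ) : 𝓢(BaseSpace d, ℂ) →L[ℂ] 𝓢(BaseSpace d, ℂ) :=
  SchwartzMap.compCLMOfContinuousLinearEquiv ℂ (ContinuousLinearEquiv.smulLeft s)

@[simp]
theorem SchwartzMap.dilate_apply (s : ℝˣ) (u : 𝓢(BaseSpace d, ℂ)) (x : BaseSpace d) :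
    SchwartzMap.dilate s u x = u ((s : ℝ) • x) := rfl

theorem integral_dilate {s : ℝ} (hs : 0 < s) (f : BaseSpace d → ℂ) :
    ∫ x, f x = ((s ^ d : ℝ) : ℂ) * ∫ x, f (s • x) := by
  rw [Measure.integral_comp_smul_of_nonneg volume f s (hR := hs.le), finrank_euclideanSpace_fin,
    Complex.real_smul, ← mul_assoc, ← Complex.ofReal_mul, mul_inv_cancel₀ (by positivity),
    Complex.ofReal_one, one_mul]

/-- The coherent states dilated by `s`, normalised in `L²`. -/
def dilatedState (s : ℝˣ) (w : PhaseSpace d) : 𝓢(BaseSpace d, ℂ) :=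
  (((√((s : ℝ) ^ d))⁻¹ : ℝ) : ℂ) • SchwartzMap.dilate s⁻¹ (coherentState w)

/-- The dilated coherent states as vectors of `L²`. -/
def stateVec (s : ℝˣ) (w : PhaseSpace d) : L2Space d := (dilatedState s w).toLp 2 volume

theorem inner_toLp_eq_integral_dilate {s : ℝˣ} (hs : 0 < (s : ℝ)) (u v : 𝓢(BaseSpace d, ℂ)) :
    ⟪u.toLp 2 volume, v.toLp 2 volume⟫_ℂ = (((s : ℝ) ^ d : ℝ) : ℂ) *
      ∫ x, starRingEnd ℂ (SchwartzMap.dilate s u x) * SchwartzMap.dilate s v x := by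
  rw [show ⟪u.toLp 2 volume, v.toLp 2 volume⟫_ℂ = _ from
    SchwartzMap.inner_toL2_toL2_eq u v volume, integral_dilate hs]
  simp only [RCLike.inner_apply, SchwartzMap.dilate_apply, mul_comm]

theorem dilate_dilatedState (s : ℝˣ) (w : PhaseSpace d) :
    SchwartzMap.dilate s (dilatedState s w) = (((√((s : ℝ) ^ d))⁻¹ : ℝ) : ℂ) • coherentState w := by
  ext x
  simp [dilatedState]

/-- Dilating the integration variable returns to the unit scale; the factor is the Jacobian `s^d`
times the normalisation `s^{-d/2}`. -/
theorem inner_stateVec {s : ℝˣ} (hs : 0 < (s : ℝ)) (w : PhaseSpace d) (u : 𝓢(BaseSpace d, ℂ)) :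
    ⟪stateVec s w, u.toLp 2 volume⟫_ℂ =
      ((√((s : ℝ) ^ d) : ℝ) : ℂ) * coherentTransform (SchwartzMap.dilate s u) w := by
  have hpos : 0 < √((s : ℝ) ^ d) := by positivity
  rw [stateVec, inner_toLp_eq_integral_dilate hs, dilate_dilatedState, coherentTransform]
  simp only [smul_apply, smul_eq_mul, map_mul, Complex.conj_ofReal, mul_assoc,
    integral_const_mul]
  rw [← mul_assoc, ← Complex.ofReal_mul]
  congr 2
  rw [← div_eq_mul_inv, Real.div_sqrt]

theorem inner_stateVec_stateVec {s : ℝˣ} (hs : 0 < (s : ℝ)) (z w : PhaseSpace d) :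
    ⟪stateVec s z, stateVec s w⟫_ℂ = overlap z w := by
  have hpos : 0 < √((s : ℝ) ^ d) := by positivity
  rw [stateVec.eq_def s w, inner_stateVec hs, dilate_dilatedState, coherentTransform]
  simp only [smul_apply, smul_eq_mul, mul_left_comm _ (((√((s : ℝ) ^ d))⁻¹ : ℝ) : ℂ),
    integral_const_mul]
  rw [← mul_assoc, ← Complex.ofReal_mul, inv_mul_cancel₀ hpos.ne', Complex.ofReal_one, one_mul]
  exact coherentTransform_coherentState z w

theorem overlap_self (z : PhaseSpace d) : overlap z z = 1 := by
  simp [overlap, cohPhase]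

theorem norm_stateVec {s : ℝˣ} (hs : 0 < (s : ℝ)) (z : PhaseSpace d) : ‖stateVec s z‖ = 1 := by
  have h := inner_self_eq_norm_sq_to_K (𝕜 := ℂ) (stateVec s z)
  rw [inner_stateVec_stateVec hs, overlap_self] at h
  have h2 : ‖stateVec s z‖ ^ 2 = 1 := by
    apply Complex.ofReal_injective
    rw [Complex.ofReal_one, h]; simp
  nlinarith [norm_nonneg (stateVec s z)]

/-- For unit vectors `‖ψ_w - ψ_z‖² = 2 - 2 Re ⟨ψ_w, ψ_z⟩`, and the overlap is explicit and
continuous. -/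
theorem continuous_stateVec {s : ℝˣ} (hs : 0 < (s : ℝ)) :
    Continuous (stateVec s : PhaseSpace d → L2Space d) := by
  rw [continuous_iff_continuousAt]
  intro z
  rw [ContinuousAt, tendsto_iff_norm_sub_tendsto_zero]
  have h1 : ∀ w, ‖stateVec s w - stateVec s z‖ = √(2 - 2 * (overlap w z).re) := by
    intro w
    have := norm_sub_sq (𝕜 := ℂ) (stateVec s w) (stateVec s z)
    rw [norm_stateVec hs, norm_stateVec hs, inner_stateVec_stateVec hs] at this
    rw [← Real.sqrt_sq (norm_nonneg (stateVec s w - stateVec s z)), this]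
    congr 1
    simp only [RCLike.re_eq_complex_re]
    ring
  simp only [h1]
  have h2 : Continuous fun w => √(2 - 2 * (overlap w z).re) := by
    have : Continuous fun w => overlap w z :=
      Continuous.comp (g := fun p : PhaseSpace d × PhaseSpace d => overlap p.1 p.2)
        (f := fun w => (w, z)) continuous_overlap (Continuous.prodMk_left z)
    exact Real.continuous_sqrt.comp
      (continuous_const.sub (continuous_const.mul (Complex.continuous_re.comp this)))
  have h3 := h2.tendsto z
  rw [overlap_self] at h3
  simpa using h3

theorem denseRange_schwartz_toLp :
    Dense (Set.range fun u : 𝓢(BaseSpace d, ℂ) => u.toLp 2 (volume : Measure (BaseSpace d))) :=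
  SchwartzMap.denseRange_toLpCLM (p := 2) (by norm_num)

/-- Parseval's identity for the coherent state transform. -/
theorem integral_norm_sq_coherentTransform (u : 𝓢(BaseSpace d, ℂ)) :
    ((∫ w, ‖coherentTransform u w‖ ^ 2 : ℝ) : ℂ) = ∫ y, starRingEnd ℂ (u y) * u y := by
  obtain ⟨C, hC, h⟩ := u.exists_norm_le_polyDecay 0
  rw [integral_mul_schwartz_eq u (b := fun y => starRingEnd ℂ (u y)) (C := C) (M := 0)
    (Complex.continuous_conj.comp u.continuous).aestronglyMeasurable
    (fun y => by simpa [polyDecay] using h y)]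
  refine (integral_ofReal (𝕜 := ℂ)).symm.trans ?_
  refine integral_congr_ae (Eventually.of_forall fun w => ?_)
  have h1 : ∫ y, starRingEnd ℂ (u y) * coherentState w y = starRingEnd ℂ (coherentTransform u w) := by
    rw [coherentTransform, ← integral_conj]
    simp only [map_mul, Complex.conj_conj, mul_comm]
  simp only [h1]
  rw [mul_comm]
  exact (Complex.conj_mul_self_eq_norm_sq _).symm

theorem integrable_norm_sq_coherentTransform (u : 𝓢(BaseSpace d, ℂ)) :
    Integrable fun w => ‖coherentTransform u w‖ ^ 2 := by
  obtain ⟨C, hC, h⟩ := coherentTransform_schwartz_decay u 0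
  have h1 := (integrable_coherentTransform_mul (u := u) (f := coherentTransform u) (C := C) (N := 0)
    (continuous_coherentTransform u).aestronglyMeasurable fun w => by simpa [polyDecay] using h w).norm
  refine h1.congr (Eventually.of_forall fun w => ?_)
  simp only [norm_mul, sq]

/-- Scaling reduces Parseval's identity on Schwartz functions to the unit scale; density gives the
rest. -/
theorem isParsevalFrame_stateVec {s : ℝˣ} (hs : 0 < (s : ℝ)) :
    IsParsevalFrame (stateVec s : PhaseSpace d → L2Space d) := by
  have hpos : 0 ≤ (s : ℝ) ^ d := by positivity
  have hn : ∀ (u : 𝓢(BaseSpace d, ℂ)) w, ‖⟪stateVec s w, u.toLp 2 volume⟫_ℂ‖ ^ 2 =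
      (s : ℝ) ^ d * ‖coherentTransform (SchwartzMap.dilate s u) w‖ ^ 2 := by
    intro u w
    rw [inner_stateVec hs, norm_mul, mul_pow, Complex.norm_real, Real.norm_of_nonneg (by positivity),
      Real.sq_sqrt hpos]
  refine IsParsevalFrame.of_dense (continuous_stateVec hs) (fun z => (norm_stateVec hs z).le)
    denseRange_schwartz_toLp ?_ ?_
  · rintro _ ⟨u, rfl⟩
    simp only [hn]
    exact (integrable_norm_sq_coherentTransform _).const_mul _
  · rintro _ ⟨u, rfl⟩
    simp only [hn]
    rw [integral_const_mul]
    apply Complex.ofReal_injective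
    rw [Complex.ofReal_mul, integral_norm_sq_coherentTransform, ← inner_toLp_eq_integral_dilate hs,
      inner_self_eq_norm_sq_to_K]
    simp

end DilatedCoherentStates
end

noncomputable section

/-! ### The Weyl quantization in the coherent state representation. -/

section WeylFrameOperator

open scoped InnerProductSpace

variable {d : ℕ}

/-- Scaling reduces the semiclassical Weyl quantization to `h = 1/(2π)`. -/
theorem weylQuantization_dilate {h s : ℝ} (hs : 0 < s) (hh : s ^ 2 = 2 * Real.pi * h)
    (q : PhaseSpace d → ℝ) (u : BaseSpace d → ℂ) (x : BaseSpace d) :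
    weylQuantization h (fun ρ => (q ρ : ℂ)) u (s • x) =
      weylUnit (fun ρ => q (s • ρ)) (fun y => u (s • y)) x := by
  have hh0 : 0 < h := by
    have : 0 < 2 * Real.pi * h := by rw [← hh]; positivity
    exact (pos_iff_pos_of_mul_pos this).mp Real.two_pi_pos
  rw [weylQuantization, integral_dilate hs]
  simp only [fun ξ : BaseSpace d => integral_dilate hs (fun y : BaseSpace d =>
    ((q (WithLp.toLp 2 ((1 / 2 : ℝ) • (s • x + y), s • ξ)) : ℝ) : ℂ) *
        Complex.exp (Complex.I * ((inner ℝ (s • x - y) (s • ξ) / h : ℝ) : ℂ)) * u y)]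
  rw [integral_const_mul, ← mul_assoc, ← mul_assoc, weylUnit]
  -- The Jacobians in `y` and `ξ` give `s^{2d} = (2πh)^d`, which cancels the semiclassical
  -- prefactor.
  have h1 : (((2 * Real.pi * h) ^ d : ℝ) : ℂ)⁻¹ * ((s ^ d : ℝ) : ℂ) * ((s ^ d : ℝ) : ℂ) = 1 := by
    rw [← hh, mul_assoc, ← Complex.ofReal_mul, ← mul_pow, ← sq, ← Complex.ofReal_inv,
      ← Complex.ofReal_mul, inv_mul_cancel₀ (by positivity), Complex.ofReal_one]
  rw [h1, one_mul]
  congr 1; funext ξ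
  congr 1; funext y
  rw [weylIntegrand, midPoint, planeWave]
  have h2 : (WithLp.toLp 2 ((1 / 2 : ℝ) • (s • x + s • y), s • ξ) : PhaseSpace d) =
      s • WithLp.toLp 2 ((1 / 2 : ℝ) • (x + y), ξ) := by
    refine phase_ext ?_ rfl
    change (1 / 2 : ℝ) • (s • x + s • y) = s • (1 / 2 : ℝ) • (x + y)
    module
  have h3 : inner ℝ (s • x - s • y) (s • ξ) / h = 2 * Real.pi * inner ℝ ξ (x - y) := by
    rw [← smul_sub, inner_smul_left, inner_smul_right, real_inner_comm, div_eq_iff hh0.ne']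
    simp only [conj_trivial]
    linear_combination (inner ℝ ξ (x - y)) * hh
  rw [h2, h3, mul_comm Complex.I]

/-- The reproducing formula, that is, the polarized Parseval identity tested against a coherent
state. -/
theorem integral_overlap_mul_coherentTransform (u : 𝓢(BaseSpace d, ℂ)) (v : PhaseSpace d) :
    ∫ w, overlap v w * coherentTransform u w = coherentTransform u v := by
  have h1 : (0 : ℝ) < ((1 : ℝˣ) : ℝ) := by simp
  have h2 := ((isParsevalFrame_stateVec h1).inner_eq_integral (stateVec 1 v) (u.toLp 2 volume)).2
  have h3 : SchwartzMap.dilate 1 u = u := by ext x; simp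
  simp only [inner_stateVec h1, inner_stateVec_stateVec h1, h3] at h2
  simpa using h2

theorem norm_overlap_le_one (z w : PhaseSpace d) : ‖overlap z w‖ ≤ 1 := by
  rw [norm_overlap]
  exact Real.exp_le_one_iff.mpr (by nlinarith [Real.pi_pos, sq_nonneg ‖z - w‖])

/-- After Fubini the integral in `w` collapses by the reproducing formula. Joint integrability needs
only `|overlap v w| ≤ 1`, since the transform of `u` and `overlap z · * q` are integrable
separately. -/
theorem integral_coherentTransform_mul_toeplitzKernel {q : PhaseSpace d → ℝ}
    (hq : HasQuadraticGrowth q) (u : 𝓢(BaseSpace d, ℂ)) (z : PhaseSpace d) :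
    Integrable (fun w => coherentTransform u w * toeplitzKernel q z w) ∧
    ∫ w, coherentTransform u w * toeplitzKernel q z w =
      ∫ v, overlap z v * (q v * coherentTransform u v) := by
  have hqc := hq.contDiff.continuous
  obtain ⟨A, hA, hAq⟩ := hq.norm_le
  have hu : Integrable (coherentTransform (u : BaseSpace d → ℂ)) := by
    have := integrable_coherentTransform_mul (u := u) (f := fun _ => 1) (C := 1) (N := 0)
      aestronglyMeasurable_const (by simp)
    simpa using this
  obtain ⟨C, hC, hexp⟩ := exists_exp_le_polyDecay (V := PhaseSpace d) (Real.pi / 2) (by positivity)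
    (2 + (2 * d + 1))
  have hcz : Continuous fun v => overlap z v :=
    Continuous.comp (g := fun p : PhaseSpace d × PhaseSpace d => overlap p.1 p.2)
      (f := fun v => (z, v)) continuous_overlap (Continuous.prodMk_right z)
  have ha : Integrable fun v => overlap z v * (q v : ℂ) := by
    refine ((integrable_polyDecay_phase.comp_sub_right z).const_mul (C * A * (1 + ‖z‖) ^ 2)).mono'
      (hcz.mul (Complex.continuous_ofReal.comp hqc)).aestronglyMeasurable
      (Eventually.of_forall fun v => ?_)
    rw [norm_mul, norm_overlap, Complex.norm_real, Real.norm_eq_abs, ← polyDecay_neg, neg_sub]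
    have h1 : (1 + ‖v‖) ^ 2 ≤ (1 + ‖z‖) ^ 2 * (1 + ‖z - v‖) ^ 2 := by
      rw [← mul_pow]
      gcongr
      have : ‖v‖ ≤ ‖z‖ + ‖z - v‖ := by
        have := norm_sub_le z (z - v); simpa using this
      nlinarith [norm_nonneg z, norm_nonneg (z - v)]
    have h2 := pow_mul_polyDecay_add 2 (2 * d + 1) (z - v)
    calc Real.exp (-(Real.pi / 2) * ‖z - v‖ ^ 2) * |q v|
        ≤ (C * polyDecay (2 + (2 * d + 1)) (z - v)) *
          (A * ((1 + ‖z‖) ^ 2 * (1 + ‖z - v‖) ^ 2)) := by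
          have := polyDecay_nonneg (2 + (2 * d + 1)) (z - v)
          gcongr
          · exact hexp _
          · exact (hAq v).trans (by gcongr)
      _ = C * A * (1 + ‖z‖) ^ 2 * polyDecay (2 * d + 1) (z - v) := by rw [← h2]; ring
  have hprod : Integrable (fun p : PhaseSpace d × PhaseSpace d =>
      coherentTransform u p.1 * (overlap z p.2 * q p.2 * overlap p.2 p.1))
      (volume.prod volume) := by
    refine (hu.mul_prod ha).norm.mono' ?_ (Eventually.of_forall fun p => ?_)
    · have h1 : Continuous fun p : PhaseSpace d × PhaseSpace d => overlap p.2 p.1 :=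
        Continuous.comp (g := fun p : PhaseSpace d × PhaseSpace d => overlap p.1 p.2)
          (f := Prod.swap) continuous_overlap continuous_swap
      exact (((continuous_coherentTransform u).comp continuous_fst).mul
        (((hcz.comp continuous_snd).mul
          (Complex.continuous_ofReal.comp (hqc.comp continuous_snd))).mul h1)).aestronglyMeasurable
    · rw [← mul_assoc, norm_mul]
      exact mul_le_of_le_one_right (norm_nonneg _) (norm_overlap_le_one _ _)
  refine ⟨?_, ?_⟩
  · have := hprod.integral_prod_left
    refine this.congr (Eventually.of_forall fun w => ?_)
    simp only [integral_const_mul, toeplitzKernel]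
  · have h1 := integral_integral_swap (f := fun w v =>
      coherentTransform u w * (overlap z v * q v * overlap v w)) hprod
    simp only [integral_const_mul] at h1
    rw [show (∫ w, coherentTransform u w * toeplitzKernel q z w) = _ from h1]
    congr 1; funext v
    rw [← mul_assoc, ← integral_overlap_mul_coherentTransform u v, ← integral_const_mul]
    congr 1; funext w; ring

/-- The coherent transform of the Weyl quantization: Toeplitz part plus remainder. -/
theorem coherentTransform_weylUnit_eq {q : PhaseSpace d → ℝ}
    (hq : HasQuadraticGrowth q) {C : ℝ}
    (hr : ∀ z w, ‖remainderKernel q z w‖ ≤ C * polyDecay (2 * d + 1) (z - w))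
    (u : 𝓢(BaseSpace d, ℂ)) (z : PhaseSpace d) :
    coherentTransform (weylUnit q u) z = (∫ v, overlap z v * (q v * coherentTransform u v)) +
      ∫ w, remainderKernel q z w * coherentTransform u w := by
  obtain ⟨h1, h2⟩ := integral_coherentTransform_mul_toeplitzKernel hq u z
  have hC : 0 ≤ C := by
    have := (norm_nonneg _).trans (hr z z)
    simpa [polyDecay] using this
  have h3 : Integrable fun w => coherentTransform u w * remainderKernel q z w := by
    refine integrable_coherentTransform_mul (C := C) (N := 0) ?_ fun w => ?_
    · exact ((stronglyMeasurable_remainderKernel hq.contDiff.continuous).comp_measurable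
        measurable_prodMk_left).aestronglyMeasurable
    · rw [pow_zero, mul_one]
      exact (hr z w).trans (mul_le_of_le_one_right hC (polyDecay_le_one _ _))
  rw [coherentTransform_weylUnit hq, ← h2]
  simp only [mul_comm (remainderKernel q z _)]
  rw [← integral_add h1 h3]
  congr 1; funext w
  rw [remainderKernel]; ring

/-- Parseval for a pairing in which `W` is only polynomially bounded. The Weyl quantization of a
Schwartz function enters in this way before it is known to lie in `L²`. -/
theorem integral_conj_mul_eq (χ : 𝓢(BaseSpace d, ℂ)) {W : BaseSpace d → ℂ}
    (hW : AEStronglyMeasurable W) {C : ℝ} {M : ℕ} (hWb : ∀ y, ‖W y‖ ≤ C * (1 + ‖y‖) ^ M) :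
    ∫ y, starRingEnd ℂ (χ y) * W y =
      ∫ z, starRingEnd ℂ (coherentTransform χ z) * coherentTransform W z := by
  have h1 := integral_mul_schwartz_eq χ (b := fun y => starRingEnd ℂ (W y)) (C := C) (M := M)
    (Complex.continuous_conj.comp_aestronglyMeasurable hW)
    (fun y => by rw [RCLike.norm_conj]; exact hWb y)
  have h2 := congrArg (starRingEnd ℂ) h1
  rw [← integral_conj, ← integral_conj] at h2
  simp only [map_mul, Complex.conj_conj] at h2
  rw [show (∫ y, starRingEnd ℂ (χ y) * W y) = ∫ y, W y * starRingEnd ℂ (χ y) by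
    simp only [mul_comm], h2]
  congr 1; funext z
  rw [← integral_conj, coherentTransform.eq_def W]
  congr 2; funext y
  simp only [map_mul, Complex.conj_conj, mul_comm]

end WeylFrameOperator
end

noncomputable section

/-! ### The Weyl quantization as an unbounded operator on `L²`. -/

section WeylOnSchwartz

open scoped InnerProductSpace

variable {d : ℕ}

theorem integrable_symbol_mul_inner_stateVec {s : ℝˣ} (hs : 0 < (s : ℝ)) {q : PhaseSpace d → ℝ}
    (hq : HasQuadraticGrowth q) (u : 𝓢(BaseSpace d, ℂ)) :
    Integrable fun z => (q z : ℂ) * ⟪stateVec s z, u.toLp 2 volume⟫_ℂ := by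
  obtain ⟨A, hA, hAq⟩ := hq.norm_le
  have h1 := (integrable_coherentTransform_mul (u := SchwartzMap.dilate s u)
    (f := fun z => (q z : ℂ)) (C := A) (N := 2)
    (Complex.continuous_ofReal.comp hq.contDiff.continuous).aestronglyMeasurable
    (fun z => by rw [Complex.norm_real, Real.norm_eq_abs]; exact hAq z)).const_mul
      ((√((s : ℝ) ^ d) : ℝ) : ℂ)
  refine h1.congr (Eventually.of_forall fun z => ?_)
  simp only [inner_stateVec hs]
  ring

/-- The Toeplitz operator of the frame of dilated coherent states, applied to a Schwartz
function. -/
def toeplitzVec (s : ℝˣ) (q : PhaseSpace d → ℝ) (u : 𝓢(BaseSpace d, ℂ)) : L2Space d :=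
  ∫ z, ((q z : ℂ) * ⟪stateVec s z, u.toLp 2 volume⟫_ℂ) • stateVec s z

theorem integrable_toeplitzVec {s : ℝˣ} (hs : 0 < (s : ℝ)) {q : PhaseSpace d → ℝ}
    (hq : HasQuadraticGrowth q) (u : 𝓢(BaseSpace d, ℂ)) :
    Integrable fun z => ((q z : ℂ) * ⟪stateVec s z, u.toLp 2 volume⟫_ℂ) • stateVec s z := by
  have h1 := integrable_symbol_mul_inner_stateVec hs hq u
  refine h1.norm.mono' (h1.aestronglyMeasurable.smul
    (continuous_stateVec hs).aestronglyMeasurable) (Eventually.of_forall fun z => ?_)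
  rw [norm_smul, norm_stateVec hs, mul_one]

theorem inner_toeplitzVec {s : ℝˣ} (hs : 0 < (s : ℝ)) {q : PhaseSpace d → ℝ}
    (hq : HasQuadraticGrowth q) (u : 𝓢(BaseSpace d, ℂ)) (b : L2Space d) :
    Integrable (fun z => ⟪b, stateVec s z⟫_ℂ * (q z * ⟪stateVec s z, u.toLp 2 volume⟫_ℂ)) ∧
    ⟪b, toeplitzVec s q u⟫_ℂ =
      ∫ z, ⟪b, stateVec s z⟫_ℂ * (q z * ⟪stateVec s z, u.toLp 2 volume⟫_ℂ) := by
  have h1 := integrable_toeplitzVec hs hq u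
  have h2 := (innerSL ℂ b).integrable_comp h1
  have h3 := (innerSL ℂ b).integral_comp_comm h1
  simp only [innerSL_apply_apply, inner_smul_right, mul_comm _ ⟪b, stateVec s _⟫_ℂ] at h2 h3
  exact ⟨h2, h3.symm⟩

theorem toLp_smul' (c : ℂ) (u : 𝓢(BaseSpace d, ℂ)) :
    (c • u).toLp 2 (volume : Measure (BaseSpace d)) = c • u.toLp 2 volume :=
  map_smul (SchwartzMap.toLpCLM ℂ ℂ 2 (volume : Measure (BaseSpace d))) c u

theorem toLp_add' (u v : 𝓢(BaseSpace d, ℂ)) :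
    (u + v).toLp 2 (volume : Measure (BaseSpace d)) = u.toLp 2 volume + v.toLp 2 volume :=
  map_add (SchwartzMap.toLpCLM ℂ ℂ 2 (volume : Measure (BaseSpace d))) u v

/-- Pairing of the Weyl quantization with a Schwartz function. -/
theorem integral_conj_mul_weylQuantization {h : ℝ} {s : ℝˣ} (hs : 0 < (s : ℝ))
    (hh : (s : ℝ) ^ 2 = 2 * Real.pi * h) {q : PhaseSpace d → ℝ}
    (hq : HasQuadraticGrowth fun ρ => q ((s : ℝ) • ρ)) {C : ℝ}
    (hr : ∀ z w, ‖remainderKernel (fun ρ => q ((s : ℝ) • ρ)) z w‖ ≤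
      C * polyDecay (2 * d + 1) (z - w))
    {R : L2Space d →L[ℂ] L2Space d}
    (hR : ∀ b u, Integrable (fun p : PhaseSpace d × PhaseSpace d => ⟪b, stateVec s p.1⟫_ℂ *
        (remainderKernel (fun ρ => q ((s : ℝ) • ρ)) p.1 p.2 * ⟪stateVec s p.2, u⟫_ℂ)) ∧
      ⟪b, R u⟫_ℂ = ∫ p : PhaseSpace d × PhaseSpace d, ⟪b, stateVec s p.1⟫_ℂ *
        (remainderKernel (fun ρ => q ((s : ℝ) • ρ)) p.1 p.2 * ⟪stateVec s p.2, u⟫_ℂ))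
    (χ u : 𝓢(BaseSpace d, ℂ)) :
    ∫ x, starRingEnd ℂ (χ x) * weylQuantization h (fun ρ => (q ρ : ℂ)) u x =
      ⟪χ.toLp 2 volume, toeplitzVec s (fun ρ => q ((s : ℝ) • ρ)) u + R (u.toLp 2 volume)⟫_ℂ := by
  set qs : PhaseSpace d → ℝ := fun ρ => q ((s : ℝ) • ρ) with hqs
  set u' := SchwartzMap.dilate s u with hu'
  set χ' := SchwartzMap.dilate s χ with hχ'
  set c : ℂ := ((√((s : ℝ) ^ d) : ℝ) : ℂ) with hc
  have hc2 : c * c = (((s : ℝ) ^ d : ℝ) : ℂ) := by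
    rw [hc, ← Complex.ofReal_mul, Real.mul_self_sqrt (by positivity)]
  have hcc : starRingEnd ℂ c = c := Complex.conj_ofReal _
  obtain ⟨CW, hCW, hWb⟩ := exists_norm_weylUnit_le hq u'
  have hframe := isParsevalFrame_stateVec (d := d) hs
  have hiu : ∀ z, ⟪stateVec s z, u.toLp 2 volume⟫_ℂ = c * coherentTransform u' z :=
    fun z => inner_stateVec hs z u
  have hiχ : ∀ z, ⟪χ.toLp 2 volume, stateVec s z⟫_ℂ = c * starRingEnd ℂ (coherentTransform χ' z) := by
    intro z
    have h1 := inner_stateVec hs z χ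
    rw [← inner_conj_symm, h1, map_mul, hcc]
  -- the Toeplitz part
  have hT := hframe.inner_eq_integral (χ.toLp 2 volume) (toeplitzVec s qs u)
  have hTz : ∀ z, ⟪stateVec s z, toeplitzVec s qs u⟫_ℂ =
      c * ∫ v, overlap z v * (qs v * coherentTransform u' v) := by
    intro z
    rw [(inner_toeplitzVec hs hq u _).2, ← integral_const_mul]
    congr 1; funext v
    rw [inner_stateVec_stateVec hs, hiu]; ring
  obtain ⟨hRi, hRe⟩ := hR (χ.toLp 2 volume) (u.toLp 2 volume)
  rw [Measure.volume_eq_prod] at hRi hRe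
  have hRi' := hRi.integral_prod_left
  rw [integral_prod _ hRi] at hRe
  rw [inner_add_right, ← hT.2, hRe, ← integral_add hT.1 hRi', integral_dilate hs]
  have hW : ∀ x : BaseSpace d, weylQuantization h (fun ρ => (q ρ : ℂ)) u ((s : ℝ) • x) =
      weylUnit qs u' x := fun x => weylQuantization_dilate hs hh q u x
  simp only [hW]
  rw [show (∫ x, starRingEnd ℂ (χ ((s : ℝ) • x)) * weylUnit qs u' x) =
    ∫ x, starRingEnd ℂ (χ' x) * weylUnit qs u' x from rfl,
    integral_conj_mul_eq χ' (stronglyMeasurable_weylUnit hq.contDiff.continuous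
      u'.continuous).aestronglyMeasurable hWb, ← integral_const_mul]
  congr 1; funext z
  rw [coherentTransform_weylUnit_eq hq hr, hiχ, hTz]
  simp only [hiu, mul_left_comm _ c, integral_const_mul]
  rw [← hc2]
  ring

/-- The Weyl quantization of a Schwartz function is, as an element of `L²`, the sum of a Toeplitz
operator and a bounded operator. -/
theorem toeplitzVec_add_ae_eq {h : ℝ} {s : ℝˣ} (hs : 0 < (s : ℝ))
    (hh : (s : ℝ) ^ 2 = 2 * Real.pi * h) {q : PhaseSpace d → ℝ}
    (hq : HasQuadraticGrowth fun ρ => q ((s : ℝ) • ρ)) (u : 𝓢(BaseSpace d, ℂ)) {v : L2Space d}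
    (hv : ∀ χ : 𝓢(BaseSpace d, ℂ), ∫ x, starRingEnd ℂ (χ x) *
      weylQuantization h (fun ρ => (q ρ : ℂ)) u x = ⟪χ.toLp 2 volume, v⟫_ℂ) :
    ⇑v =ᵐ[volume] weylQuantization h (fun ρ => (q ρ : ℂ)) u := by
  set W := weylQuantization h (fun ρ => (q ρ : ℂ)) u with hWdef
  set u' := SchwartzMap.dilate s u with hu'
  obtain ⟨CW, hCW, hWb⟩ := exists_norm_weylUnit_le hq u'
  have hW : ∀ x : BaseSpace d, W x = weylUnit (fun ρ => q ((s : ℝ) • ρ)) u' ((s : ℝ)⁻¹ • x) := by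
    intro x
    have := weylQuantization_dilate hs hh q u ((s : ℝ)⁻¹ • x)
    rw [smul_inv_smul₀ hs.ne'] at this
    exact this
  have hWm : AEStronglyMeasurable W volume := by
    have : W = fun x => weylUnit (fun ρ => q ((s : ℝ) • ρ)) u' ((s : ℝ)⁻¹ • x) := funext hW
    rw [this]
    exact ((stronglyMeasurable_weylUnit hq.contDiff.continuous u'.continuous).comp_measurable
      (measurable_const_smul _)).aestronglyMeasurable
  have hWl : LocallyIntegrable W volume := by
    have hg : Continuous fun x : BaseSpace d => CW * (1 + ‖(s : ℝ)⁻¹ • x‖) ^ 2 := by fun_prop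
    refine hg.locallyIntegrable.mono hWm (Eventually.of_forall fun x => ?_)
    rw [Real.norm_of_nonneg (by positivity), hW]
    exact hWb _
  have hvl : LocallyIntegrable v volume := (Lp.memLp v).locallyIntegrable (by norm_num)
  -- Real test functions of compact support are Schwartz functions, so `hv` makes the two locally
  -- integrable functions equal as distributions.
  have h0 := ae_eq_zero_of_integral_contDiff_smul_eq_zero (hvl.sub hWl) fun g hg hgc => by
    have hgc' : HasCompactSupport fun x => (g x : ℂ) := hgc.comp_left Complex.ofReal_zero
    have hg' : ContDiff ℝ ∞ fun x => (g x : ℂ) := Complex.ofRealCLM.contDiff.comp hg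
    let χ : 𝓢(BaseSpace d, ℂ) := hgc'.toSchwartzMap hg'
    have hχ : ∀ x, χ x = (g x : ℂ) := fun x => rfl
    have h1 := hv χ
    rw [L2.inner_def] at h1
    have h2 : ∫ x, ⟪(χ.toLp 2 volume : L2Space d) x, v x⟫_ℂ = ∫ x, g x • v x := by
      refine integral_congr_ae ?_
      filter_upwards [χ.coeFn_toLp 2 volume] with x hx
      rw [hx, RCLike.inner_apply, hχ, Complex.conj_ofReal, Complex.real_smul, mul_comm]
    have h3 : ∫ x, starRingEnd ℂ (χ x) * W x = ∫ x, g x • W x := by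
      congr 1; funext x
      rw [hχ, Complex.conj_ofReal, Complex.real_smul]
    have hi1 := hvl.integrable_smul_left_of_hasCompactSupport hg.continuous hgc
    have hi2 := hWl.integrable_smul_left_of_hasCompactSupport hg.continuous hgc
    simp only [Pi.sub_apply, smul_sub]
    rw [integral_sub hi1 hi2, ← h2, ← h3, h1, sub_self]
  filter_upwards [h0] with x hx
  exact sub_eq_zero.mp hx

/-- If the Weyl quantization acts on Schwartz functions as a linear map into `L²`, then that map
gives the unbounded operator. -/
theorem weylOnSchwartz_spec {h : ℝ} {a : PhaseSpace d → ℂ}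
    {V : 𝓢(BaseSpace d, ℂ) →ₗ[ℂ] L2Space d}
    (hV : ∀ u : 𝓢(BaseSpace d, ℂ), ⇑(V u) =ᵐ[volume] weylQuantization h a u)
    (hV0 : ∀ u : 𝓢(BaseSpace d, ℂ), u.toLp 2 (volume : Measure (BaseSpace d)) = 0 → V u = 0)
    (p : L2Space d × L2Space d) :
    p ∈ (weylOnSchwartz h a).graph ↔ ∃ u : 𝓢(BaseSpace d, ℂ), (u.toLp 2 volume, V u) = p := by
  let T : 𝓢(BaseSpace d, ℂ) →ₗ[ℂ] L2Space d × L2Space d :=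
    (SchwartzMap.toLpCLM ℂ ℂ 2 (volume : Measure (BaseSpace d))).toLinearMap.prod V
  have hset : {p : L2Space d × L2Space d | ∃ φ : 𝓢(BaseSpace d, ℂ),
      p.1 = φ.toLp 2 volume ∧ ⇑p.2 =ᵐ[volume] weylQuantization h a φ} = (LinearMap.range T : Set _) := by
    ext p
    simp only [Set.mem_ofPred_eq, SetLike.mem_coe, LinearMap.mem_range]
    constructor
    · rintro ⟨φ, h1, h2⟩
      refine ⟨φ, Prod.ext h1.symm ?_⟩
      exact Lp.ext ((hV φ).trans h2.symm)
    · rintro ⟨φ, rfl⟩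
      exact ⟨φ, rfl, hV φ⟩
  -- The spanning set is already a subspace, the range of `T`. It is a graph because `hV0` makes it
  -- single valued.
  rw [weylOnSchwartz, hset, Submodule.span_eq, Submodule.toLinearPMap_graph_eq]
  · exact LinearMap.mem_range
  · rintro _ ⟨φ, rfl⟩ h0
    exact hV0 φ h0

/-- The Weyl quantization of a symbol with bounded derivatives of order two and more is a frame
operator for the dilated coherent states. -/
theorem exists_isFrameOperator_weyl {h : ℝ} {s : ℝˣ} (hs : 0 < (s : ℝ))
    (hh : (s : ℝ) ^ 2 = 2 * Real.pi * h) {q : PhaseSpace d → ℝ} (hq0 : ∀ ρ, 0 ≤ q ρ)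
    (hq : HasQuadraticGrowth fun ρ => q ((s : ℝ) • ρ)) {C : ℝ}
    (hr : ∀ z w, ‖remainderKernel (fun ρ => q ((s : ℝ) • ρ)) z w‖ ≤
      C * polyDecay (2 * d + 1) (z - w)) :
    ∃ R : L2Space d →L[ℂ] L2Space d,
      ‖R‖ ≤ C * ∫ z : PhaseSpace d, polyDecay (2 * d + 1) z ∧
      IsFrameOperator (stateVec s) (weylOnSchwartz h fun ρ => (q ρ : ℂ))
        (fun ρ => q ((s : ℝ) • ρ)) R := by
  set qs : PhaseSpace d → ℝ := fun ρ => q ((s : ℝ) • ρ) with hqs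
  have hqc := hq.contDiff.continuous
  have hframe := isParsevalFrame_stateVec (d := d) hs
  obtain ⟨R, hRs, hRn, hR⟩ := hframe.exists_clm_of_kernel (K := remainderKernel qs)
    (κ := fun z => C * polyDecay (2 * d + 1) z)
    (stronglyMeasurable_remainderKernel hqc).aestronglyMeasurable
    (conj_remainderKernel qs) (integrable_polyDecay_phase.const_mul C)
    (fun z => by simp only [polyDecay_neg]) hr
  rw [integral_const_mul] at hRn
  let V : 𝓢(BaseSpace d, ℂ) →ₗ[ℂ] L2Space d :=
    { toFun := fun u => toeplitzVec s qs u + R (u.toLp 2 volume)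
      map_add' := fun u v => by
        have h1 : toeplitzVec s qs (u + v) = toeplitzVec s qs u + toeplitzVec s qs v := by
          rw [toeplitzVec, toeplitzVec, toeplitzVec,
            ← integral_add (integrable_toeplitzVec hs hq u) (integrable_toeplitzVec hs hq v)]
          congr 1; funext z
          rw [toLp_add', inner_add_right, mul_add, add_smul]
        rw [h1, toLp_add', map_add]
        abel
      map_smul' := fun c u => by
        have h1 : toeplitzVec s qs (c • u) = c • toeplitzVec s qs u := by
          rw [toeplitzVec, toeplitzVec, ← integral_smul]
          congr 1; funext z
          rw [toLp_smul', inner_smul_right, smul_smul, mul_left_comm]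
        rw [h1, toLp_smul', map_smul, RingHom.id_apply, smul_add] }
  have hVdef : ∀ u, V u = toeplitzVec s qs u + R (u.toLp 2 volume) := fun u => rfl
  have hV : ∀ u : 𝓢(BaseSpace d, ℂ), ⇑(V u) =ᵐ[volume] weylQuantization h (fun ρ => (q ρ : ℂ)) u :=
    fun u => toeplitzVec_add_ae_eq hs hh hq u
      (integral_conj_mul_weylQuantization hs hh hq hr hR · u)
  have hV0 : ∀ u : 𝓢(BaseSpace d, ℂ), u.toLp 2 (volume : Measure (BaseSpace d)) = 0 → V u = 0 := by
    intro u hu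
    rw [hVdef, toeplitzVec, hu]
    simp
  have hspec := weylOnSchwartz_spec hV hV0
  have hdom : ∀ x : L2Space d, x ∈ (weylOnSchwartz h fun ρ => (q ρ : ℂ)).domain ↔
      ∃ u : 𝓢(BaseSpace d, ℂ), u.toLp 2 volume = x := by
    intro x
    rw [LinearPMap.mem_domain_iff]
    constructor
    · rintro ⟨y, hy⟩
      obtain ⟨u, hu⟩ := (hspec _).mp hy
      exact ⟨u, congrArg Prod.fst hu⟩
    · rintro ⟨u, rfl⟩
      exact ⟨V u, (hspec _).mpr ⟨u, rfl⟩⟩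
  have happ : ∀ x : (weylOnSchwartz h fun ρ => (q ρ : ℂ)).domain, ∃ u : 𝓢(BaseSpace d, ℂ),
      (x : L2Space d) = u.toLp 2 volume ∧ weylOnSchwartz h (fun ρ => (q ρ : ℂ)) x = V u := by
    intro x
    obtain ⟨u, hu⟩ := (hspec _).mp ((weylOnSchwartz h fun ρ => (q ρ : ℂ)).mem_graph x)
    exact ⟨u, (congrArg Prod.fst hu).symm, (congrArg Prod.snd hu).symm⟩
  refine ⟨R, hRn, hframe, ?_, fun z => (hdom _).mpr ⟨dilatedState s z, rfl⟩, hqc,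
    fun z => hq0 _, hRs, fun b x => ?_, fun b x => ?_⟩
  · refine denseRange_schwartz_toLp.mono ?_
    rintro _ ⟨u, rfl⟩
    exact (hdom _).mpr ⟨u, rfl⟩
  · obtain ⟨u, hu, -⟩ := happ x
    rw [hu]
    exact (inner_toeplitzVec hs hq u b).1
  · obtain ⟨u, hu, hxu⟩ := happ x
    rw [hxu, hu, hVdef, inner_add_right, (inner_toeplitzVec hs hq u b).2]

end WeylOnSchwartz
end

noncomputable section

/-! ### Bounds for symbols comparable with a squared distance -/

section SymbolBounds

variable {d : ℕ}

theorem norm_iteratedFDeriv_comp_smul_le {V : Type*} [NormedAddCommGroup V] [NormedSpace ℝ V]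
    {q : V → ℝ} (hq : ContDiff ℝ ∞ q) {s : ℝ} (hs : 0 ≤ s) (n : ℕ) (x : V) :
    ‖iteratedFDeriv ℝ n (fun y => q (s • y)) x‖ ≤ s ^ n * ‖iteratedFDeriv ℝ n q (s • x)‖ := by
  rw [iteratedFDeriv_comp_const_smul s (hq.of_le (by exact_mod_cast le_top)), norm_smul, norm_pow,
    Real.norm_of_nonneg hs]

/-- The left side is `s² (s/√q)^k`, and the hypothesis says that `s ≤ a √q`. -/
theorem Real.pow_mul_rpow_one_sub_half_le {s a q : ℝ} (hs : 0 ≤ s) (ha : 0 ≤ a) (hq : 0 < q)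
    (h : s ^ 2 ≤ a ^ 2 * q) (k : ℕ) :
    s ^ (k + 2) * q ^ (1 - ((k + 2 : ℕ) : ℝ) / 2) ≤ a ^ k * s ^ 2 := by
  have h1 : q ^ (1 - ((k + 2 : ℕ) : ℝ) / 2) = ((√q) ^ k)⁻¹ := by
    rw [Real.sqrt_eq_rpow, ← Real.rpow_natCast, ← Real.rpow_mul hq.le, ← Real.rpow_neg hq.le]
    congr 1; push_cast; ring
  have hsq : 0 < √q := Real.sqrt_pos.2 hq
  have h2 : s ≤ a * √q := by
    refine abs_le_of_sq_le_sq' ?_ (by positivity) |>.2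
    rw [mul_pow, Real.sq_sqrt hq.le]; exact h
  have h3 : s ^ k ≤ a ^ k * √q ^ k := by
    rw [← mul_pow]; exact pow_le_pow_left₀ hs h2 k
  rw [h1, pow_add, ← div_eq_mul_inv, div_le_iff₀ (by positivity)]
  nlinarith [sq_nonneg s, mul_le_mul_of_nonneg_right h3 (sq_nonneg s)]

variable {Γ : Set (PhaseSpace d)} {q : ℝ → ℝ → PhaseSpace d → ℝ}

namespace IsDistSymbol

/-- The weight is at least `h/h̃ ≥ h`, since `h̃ ≤ 1`. -/
theorem exists_bounds (hq : IsDistSymbol Γ q) : ∃ C : ℝ, 1 ≤ C ∧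
    ∀ h ht : ℝ, 0 < h → h ≤ ht → ht ≤ 1 → ∀ ρ, 0 < q h ht ρ ∧ h ≤ C * q h ht ρ ∧
      Metric.infDist ρ Γ ^ 2 ≤ C * q h ht ρ := by
  obtain ⟨C, hC, H⟩ := hq.comparable
  refine ⟨C, hC, fun h ht h0 hle h1 ρ => ?_⟩
  have hC0 : 0 < C := by linarith
  have hht : 0 < ht := h0.trans_le hle
  have h2 := (H h ht h0 hle h1 ρ).1
  rw [div_le_iff₀ hC0, distWeight] at h2
  have h3 : h ≤ h / ht := by
    rw [le_div_iff₀ hht]; nlinarith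
  have h4 := sq_nonneg (Metric.infDist ρ Γ)
  refine ⟨?_, by linarith, by linarith⟩
  by_contra! hn
  nlinarith

theorem contDiff (hq : IsDistSymbol Γ q) {h ht : ℝ} (h0 : 0 < h) (hle : h ≤ ht) (h1 : ht ≤ 1) :
    ContDiff ℝ ∞ (q h ht) :=
  hq.isHalfSymbol.1 h ht h0 hle h1

theorem contDiff_comp_smul (hq : IsDistSymbol Γ q) {h ht : ℝ} (h0 : 0 < h) (hle : h ≤ ht)
    (h1 : ht ≤ 1) (s : ℝ) : ContDiff ℝ ∞ fun ρ => q h ht (s • ρ) :=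
  (hq.contDiff h0 hle h1).comp (contDiff_const_smul s)

/-- Rescaling gains `s^n`, while differentiation costs `q^{1 - n/2}`. As `s² = 2πh` is at most a
constant times `q`, the product is `O(s²) = O(h)` once `n ≥ 2`. This uniform bound controls the
difference between the Weyl and Toeplitz operators. -/
theorem exists_norm_iteratedFDeriv_le (hq : IsDistSymbol Γ q) (n : ℕ) (hn : 2 ≤ n) :
    ∃ B : ℝ, 0 ≤ B ∧ ∀ h ht : ℝ, 0 < h → h ≤ ht → ht ≤ 1 → ∀ s : ℝ, 0 ≤ s →
      s ^ 2 = 2 * Real.pi * h → ∀ x, ‖iteratedFDeriv ℝ n (fun ρ => q h ht (s • ρ)) x‖ ≤ B * h := by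
  obtain ⟨C, hC, hb⟩ := hq.exists_bounds
  obtain ⟨D, hD⟩ := hq.deriv_bound n
  obtain ⟨k, rfl⟩ := Nat.exists_eq_add_of_le' hn
  have hπ := Real.pi_pos
  refine ⟨|D| * (√(2 * Real.pi * C) ^ k * (2 * Real.pi)), by positivity,
    fun h ht h0 hle h1 s hs hsh x => ?_⟩
  obtain ⟨hpos, hlow, -⟩ := hb h ht h0 hle h1 (s • x)
  have hk := Real.pow_mul_rpow_one_sub_half_le (a := √(2 * Real.pi * C)) hs (by positivity) hpos
    (by rw [Real.sq_sqrt (by positivity), hsh]; nlinarith) k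
  have hr : 0 ≤ q h ht (s • x) ^ (1 - ((k + 2 : ℕ) : ℝ) / 2) := Real.rpow_nonneg hpos.le _
  calc ‖iteratedFDeriv ℝ (k + 2) (fun ρ => q h ht (s • ρ)) x‖
      ≤ s ^ (k + 2) * ‖iteratedFDeriv ℝ (k + 2) (q h ht) (s • x)‖ :=
        norm_iteratedFDeriv_comp_smul_le (hq.contDiff h0 hle h1) hs _ _
    _ ≤ s ^ (k + 2) * (|D| * q h ht (s • x) ^ (1 - ((k + 2 : ℕ) : ℝ) / 2)) := by
        gcongr
        exact (hD h ht h0 hle h1 _).trans (mul_le_mul_of_nonneg_right (le_abs_self D) hr)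
    _ = |D| * (s ^ (k + 2) * q h ht (s • x) ^ (1 - ((k + 2 : ℕ) : ℝ) / 2)) := by ring
    _ ≤ |D| * (√(2 * Real.pi * C) ^ k * s ^ 2) := by gcongr
    _ = _ := by rw [hsh]; ring

theorem hasQuadraticGrowth (hq : IsDistSymbol Γ q) {h ht : ℝ} (h0 : 0 < h) (hle : h ≤ ht)
    (h1 : ht ≤ 1) {s : ℝ} (hs : 0 ≤ s) (hsh : s ^ 2 = 2 * Real.pi * h) :
    HasQuadraticGrowth fun ρ => q h ht (s • ρ) :=
  hasQuadraticGrowth_of_bounded (hq.contDiff_comp_smul h0 hle h1 s) fun n hn => by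
    obtain ⟨B, -, hB⟩ := hq.exists_norm_iteratedFDeriv_le n hn
    exact ⟨B * h, hB h ht h0 hle h1 s hs hsh⟩

/-- The Weyl quantization is the sum of a Toeplitz operator and a bounded operator of norm
`O(h)`. -/
theorem exists_isFrameOperator (hq : IsDistSymbol Γ q) : ∃ C : ℝ, 0 ≤ C ∧
    ∀ h ht : ℝ, 0 < h → h ≤ ht → ht ≤ 1 → ∀ s : ℝˣ, 0 < (s : ℝ) → (s : ℝ) ^ 2 = 2 * Real.pi * h →
      ∃ R : L2Space d →L[ℂ] L2Space d, ‖R‖ ≤ C * h ∧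
        IsFrameOperator (stateVec s) (weylOnSchwartz h fun ρ => (q h ht ρ : ℂ))
          (fun ρ => q h ht ((s : ℝ) • ρ)) R := by
  choose! B hB0 hB using hq.exists_norm_iteratedFDeriv_le
  obtain ⟨C, -, hb⟩ := hq.exists_bounds
  obtain ⟨A, hA, hr⟩ := exists_norm_remainderKernel_le d
  set M := ∑ k ∈ Finset.range (2 * d + 3), |B k|
  have hM : 0 ≤ M := Finset.sum_nonneg fun _ _ => abs_nonneg _
  have hI : 0 ≤ ∫ z : PhaseSpace d, polyDecay (2 * d + 1) z :=
    integral_nonneg fun z => polyDecay_nonneg _ z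
  refine ⟨A * M * ∫ z : PhaseSpace d, polyDecay (2 * d + 1) z, by positivity,
    fun h ht h0 hle h1 s hs hsh => ?_⟩
  have hg := hq.hasQuadraticGrowth h0 hle h1 hs.le hsh
  have hk := hr _ (M * h) hg (by positivity) fun k h2 hk x =>
    (hB k h2 h ht h0 hle h1 s hs.le hsh x).trans (mul_le_mul_of_nonneg_right
      ((le_abs_self _).trans (Finset.single_le_sum (f := fun k => |B k|)
        (fun _ _ => abs_nonneg _) (Finset.mem_range.2 (by omega)))) h0.le)
  obtain ⟨R, hR, hF⟩ := exists_isFrameOperator_weyl hs hsh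
    (fun ρ => (hb h ht h0 hle h1 ρ).1.le) hg hk
  exact ⟨R, hR.trans_eq (by ring), hF⟩

/-- `Γ` is bounded, so the distance to it grows linearly, and the symbol dominates a multiple of its
square. -/
theorem tendsto_cocompact (hq : IsDistSymbol Γ q) (hΓ : Bornology.IsBounded Γ) (hne : Γ.Nonempty)
    {h ht : ℝ} (h0 : 0 < h) (hle : h ≤ ht) (h1 : ht ≤ 1) {s : ℝ} (hs : 0 < s) :
    Tendsto (fun ρ => q h ht (s • ρ)) (cocompact (PhaseSpace d)) atTop := by
  obtain ⟨C, hC, hb⟩ := hq.exists_bounds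
  obtain ⟨r, hr⟩ := hΓ.exists_norm_le
  have hinf : ∀ ρ, s * ‖ρ‖ - r ≤ Metric.infDist (s • ρ) Γ := by
    intro ρ
    refine (Metric.le_infDist hne).2 fun y hy => ?_
    have h2 := norm_sub_norm_le (s • ρ) y
    rw [norm_smul, Real.norm_of_nonneg hs.le] at h2
    rw [dist_eq_norm]
    linarith [hr y hy]
  have ht1 : Tendsto (fun ρ : PhaseSpace d => s * ‖ρ‖ - r) (cocompact _) atTop :=
    tendsto_atTop_add_const_right _ _ ((tendsto_norm_cocompact_atTop (E := PhaseSpace d)).const_mul_atTop hs)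
  have ht2 := ((tendsto_pow_atTop (α := ℝ) two_ne_zero).comp
    (tendsto_atTop_mono hinf ht1)).atTop_div_const (show 0 < C by linarith)
  refine tendsto_atTop_mono (fun ρ => ?_) ht2
  rw [div_le_iff₀ (by linarith), mul_comm]
  exact (hb h ht h0 hle h1 _).2.2

/-- The rescaled symbol varies slowly in the sense of `IsFrameOperator.isSelfAdjoint_closure`: its
gradient is `O(√q)` and its Hessian is bounded, so its increment from `z` to `w` is at most `√q(z) +
1` times a quadratic polynomial in `‖z - w‖`. The Gaussian overlap absorbs the polynomial. Constants
may depend on `h` here, since the conclusion is qualitative. -/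
theorem isSelfAdjoint_weylOperator (hq : IsDistSymbol Γ q) (hΓ : Bornology.IsBounded Γ)
    (hne : Γ.Nonempty) {h ht : ℝ} (h0 : 0 < h) (hle : h ≤ ht) (h1 : ht ≤ 1) :
    IsSelfAdjoint (weylOperator h fun ρ => (q h ht ρ : ℂ)) ∧
    ∃ P : ProjectionValuedMeasure (L2Space d),
      P.IsSpectralMeasureOf (weylOperator h fun ρ => (q h ht ρ : ℂ)) := by
  have hs : 0 < √(2 * Real.pi * h) := Real.sqrt_pos.2 (by positivity)
  have hsh : √(2 * Real.pi * h) ^ 2 = 2 * Real.pi * h := Real.sq_sqrt (by positivity)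
  obtain ⟨_, _, hF⟩ := hq.exists_isFrameOperator
  obtain ⟨R, -, hF⟩ := hF h ht h0 hle h1 (Units.mk0 _ hs.ne') hs hsh
  obtain ⟨C, hC, hb⟩ := hq.exists_bounds
  obtain ⟨B, hB0, hB⟩ := hq.exists_norm_iteratedFDeriv_le 2 le_rfl
  obtain ⟨D, hD⟩ := hq.deriv_bound 1
  obtain ⟨E, hE, hexp⟩ := exists_exp_le_polyDecay (V := PhaseSpace d) (Real.pi / 2) (by positivity)
    (2 + (2 * d + 1))
  set s := √(2 * Real.pi * h) with hsdef
  set qs : PhaseSpace d → ℝ := fun ρ => q h ht (s • ρ) with hqs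
  have hqc := hq.contDiff_comp_smul h0 hle h1 s
  have hfd : ∀ z, ‖fderiv ℝ qs z‖ ≤ s * |D| * √(qs z) := by
    intro z
    have h2 := norm_iteratedFDeriv_comp_smul_le (hq.contDiff h0 hle h1) hs.le 1 z
    have h3 := hD h ht h0 hle h1 (s • z)
    rw [norm_iteratedFDeriv_one, pow_one] at h2
    rw [show (1 - ((1 : ℕ) : ℝ) / 2) = 1 / 2 by norm_num, ← Real.sqrt_eq_rpow] at h3
    calc _ ≤ _ := h2
      _ ≤ s * (|D| * √(qs z)) := by
        gcongr
        exact h3.trans (mul_le_mul_of_nonneg_right (le_abs_self D) (Real.sqrt_nonneg _))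
      _ = _ := by ring
  refine hF.isSelfAdjoint_closure
    (κ := fun x => (s * |D| + B * h) * E * polyDecay (2 * d + 1) x)
    (integrable_polyDecay_phase.const_mul _) (fun z => by rw [polyDecay_neg]) (fun z w => ?_)
    (hq.tendsto_cocompact hΓ hne h0 hle h1 hs)
  change ‖((qs w - qs z : ℝ) : ℂ) * _‖ ≤ (√(qs z) + 1) * _
  have hT := abs_taylorRemainder_le hqc (by positivity) (hB h ht h0 hle h1 s hs.le hsh) z (w - z)
  have hdiff : |qs w - qs z| ≤
      (√(qs z) + 1) * ((s * |D| + B * h) * (1 + ‖z - w‖) ^ 2) := by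
    have h2 : qs w - qs z = taylorRemainder qs z (w - z) + fderiv ℝ qs z (w - z) := by
      rw [taylorRemainder, add_sub_cancel]; ring
    have h3 : |fderiv ℝ qs z (w - z)| ≤ s * |D| * √(qs z) * ‖w - z‖ :=
      ((fderiv ℝ qs z).le_opNorm _).trans (by gcongr; exact hfd z)
    rw [h2]
    refine (abs_add_le _ _).trans ((add_le_add hT h3).trans ?_)
    rw [norm_sub_rev w z]
    have h4 := norm_nonneg (z - w)
    have h5 := Real.sqrt_nonneg (qs z)
    have h6 : 0 ≤ s * |D| := by positivity
    have h7 : 0 ≤ B * h := by positivity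
    have h8 : ‖z - w‖ ^ 2 ≤ (1 + ‖z - w‖) ^ 2 := by nlinarith
    have h9 : ‖z - w‖ ≤ (1 + ‖z - w‖) ^ 2 := by nlinarith
    calc B * h * ‖z - w‖ ^ 2 + s * |D| * √(qs z) * ‖z - w‖
        ≤ B * h * (1 + ‖z - w‖) ^ 2 + s * |D| * √(qs z) * (1 + ‖z - w‖) ^ 2 := by gcongr
      _ ≤ _ := by
        have : 0 ≤ (B * h * √(qs z) + s * |D|) * (1 + ‖z - w‖) ^ 2 := by positivity
        nlinarith
  rw [norm_mul, Complex.norm_real, Real.norm_eq_abs, inner_stateVec_stateVec hs, norm_overlap]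
  calc |qs w - qs z| * Real.exp (-(Real.pi / 2) * ‖z - w‖ ^ 2)
      ≤ ((√(qs z) + 1) * ((s * |D| + B * h) * (1 + ‖z - w‖) ^ 2)) *
        (E * polyDecay (2 + (2 * d + 1)) (z - w)) := by
        gcongr
        exact hexp _
    _ = (√(qs z) + 1) * ((s * |D| + B * h) * E *
        ((1 + ‖z - w‖) ^ 2 * polyDecay (2 + (2 * d + 1)) (z - w))) := by ring
    _ = _ := by rw [pow_mul_polyDecay_add]

end IsDistSymbol

end SymbolBounds

end

noncomputable section

/-! ### Volumes of tubes -/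

section Tubes

/-- The limsup controls the radii below some `δ`; for radii in `[δ, r]` the volume is at most that
of the `r`-tube and the power is bounded by compactness. All radii up to a fixed `r` are needed,
since `√(h/h̃)` is not small when `h` is comparable with `h̃`. -/
theorem exists_volume_thickening_le {X : Type*} [NormedAddCommGroup X] [InnerProductSpace ℝ X]
    [ProperSpace X] [MeasureSpace X] [IsFiniteMeasureOnCompacts (volume : Measure X)] {Γ : Set X}
    (hΓ : Bornology.IsBounded Γ) {γ : ℝ} (hγ : tubeLimsup Γ γ < ⊤) (r : ℝ) :
    ∃ C : ℝ, 0 ≤ C ∧ ∀ ε, 0 < ε → ε ≤ r →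
      volume (Metric.thickening ε Γ) ≤ ENNReal.ofReal (C * ε ^ γ) := by
  obtain ⟨b, hb, hbt⟩ := exists_between hγ
  have hev := eventually_lt_of_limsup_lt hb
  rw [eventually_nhdsWithin_iff, Metric.eventually_nhds_iff] at hev
  obtain ⟨δ, hδ, hev⟩ := hev
  have hfin : volume (Metric.thickening r Γ) < ⊤ := hΓ.thickening.measure_lt_top
  have hcont : ContinuousOn (fun ε : ℝ => ε ^ (-γ)) (Set.Icc δ r) := fun ε hε =>
    (Real.continuousAt_rpow_const _ _ (Or.inl (hδ.trans_le hε.1).ne')).continuousWithinAt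
  obtain ⟨M, hM⟩ := isCompact_Icc.exists_bound_of_continuousOn hcont
  set T := (volume (Metric.thickening r Γ)).toReal with hTdef
  refine ⟨b.toReal + |M| * T, by positivity, fun ε h0 hr => ?_⟩
  have hpos : 0 < ε ^ γ := Real.rpow_pos_of_pos h0 _
  have key : ENNReal.ofReal (ε ^ (-γ)) * volume (Metric.thickening ε Γ) ≤
      ENNReal.ofReal (b.toReal + |M| * T) := by
    rcases lt_or_ge ε δ with h | h
    · refine (hev (by rwa [Real.dist_eq, sub_zero, abs_of_pos h0]) h0).le.trans ?_
      rw [← ENNReal.ofReal_toReal hbt.ne]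
      exact ENNReal.ofReal_le_ofReal (by simp only [ENNReal.ofReal_toReal hbt.ne]; nlinarith [mul_nonneg (abs_nonneg M) (ENNReal.toReal_nonneg : 0 ≤ T)])
    · calc _ ≤ ENNReal.ofReal |M| * ENNReal.ofReal T := by
            gcongr
            · exact (le_abs_self _).trans ((hM ε ⟨h, hr⟩).trans (le_abs_self M))
            · rw [hTdef, ENNReal.ofReal_toReal hfin.ne]
              exact measure_mono (Metric.thickening_mono hr Γ)
        _ = ENNReal.ofReal (|M| * T) := (ENNReal.ofReal_mul (abs_nonneg M)).symm
        _ ≤ _ := ENNReal.ofReal_le_ofReal (by linarith [ENNReal.toReal_nonneg (a := b)])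
  calc volume (Metric.thickening ε Γ)
      = ENNReal.ofReal (ε ^ γ) * (ENNReal.ofReal (ε ^ (-γ)) * volume (Metric.thickening ε Γ)) := by
        rw [← mul_assoc, ← ENNReal.ofReal_mul hpos.le, Real.rpow_neg h0.le,
          mul_inv_cancel₀ hpos.ne', ENNReal.ofReal_one, one_mul]
    _ ≤ ENNReal.ofReal (ε ^ γ) * ENNReal.ofReal (b.toReal + |M| * T) := by gcongr
    _ = _ := by rw [← ENNReal.ofReal_mul hpos.le, mul_comm]

/-- The supremum need not be attained, but every smaller number is exceeded by an admissible
exponent. The admissible set is nonempty: it contains `0`, because tubes around a bounded set have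
finite volume. -/
theorem exists_lt_tubeLimsup_lt_top {X : Type*} [NormedAddCommGroup X] [InnerProductSpace ℝ X]
    [ProperSpace X] [MeasureSpace X] [IsFiniteMeasureOnCompacts (volume : Measure X)] {Γ : Set X}
    (hΓ : Bornology.IsBounded Γ) {a : ℝ} (ha : minkowskiDim Γ < Module.finrank ℝ X - a) :
    ∃ γ, a < γ ∧ tubeLimsup Γ γ < ⊤ := by
  have hne : {γ : ℝ | tubeLimsup Γ γ < ⊤}.Nonempty := by
    refine ⟨0, lt_of_le_of_lt (b := volume (Metric.thickening 1 Γ)) ?_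
      hΓ.thickening.measure_lt_top⟩
    refine limsup_le_of_le (h := ?_)
    filter_upwards [Ioo_mem_nhdsGT (zero_lt_one (α := ℝ))] with ε hε
    simpa using measure_mono (Metric.thickening_mono hε.2.le Γ)
  rw [minkowskiDim] at ha
  obtain ⟨γ, hγ, hlt⟩ := exists_lt_of_lt_csSup hne (show a < _ by linarith)
  exact ⟨γ, hlt, hγ⟩

end Tubes

/-! ### Counting eigenvalues -/

section Counting

variable {d : ℕ} {Γ : Set (PhaseSpace d)} {q : ℝ → ℝ → PhaseSpace d → ℝ}

theorem volume_preimage_smul_phaseSpace {s : ℝ} (hs : 0 < s) (S : Set (PhaseSpace d)) :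
    volume ((fun z => s • z) ⁻¹' S) = ENNReal.ofReal ((s ^ (2 * d))⁻¹) * volume S := by
  rw [Measure.addHaar_preimage_smul _ hs.ne', finrank_phaseSpace, abs_of_pos (by positivity)]

namespace IsDistSymbol

theorem sublevel_subset_thickening (hne : Γ.Nonempty) {f : PhaseSpace d → ℝ} {C : ℝ}
    (hf : ∀ ρ, Metric.infDist ρ Γ ^ 2 ≤ C * f ρ) (hC : 0 ≤ C) {t ε : ℝ} (hε : 0 < ε)
    (ht : C * t < ε ^ 2) : {ρ | f ρ ≤ t} ⊆ Metric.thickening ε Γ := by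
  intro ρ hρ
  rw [Metric.mem_thickening_iff_infDist_lt hne]
  refine lt_of_pow_lt_pow_left₀ 2 hε.le ?_
  have : f ρ ≤ t := hρ
  nlinarith [hf ρ]

/-- The remainder has norm at most `D h ≤ D h/h̃`, so it only changes `K` into `K + D` in the
threshold. The sublevel set of the rescaled symbol lies in a tube seen at scale `s`, whence the
factor `s^{-2d} = (2πh)^{-d}`. -/
theorem exists_finrank_lowSubspace_le (hq : IsDistSymbol Γ q) (hΓ : IsCompact Γ)
    (hne : Γ.Nonempty) {K : ℝ} (hK : 0 < K) : ∃ A : ℝ, 0 < A ∧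
    ∀ h ht : ℝ, 0 < h → h ≤ ht → ht ≤ 1 → ∀ P : ProjectionValuedMeasure (L2Space d),
      P.IsSpectralMeasureOf (weylOperator h fun ρ => (q h ht ρ : ℂ)) →
      FiniteDimensional ℂ (P.lowSubspace (K * h / ht)) ∧
      (Module.finrank ℂ (P.lowSubspace (K * h / ht)) : ℝ≥0∞) ≤
        2 * (ENNReal.ofReal (((2 * Real.pi * h) ^ d)⁻¹) *
          volume (Metric.thickening (A * √(h / ht)) Γ)) := by
  obtain ⟨C, hC, hb⟩ := hq.exists_bounds
  obtain ⟨D, hD, hF⟩ := hq.exists_isFrameOperator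
  have hA : 0 < 2 * C * (K + D) + 1 := by positivity
  -- The sublevel `2k` puts the squared distance below `2C(K + D) h/h̃`; the extra `1` makes the
  -- inequality strict, as the open thickening requires.
  refine ⟨√(2 * C * (K + D) + 1), Real.sqrt_pos.2 hA, fun h ht h0 hle h1 P hP => ?_⟩
  have hht : 0 < ht := h0.trans_le hle
  have hs : 0 < √(2 * Real.pi * h) := Real.sqrt_pos.2 (by positivity)
  have hsh : √(2 * Real.pi * h) ^ 2 = 2 * Real.pi * h := Real.sq_sqrt (by positivity)
  obtain ⟨R, hR, hF⟩ := hF h ht h0 hle h1 (Units.mk0 _ hs.ne') hs hsh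
  set s := √(2 * Real.pi * h) with hsdef
  have hx : 0 < h / ht := div_pos h0 hht
  have hhx : h ≤ h / ht := by rw [le_div_iff₀ hht]; nlinarith
  set k := (K + D) * (h / ht) with hk
  have hk0 : 0 < k := by positivity
  have hck : K * h / ht + ‖R‖ ≤ k := by
    rw [hk, mul_div_assoc, add_mul]; nlinarith
  have hε : 0 < √(2 * C * (K + D) + 1) * √(h / ht) := by positivity
  have hsub : {z | q h ht (s • z) ≤ 2 * k} ⊆
      (fun z => s • z) ⁻¹' Metric.thickening (√(2 * C * (K + D) + 1) * √(h / ht)) Γ := by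
    intro z hz
    refine sublevel_subset_thickening (t := 2 * k) hne (fun ρ => (hb h ht h0 hle h1 ρ).2.2)
      (by linarith) hε ?_ hz
    rw [mul_pow, Real.sq_sqrt hA.le, Real.sq_sqrt hx.le, hk]
    linarith
  have hvol : volume {z | q h ht (s • z) ≤ 2 * k} ≤ ENNReal.ofReal (((2 * Real.pi * h) ^ d)⁻¹) *
      volume (Metric.thickening (√(2 * C * (K + D) + 1) * √(h / ht)) Γ) := by
    refine (measure_mono hsub).trans_eq ?_
    rw [volume_preimage_smul_phaseSpace hs, pow_mul, hsh]
  have hfin : volume {z | q h ht (s • z) ≤ 2 * k} < ⊤ :=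
    hvol.trans_lt (ENNReal.mul_lt_top ENNReal.ofReal_lt_top
      hΓ.isBounded.thickening.measure_lt_top)
  obtain ⟨h2, h3⟩ := hF.finrank_lowSubspace_le hP hk0 hck hfin
  exact ⟨h2, h3.trans (by gcongr; exact hvol)⟩

theorem exists_finrank_lowSubspace_le_of_tubeLimsup (hq : IsDistSymbol Γ q) (hΓ : IsCompact Γ)
    (hne : Γ.Nonempty) {K : ℝ} (hK : 0 < K) {γ μ : ℝ} (hγ : tubeLimsup Γ γ < ⊤)
    (hμ : 2 * d - 2 * μ ≤ γ) : ∃ C : ℝ,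
    ∀ h ht : ℝ, 0 < h → h ≤ ht → ht ≤ 1 → ∀ P : ProjectionValuedMeasure (L2Space d),
      P.IsSpectralMeasureOf (weylOperator h fun ρ => (q h ht ρ : ℂ)) →
      (Module.finrank ℂ (P.lowSubspace (K * h / ht)) : ℝ) ≤ C * (ht ^ d)⁻¹ * (ht / h) ^ μ := by
  obtain ⟨A, hA, hfr⟩ := hq.exists_finrank_lowSubspace_le hΓ hne hK
  obtain ⟨B, hB, hvol⟩ := exists_volume_thickening_le hΓ.isBounded hγ A
  have hπ := Real.pi_pos
  refine ⟨2 * ((2 * Real.pi) ^ d)⁻¹ * (B * A ^ γ), fun h ht h0 hle h1 P hP => ?_⟩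
  have hht : 0 < ht := h0.trans_le hle
  have hx : 0 < h / ht := div_pos h0 hht
  have hx1 : h / ht ≤ 1 := (div_le_one hht).2 hle
  have hsx : √(h / ht) ≤ 1 := Real.sqrt_le_one.2 hx1
  have hv := hvol (A * √(h / ht)) (by positivity) (by nlinarith)
  have hAγ : 0 < A ^ γ := Real.rpow_pos_of_pos hA _
  have hbound : (Module.finrank ℂ (P.lowSubspace (K * h / ht)) : ℝ) ≤
      2 * (((2 * Real.pi * h) ^ d)⁻¹ * (B * (A * √(h / ht)) ^ γ)) := by
    have h2 := (hfr h ht h0 hle h1 P hP).2.trans (mul_le_mul_right (mul_le_mul_right hv _) 2)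
    generalize Module.finrank ℂ (P.lowSubspace (K * h / ht)) = n at h2 ⊢
    rw [← ENNReal.ofReal_mul (by positivity), ← ENNReal.ofReal_ofNat 2,
      ← ENNReal.ofReal_mul (by norm_num), ← ENNReal.ofReal_natCast] at h2
    exact (ENNReal.ofReal_le_ofReal_iff (by positivity)).1 h2
  refine hbound.trans ?_
  -- Since `h/h̃ ≤ 1`, the exponent `γ/2` may be lowered to `d - μ`. The factor `(h/h̃)^d` then
  -- combines with `h^{-d}` into `h̃^{-d}`.
  have hp : √(h / ht) ^ γ ≤ (h / ht) ^ d * (ht / h) ^ μ := by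
    have e1 : √(h / ht) ^ γ = (h / ht) ^ (γ / 2) := by
      rw [Real.sqrt_eq_rpow, ← Real.rpow_mul hx.le]; congr 1; ring
    have e2 : (ht / h) ^ μ = (h / ht) ^ (-μ) := by
      rw [Real.rpow_neg hx.le, ← Real.inv_rpow hx.le, inv_div]
    rw [e1, e2, ← Real.rpow_natCast, ← Real.rpow_add hx]
    exact Real.rpow_le_rpow_of_exponent_ge hx hx1 (by linarith)
  rw [Real.mul_rpow hA.le (Real.sqrt_nonneg _)]
  calc 2 * (((2 * Real.pi * h) ^ d)⁻¹ * (B * (A ^ γ * √(h / ht) ^ γ)))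
      ≤ 2 * (((2 * Real.pi * h) ^ d)⁻¹ * (B * (A ^ γ * ((h / ht) ^ d * (ht / h) ^ μ)))) := by
        gcongr
    _ = _ := by
        rw [mul_pow _ h, div_pow]
        field_simp

end IsDistSymbol

end Counting

end

/-! ### The main theorem. -/

noncomputable section

theorem lemmal (d : ℕ) (Γ : Set (PhaseSpace d)) (hΓ : IsCompact Γ) (hΓne : Γ.Nonempty)
    (μ₀ : ℝ) (hμ₀ : minkowskiDim Γ = 2 * μ₀)
    (q : ℝ → ℝ → PhaseSpace d → ℝ) (hq : IsDistSymbol Γ q) (K : ℝ) (hK : 0 < K) :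
    ∃ ht₀ : ℝ, 0 < ht₀ ∧ ht₀ ≤ 1 ∧
      (∀ h ht : ℝ, 0 < h → h ≤ ht → ht ≤ ht₀ →
        IsSelfAdjoint (weylOperator h (fun ρ => (q h ht ρ : ℂ))) ∧
        (∃ P : ProjectionValuedMeasure (L2Space d),
          P.IsSpectralMeasureOf (weylOperator h (fun ρ => (q h ht ρ : ℂ)))) ∧
        ∀ P : ProjectionValuedMeasure (L2Space d),
          P.IsSpectralMeasureOf (weylOperator h (fun ρ => (q h ht ρ : ℂ))) →
          FiniteDimensional ℂ (P.lowSubspace (K * h / ht))) ∧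
      (∀ μ : ℝ, μ₀ < μ → ∃ C : ℝ, ∀ h ht : ℝ, 0 < h → h ≤ ht → ht ≤ ht₀ →
        ∀ P : ProjectionValuedMeasure (L2Space d),
          P.IsSpectralMeasureOf (weylOperator h (fun ρ => (q h ht ρ : ℂ))) →
          (Module.finrank ℂ (P.lowSubspace (K * h / ht)) : ℝ) ≤ C * (ht ^ d)⁻¹ * (ht / h) ^ μ) ∧
      (IsPureDimensional Γ → ∃ C : ℝ, ∀ h ht : ℝ, 0 < h → h ≤ ht → ht ≤ ht₀ →
        ∀ P : ProjectionValuedMeasure (L2Space d),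
          P.IsSpectralMeasureOf (weylOperator h (fun ρ => (q h ht ρ : ℂ))) →
          (Module.finrank ℂ (P.lowSubspace (K * h / ht)) : ℝ) ≤ C * (ht ^ d)⁻¹ * (ht / h) ^ μ₀) := by
  have hdim : (Module.finrank ℝ (PhaseSpace d) : ℝ) = 2 * d := by
    rw [finrank_phaseSpace]; push_cast; ring
  -- The remainder is `O(h)`, and comparing it with `h/h̃` only requires `h̃ ≤ 1`; no further
  -- smallness is needed.
  refine ⟨1, one_pos, le_rfl, fun h ht h0 hle h1 => ?_, fun μ hμ => ?_, fun hpure => ?_⟩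
  · obtain ⟨hsa, hP⟩ := hq.isSelfAdjoint_weylOperator hΓ.isBounded hΓne h0 hle h1
    obtain ⟨A, -, hA⟩ := hq.exists_finrank_lowSubspace_le hΓ hΓne hK
    exact ⟨hsa, hP, fun P hP => (hA h ht h0 hle h1 P hP).1⟩
  · obtain ⟨γ, hlt, hγ⟩ := exists_lt_tubeLimsup_lt_top hΓ.isBounded (a := 2 * d - 2 * μ)
      (by rw [hμ₀, hdim]; linarith)
    exact hq.exists_finrank_lowSubspace_le_of_tubeLimsup hΓ hΓne hK hγ hlt.le
  · exact hq.exists_finrank_lowSubspace_le_of_tubeLimsup hΓ hΓne hK hpure (by rw [hμ₀, hdim])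

end
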